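/- Let $\alpha>0$, let $r\in C(0,\infty)$ with $r(x)>0$ for all $x>0$ and $\int_1^\infty\frac{d\tau}{r(\tau)}=+\infty$, let $0\le a\in L^1_{loc}(0,\infty)$, and let $b\ge 0$ be a measurable kernel on $(0,\infty)^2$ with $b(x,y)=0$ for $x\ge y$ and $\int_0^y x\,b(x,y)\,dx=y$ for all $y>0$. Consider one of the following two settings. (A) $\int_0^1\frac{d\tau}{r(\tau)}<+\infty$, the weight is $w(x)=(1+x)^\alpha$, and $r(z)\le C(1+z)$ for all $z>0$ and some $C>0$. (B) $\int_0^1\frac{d\tau}{r(\tau)}=+\infty$, the weight is $w(x)=x^\alpha$, and $r(z)\le Cz$ for all $z>0$ and some $C>0$. Let $X=L^1((0,\infty);w(x)\,dx)$ (real-valued functions; $X=X_{0,\alpha}$ in (A), $X=X_\alpha$ in (B)), and put $n(y)=\int_0^y w(x)b(x,y)\,dx$. Assume $$\sup_{y>0}\frac{n(y)}{w(y)}<\infty,\qquad \limsup_{a(y)\to+\infty}\frac{n(y)}{w(y)}:=\lim_{c\to+\infty}\ \sup_{\{y>0:\,a(y)\ge c\}}\frac{n(y)}{w(y)}<1$$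 (a supremum over the empty set is $0$). Supports being essential supports (with respect to Lebesgue measure), assume moreover that one of the following holds: 1. for every $x>0$ the support of $y\mapsto a(y)b(x,y)$ is unbounded; 2. $a(y)>0$ for almost every $y>0$, and there is $p\in[0,1)$ such that $\inf\operatorname{supp} b(\cdot,y)\le p\,y$ for every $y>0$. Then the formula $$(U(t)f)(y)=\chi_{\{\int_0^y\frac{d\tau}{r(\tau)}>t\}}\;e^{-\int_{X(y,t)}^y\frac{a(\tau)}{r(\tau)}d\tau}\;\frac{r(X(y,t))\,f(X(y,t))}{r(y)},\qquad \int_{X(y,t)}^y\frac{d\tau}{r(\tau)}=t,$$ defines a $C_0$-semigroup $(U(t))_{t\ge0}$ on $X$. Let $T$ be its generator. The fragmentation operator $(B\varphi)(x)=\int_x^\infty a(y)b(x,y)\varphi(y)\,dy$ maps $D(T)$ into $X$, and $T+B$ with domain $D(T)$ generates a positive $C_0$-semigroup $(V(t))_{t\ge0}$ on $X$. The resolvent set of $T+B$ contains a half-line $(\omega,\infty)$, and for every real $\lambda$ with $[\lambda,\infty)\subset\rho(T+B)$ (in particular for every $\lambda$ larger than the spectral bound of $T+B$) the resolvent $(\lambda-T-B)^{-1}$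 is positivity improving: $(\lambda-T-B)^{-1}g>0$ almost everywhere for every nontrivial nonnegative $g\in X$. Moreover $(V(t))_{t\ge0}$ is irreducible: the only closed ideals of the Banach lattice $X$ that are invariant under all $V(t)$ are $\{0\}$ and $X$. -/

import Mathlib

open MeasureTheory Filter Topology Set
open scoped NNReal ENNReal

/-! ### Strongly continuous semigroups, generators, resolvents -/

/-- A strongly continuous semigroup of bounded linear operators on a real normed space. -/
structure C0Semigroup (E : Type*) [NormedAddCommGroup E] [NormedSpace ℝ E] where
  toFun : ℝ≥0 → E →L[ℝ] E
  map_zero : toFun 0 = ContinuousLinearMap.id ℝ E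
  map_add : ∀ s t, toFun (s + t) = (toFun s).comp (toFun t)
  continuous_orbit : ∀ f, Continuous fun t => toFun t f

namespace C0Semigroup

variable {E : Type*} [NormedAddCommGroup E] [NormedSpace ℝ E]

/-- `f` lies in the domain of the generator with value `g`, that is
`(S(t) f - f) / t → g` in norm as `t → 0⁺`. -/
def GeneratorRel (S : C0Semigroup E) (f g : E) : Prop :=
  Tendsto (fun t : ℝ≥0 => (t : ℝ)⁻¹ • (S.toFun t f - f)) (𝓝[>] 0) (𝓝 g)

theorem GeneratorRel.unique {S : C0Semigroup E} {f g g' : E}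
    (h : S.GeneratorRel f g) (h' : S.GeneratorRel f g') : g = g' :=
  tendsto_nhds_unique h h'

theorem GeneratorRel.add {S : C0Semigroup E} {f g f' g' : E}
    (h : S.GeneratorRel f g) (h' : S.GeneratorRel f' g') :
    S.GeneratorRel (f + f') (g + g') := by
  refine (Tendsto.add h h').congr fun t => ?_
  rw [← smul_add, _root_.map_add]
  congr 1
  abel

theorem GeneratorRel.smul {S : C0Semigroup E} {f g : E} (k : ℝ)
    (h : S.GeneratorRel f g) : S.GeneratorRel (k • f) (k • g) := by
  refine (Tendsto.const_smul h k).congr fun t => ?_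
  rw [smul_comm, smul_sub, _root_.map_smul]

theorem GeneratorRel.zero (S : C0Semigroup E) : S.GeneratorRel 0 0 := by
  simp [GeneratorRel]

/-- The (infinitesimal) generator of a strongly continuous semigroup, on its full domain. -/
noncomputable def generator (S : C0Semigroup E) : E →ₗ.[ℝ] E where
  domain :=
    { carrier := {f | ∃ g, S.GeneratorRel f g}
      add_mem' := fun ⟨_, h⟩ ⟨_, h'⟩ => ⟨_, h.add h'⟩
      zero_mem' := ⟨0, GeneratorRel.zero S⟩
      smul_mem' := fun k _ ⟨_, h⟩ => ⟨_, h.smul k⟩ }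
  toFun :=
    { toFun := fun f => f.2.choose
      map_add' := fun f f' =>
        (f + f').2.choose_spec.unique (f.2.choose_spec.add f'.2.choose_spec)
      map_smul' := fun k f =>
        (k • f).2.choose_spec.unique (f.2.choose_spec.smul k) }

theorem generatorRel_generator (S : C0Semigroup E) (f : S.generator.domain) :
    S.GeneratorRel f (S.generator f) :=
  f.2.choose_spec

/-- Every operator of the semigroup maps the positive cone into itself. -/
def IsPositive [Lattice E] (S : C0Semigroup E) : Prop :=
  ∀ t f, 0 ≤ f → 0 ≤ S.toFun t f

/-- Irreducibility: the only closed lattice ideals that are invariant under all operators of the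
semigroup are `{0}` and the whole space. -/
def IsIrreducible [Lattice E] (S : C0Semigroup E) : Prop :=
  ∀ J : Submodule ℝ E, IsClosed (J : Set E) →
    (∀ f ∈ J, ∀ g, |g| ≤ |f| → g ∈ J) →
    (∀ t, ∀ f ∈ J, S.toFun t f ∈ J) → J = ⊥ ∨ J = ⊤

end C0Semigroup

/-- `R = (l - A)⁻¹` as a bounded, everywhere defined operator. -/
def IsResolvent {E : Type*} [NormedAddCommGroup E] [NormedSpace ℝ E]
    (A : E →ₗ.[ℝ] E) (l : ℝ) (R : E →L[ℝ] E) : Prop :=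
  (∀ f, ∃ h : R f ∈ A.domain, l • R f - A ⟨R f, h⟩ = f) ∧
    ∀ f : A.domain, R (l • (f : E) - A f) = f

/-- The set of real `l` such that `l - A` has a bounded inverse. -/
def realResolventSet {E : Type*} [NormedAddCommGroup E] [NormedSpace ℝ E]
    (A : E →ₗ.[ℝ] E) : Set ℝ :=
  {l | ∃ R : E →L[ℝ] E, IsResolvent A l R}

/-! ### Moment spaces -/

/-- The weight `(c + x) ^ α`; `c = 1` and `c = 0` are the cases of interest. -/
noncomputable def weight (c : ℝ≥0) (α x : ℝ) : ℝ := (c + x) ^ α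

/-- The measure `(c + x) ^ α dx` on `(0, ∞)`. -/
noncomputable def momentMeasure (c : ℝ≥0) (α : ℝ) : Measure ℝ :=
  (volume.restrict (Ioi 0)).withDensity fun x => ENNReal.ofReal (weight c α x)

/-- `L¹((0, ∞); (c + x) ^ α dx)`: this is `X_{0,α}` for `c = 1` and `X_α` for `c = 0`. -/
abbrev MomentSpace (c : ℝ≥0) (α : ℝ) : Type := Lp ℝ 1 (momentMeasure c α)

theorem weight_pos (c : ℝ≥0) (α : ℝ) {x : ℝ} (hx : 0 < x) : 0 < weight c α x :=
  Real.rpow_pos_of_pos (add_pos_of_nonneg_of_pos c.2 hx) α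

theorem ae_momentMeasure_iff (c : ℝ≥0) (α : ℝ) {P : ℝ → Prop} :
    (∀ᵐ x ∂momentMeasure c α, P x) ↔ ∀ᵐ x ∂volume.restrict (Ioi 0), P x := by
  have hm : Measurable fun x : ℝ => ENNReal.ofReal (weight c α x) := by
    unfold weight; fun_prop
  rw [momentMeasure, ae_withDensity_iff hm]
  refine eventually_congr ?_
  filter_upwards [ae_restrict_mem measurableSet_Ioi] with x hx
  have : ENNReal.ofReal (weight c α x) ≠ 0 := by
    simpa using weight_pos c α hx
  simp [this]

theorem ae_restrict_of_ae_momentMeasure {c : ℝ≥0} {α : ℝ} {P : ℝ → Prop}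
    (h : ∀ᵐ x ∂momentMeasure c α, P x) {x : ℝ} (hx : 0 < x) :
    ∀ᵐ y ∂volume.restrict (Ioi x), P y :=
  ae_restrict_of_ae_restrict_of_subset (Ioi_subset_Ioi hx.le) ((ae_momentMeasure_iff c α).1 h)

theorem ae_momentMeasure_pos (c : ℝ≥0) (α : ℝ) : ∀ᵐ x ∂momentMeasure c α, 0 < x :=
  (ae_momentMeasure_iff c α).2 (ae_restrict_mem measurableSet_Ioi)

/-- `R` maps every nontrivial nonnegative `g` to a function that is positive almost everywhere. -/
def IsPositivityImproving {c : ℝ≥0} {α : ℝ}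
    (R : MomentSpace c α →L[ℝ] MomentSpace c α) : Prop :=
  ∀ g, 0 ≤ g → g ≠ 0 → ∀ᵐ x ∂momentMeasure c α, 0 < (R g : ℝ → ℝ) x

/-! ### Growth and fragmentation -/

/-- The semigroup `U` is the one that solves `∂ₜu + ∂ₓ(r u) + a u = 0` along characteristics:
`(U(t) f)(y) = exp (-∫_x^y a / r) * r(x) f(x) / r(y)`, where `x = X(y, t) ∈ (0, y]` is the point with
`∫_x^y 1 / r = t` if `∫_0^y 1 / r > t`, and `(U(t) f)(y) = 0` otherwise. -/
def IsGrowthAbsorptionSemigroup {c : ℝ≥0} {α : ℝ} (r a : ℝ → ℝ)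
    (U : C0Semigroup (MomentSpace c α)) : Prop :=
  ∀ (t : ℝ≥0) (f : MomentSpace c α), ∀ᵐ y ∂momentMeasure c α,
    ((∫⁻ τ in Ioo 0 y, ENNReal.ofReal (1 / r τ)) ≤ t → (U.toFun t f : ℝ → ℝ) y = 0) ∧
    ∀ x ∈ Ioc 0 y, ∫ τ in x..y, 1 / r τ = t →
      (U.toFun t f : ℝ → ℝ) y = Real.exp (-∫ τ in x..y, a τ / r τ) * (r x * f x / r y)

/-- The function `x ↦ ∫_x^∞ a(y) b(x, y) f(y) dy`. -/
noncomputable def fragmentationFun (a : ℝ → ℝ) (b : ℝ → ℝ → ℝ) (f : ℝ → ℝ) (x : ℝ) : ℝ :=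
  ∫ y in Ioi x, a y * b x y * f y

theorem integrand_add {c : ℝ≥0} {α : ℝ} (a : ℝ → ℝ) (b : ℝ → ℝ → ℝ) (f g : MomentSpace c α)
    {x : ℝ} (hx : 0 < x) : (fun y => a y * b x y * (f + g : MomentSpace c α) y)
      =ᵐ[volume.restrict (Ioi x)] fun y => a y * b x y * f y + a y * b x y * g y := by
  filter_upwards [ae_restrict_of_ae_momentMeasure (Lp.coeFn_add f g) hx] with y hy
  rw [hy, Pi.add_apply, mul_add]

theorem integrand_smul {c : ℝ≥0} {α : ℝ} (a : ℝ → ℝ) (b : ℝ → ℝ → ℝ) (k : ℝ)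
    (f : MomentSpace c α) {x : ℝ} (hx : 0 < x) :
    (fun y => a y * b x y * (k • f : MomentSpace c α) y)
      =ᵐ[volume.restrict (Ioi x)] fun y => k * (a y * b x y * f y) := by
  filter_upwards [ae_restrict_of_ae_momentMeasure (Lp.coeFn_smul k f) hx] with y hy
  rw [hy, Pi.smul_apply, smul_eq_mul]
  ring

/-- The integral defining `B f` converges absolutely for almost every `x > 0`, and `B f` belongs to
the moment space. -/
def InFragmentationDomain (c : ℝ≥0) (α : ℝ) (a : ℝ → ℝ) (b : ℝ → ℝ → ℝ)
    (f : MomentSpace c α) : Prop :=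
  (∀ᵐ x ∂momentMeasure c α, IntegrableOn (fun y => a y * b x y * f y) (Ioi x)) ∧
    MemLp (fragmentationFun a b f) 1 (momentMeasure c α)

theorem fragmentationFun_add {c : ℝ≥0} {α : ℝ} {a : ℝ → ℝ} {b : ℝ → ℝ → ℝ}
    {f g : MomentSpace c α} (hf : InFragmentationDomain c α a b f)
    (hg : InFragmentationDomain c α a b g) :
    fragmentationFun a b (f + g : MomentSpace c α) =ᵐ[momentMeasure c α]
      fragmentationFun a b f + fragmentationFun a b g := by
  filter_upwards [hf.1, hg.1, ae_momentMeasure_pos c α] with x h1 h2 hx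
  simp only [fragmentationFun, Pi.add_apply]
  rw [integral_congr_ae (integrand_add a b f g hx), integral_add h1 h2]

theorem fragmentationFun_smul {c : ℝ≥0} {α : ℝ} (a : ℝ → ℝ) (b : ℝ → ℝ → ℝ) (k : ℝ)
    (f : MomentSpace c α) :
    fragmentationFun a b (k • f : MomentSpace c α) =ᵐ[momentMeasure c α]
      k • fragmentationFun a b f := by
  filter_upwards [ae_momentMeasure_pos c α] with x hx
  simp only [fragmentationFun, Pi.smul_apply, smul_eq_mul]
  rw [integral_congr_ae (integrand_smul a b k f hx), integral_const_mul]

theorem InFragmentationDomain.add {c : ℝ≥0} {α : ℝ} {a : ℝ → ℝ} {b : ℝ → ℝ → ℝ}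
    {f g : MomentSpace c α} (hf : InFragmentationDomain c α a b f)
    (hg : InFragmentationDomain c α a b g) : InFragmentationDomain c α a b (f + g) := by
  refine ⟨?_, (hf.2.add hg.2).ae_eq (fragmentationFun_add hf hg).symm⟩
  filter_upwards [hf.1, hg.1, ae_momentMeasure_pos c α] with x h1 h2 hx
  exact (Integrable.add h1 h2).congr (integrand_add a b f g hx).symm

theorem InFragmentationDomain.smul {c : ℝ≥0} {α : ℝ} {a : ℝ → ℝ} {b : ℝ → ℝ → ℝ} (k : ℝ)
    {f : MomentSpace c α} (hf : InFragmentationDomain c α a b f) :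
    InFragmentationDomain c α a b (k • f) := by
  refine ⟨?_, (hf.2.const_smul k).ae_eq (fragmentationFun_smul a b k f).symm⟩
  filter_upwards [hf.1, ae_momentMeasure_pos c α] with x h1 hx
  exact (Integrable.const_mul h1 k).congr (integrand_smul a b k f hx).symm

theorem InFragmentationDomain.zero (c : ℝ≥0) (α : ℝ) (a : ℝ → ℝ) (b : ℝ → ℝ → ℝ) :
    InFragmentationDomain c α a b 0 := by
  have key : ∀ x : ℝ, 0 < x → (fun y => a y * b x y * (0 : MomentSpace c α) y)
      =ᵐ[volume.restrict (Ioi x)] fun _ => 0 := by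
    intro x hx
    filter_upwards [ae_restrict_of_ae_momentMeasure
      (Lp.coeFn_zero ℝ 1 (momentMeasure c α)) hx] with y hy
    rw [hy, Pi.zero_apply, mul_zero]
  constructor
  · filter_upwards [ae_momentMeasure_pos c α] with x hx
    exact (integrable_zero _ _ _).congr (key x hx).symm
  · refine (MemLp.zero' (μ := momentMeasure c α)).ae_eq ?_
    filter_upwards [ae_momentMeasure_pos c α] with x hx
    rw [fragmentationFun, integral_congr_ae (key x hx), integral_zero]

/-- The fragmentation operator `(B f)(x) = ∫_x^∞ a(y) b(x, y) f(y) dy` on its maximal domain. -/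
noncomputable def fragmentation (c : ℝ≥0) (α : ℝ) (a : ℝ → ℝ) (b : ℝ → ℝ → ℝ) :
    MomentSpace c α →ₗ.[ℝ] MomentSpace c α where
  domain :=
    { carrier := {f | InFragmentationDomain c α a b f}
      add_mem' := fun hf hg => InFragmentationDomain.add hf hg
      zero_mem' := InFragmentationDomain.zero c α a b
      smul_mem' := fun k _ hf => InFragmentationDomain.smul k hf }
  toFun :=
    { toFun := fun f => MemLp.toLp (fragmentationFun a b f) f.2.2
      map_add' := fun f g =>
        (MemLp.toLp_congr _ (f.2.2.add g.2.2) (fragmentationFun_add f.2 g.2)).trans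
          (MemLp.toLp_add f.2.2 g.2.2)
      map_smul' := fun k f =>
        (MemLp.toLp_congr _ (f.2.2.const_smul k)
          (fragmentationFun_smul a b k (f : MomentSpace c α))).trans
          (MemLp.toLp_const_smul k f.2.2) }

/-- `y ↦ (c + y) ^ (-α) * ∫_0^y (c + x) ^ α b(x, y) dx`, with values in `[0, ∞]`. -/
noncomputable def momentRatio (c : ℝ≥0) (α : ℝ) (b : ℝ → ℝ → ℝ) (y : ℝ) : ℝ≥0∞ :=
  (∫⁻ x in Ioo 0 y, ENNReal.ofReal (weight c α x * b x y)) / ENNReal.ofReal (weight c α y)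

/-- The (essential) support of a function on `(0, ∞)` given up to null sets: the points all of whose
neighbourhoods meet `{z > 0 | f z ≠ 0}` in a set of positive measure. -/
def essSupport (f : ℝ → ℝ) : Set ℝ :=
  {x | ∀ N ∈ 𝓝 x, 0 < volume (N ∩ {z | 0 < z ∧ f z ≠ 0})}

/-!
In the time variable `ρ(y) = ∫₁^y dτ / r(τ)` growth is translation, so the semigroup `U` and the
resolvent of its generator `T` are explicit (`IsGrowthRate.exists_growthSemigroup`,
`IsGrowthRate.ofReal_resolvent_apply`): with `q(y) = exp (-∫₁^y a / r) / r(y)`,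
`(R_l f)(y) = e^{-l ρ(y)} q(y) ∫_0^y e^{l ρ(x)} f(x) / (r(x) q(x)) dx`. Since `r(z) ≤ C (c + z)`, the
weight grows along characteristics at most like `e^{K t}` with `K = α C`, and this formula gives
the dissipativity estimate `‖a R_l f‖ + (l - K) ‖R_l f‖ ≤ ‖f‖` for `f ≥ 0`
(`IsGrowthRate.lintegral_resolvent_le`).

The conditions on `n / w` say that `a n / w ≤ θ a + D` for some `θ < 1`
(`exists_mul_momentRatio_le`). As `‖B u‖ ≤ ∫ a u n` for `u ≥ 0`, it follows that `B` is defined on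
`D(T)` and that, for large `l`, both `‖B R_l‖ ≤ θ` and `‖B R_l f‖ + (l - ω) ‖R_l f‖ ≤ ‖f‖` for
`f ≥ 0`. Hence the Neumann series `R_l ∑ (B R_l)ⁿ` is a positive resolvent of `T + B` of norm at most
`1 / (l - ω)` (`exists_isResolvent_add`), and the Hille–Yosida theorem
(`exists_c0Semigroup_of_norm_resolvent_le`), whose Yosida approximations are positive here, yields
the semigroup `V`.

For the strict positivity let `u = (l - T - B)⁻¹ g` with `g ≥ 0` nontrivial, so that
`u = R_l (g + B u)`. By the formula for `R_l`, `u` is positive above every size below which `g + B u`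
does not vanish. If `g + B u` vanished below a largest `z₀ > 0`, then `u > 0` above `z₀` while `B u`
vanishes below `z₀`, so particles above `z₀` would produce none below `z₀`, and both
alternatives exclude such a gap (`exists_le_mul_of_gap`, `ae_pos_of_no_gap`). This treats large `l`;
positivity of the resolvent propagates downwards as long as `[l, ∞)` consists of resolvent
points (`IsResolvent.nonneg_of_Ici_subset`), and the resolvent identity then bounds the resolvent
at `l` below by one at a larger point. Finally, a closed invariant ideal is invariant under the
resolvents, so if it is nonzero it contains a function that is positive almost everywhere, and
such a function generates the whole space as a closed ideal (`eq_top_of_isClosed_of_pos`).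
-/

/-! ### Strongly continuous semigroups: Laplace transform and density of the domain -/

namespace C0Semigroup

variable {E : Type*} [NormedAddCommGroup E] [NormedSpace ℝ E]

/-- A one-parameter semigroup of bounded operators of exponential growth that is strongly
continuous at `0` is strongly continuous. -/
def ofTendstoZero (S : ℝ≥0 → E →L[ℝ] E) (K : ℝ) (h0 : S 0 = ContinuousLinearMap.id ℝ E)
    (hadd : ∀ s t, S (s + t) = (S s).comp (S t))
    (hK : ∀ t : ℝ≥0, ‖S t‖ ≤ Real.exp (K * t))
    (hlim : ∀ f, Tendsto (fun t => S t f) (𝓝 0) (𝓝 f)) : C0Semigroup E where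
  toFun := S
  map_zero := h0
  map_add := hadd
  continuous_orbit f := by
    refine continuous_iff_continuousAt.2 fun s => ?_
    -- with `d = |t - s|` one has `S t f - S s f = ± S (min t s) (S d f - f)`
    have hd : Tendsto (fun t : ℝ≥0 => (t - s) + (s - t)) (𝓝 s) (𝓝 0) := by
      have : Continuous fun t : ℝ≥0 => (t - s) + (s - t) := by fun_prop
      simpa using this.tendsto s
    have hbound : ∀ t : ℝ≥0, ‖S t f - S s f‖ ≤
        Real.exp (K * (min t s : ℝ≥0)) * ‖S ((t - s) + (s - t)) f - f‖ := by
      intro t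
      rcases le_total s t with h | h
      · obtain ⟨d, rfl⟩ := exists_add_of_le h
        have : S (s + d) f - S s f = S s (S d f - f) := by
          rw [hadd]; simp
        rw [this, min_eq_right h, tsub_eq_zero_of_le h, add_tsub_cancel_left, add_zero]
        simpa using (S s).le_of_opNorm_le (hK s) (S d f - f)
      · obtain ⟨d, rfl⟩ := exists_add_of_le h
        have : S t f - S (t + d) f = -(S t (S d f - f)) := by
          rw [hadd]; simp
        rw [this, min_eq_left h, norm_neg, tsub_eq_zero_of_le h, add_tsub_cancel_left, zero_add]
        simpa using (S t).le_of_opNorm_le (hK t) (S d f - f)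
    have hc : Tendsto (fun t : ℝ≥0 => Real.exp (K * (min t s : ℝ≥0))) (𝓝 s)
        (𝓝 (Real.exp (K * (min s s : ℝ≥0)))) := by
      have : Continuous fun t : ℝ≥0 => Real.exp (K * (min t s : ℝ≥0)) := by fun_prop
      exact this.tendsto s
    have hr := hc.mul (((hlim f).comp hd).sub_const f).norm
    simp only [sub_self, norm_zero, mul_zero] at hr
    exact tendsto_iff_norm_sub_tendsto_zero.2
      (squeeze_zero (fun t => norm_nonneg _) hbound hr)

variable (S : C0Semigroup E)

theorem toFun_zero_apply (f : E) : S.toFun 0 f = f := by simp [S.map_zero]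

theorem toFun_add_apply (s t : ℝ≥0) (f : E) : S.toFun (s + t) f = S.toFun s (S.toFun t f) := by
  simp [S.map_add]

theorem continuous_orbit_toNNReal (f : E) :
    Continuous fun t : ℝ => S.toFun t.toNNReal f :=
  (S.continuous_orbit f).comp continuous_real_toNNReal

variable {S}

/-- If an orbit agrees for nonnegative times with a curve that is differentiable at `0`, its initial
value lies in the domain of the generator. -/
theorem GeneratorRel.of_hasDerivAt {f g : E} {D : ℝ → E} (hD : ∀ t : ℝ≥0, S.toFun t f = D t)
    (h : HasDerivAt D g 0) : S.GeneratorRel f g := by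
  have h1 := h.tendsto_slope_zero_right
  have h2 : Tendsto (fun t : ℝ≥0 => (t : ℝ)) (𝓝[>] 0) (𝓝[>] 0) := by
    refine tendsto_nhdsWithin_iff.2 ⟨?_, ?_⟩
    · exact (NNReal.continuous_coe.tendsto 0).mono_left nhdsWithin_le_nhds
    · filter_upwards [self_mem_nhdsWithin] with t ht
      exact NNReal.coe_pos.2 ht
  refine (h1.comp h2).congr fun t => ?_
  have h3 := hD 0
  rw [toFun_zero_apply] at h3
  simp only [Function.comp, zero_add]
  rw [hD t, h3, NNReal.coe_zero]

theorem GeneratorRel.mem_domain {f g : E} (h : S.GeneratorRel f g) : f ∈ S.generator.domain :=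
  ⟨g, h⟩

theorem GeneratorRel.generator_eq {f g : E} (h : S.GeneratorRel f g) :
    S.generator ⟨f, h.mem_domain⟩ = g :=
  (S.generatorRel_generator ⟨f, h.mem_domain⟩).unique h

variable (S) in
/-- The domain of the generator is dense: it contains the averages `h⁻¹ ∫₀ʰ S(s) f ds`. -/
theorem dense_generator_domain [CompleteSpace E] : Dense (S.generator.domain : Set E) := by
  intro f
  have hc := S.continuous_orbit_toNNReal f
  have hint : ∀ a b : ℝ, IntervalIntegrable (fun t : ℝ => S.toFun t.toNNReal f) volume a b :=
    fun a b => hc.intervalIntegrable a b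
  have hmem : ∀ h : ℝ, 0 < h → (∫ s in (0 : ℝ)..h, S.toFun s.toNNReal f) ∈ S.generator.domain := by
    intro h hh
    refine GeneratorRel.mem_domain (g := S.toFun h.toNNReal f - S.toFun (0 : ℝ).toNNReal f)
      (GeneratorRel.of_hasDerivAt
        (D := fun t => (∫ s in (0 : ℝ)..(t + h), S.toFun s.toNNReal f) -
          ∫ s in (0 : ℝ)..t, S.toFun s.toNNReal f) ?_ ?_)
    · intro t
      rw [← ContinuousLinearMap.intervalIntegral_comp_comm _ (hint 0 h)]
      have : ∫ s in (0 : ℝ)..h, S.toFun t (S.toFun s.toNNReal f) =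
          ∫ s in (0 : ℝ)..h, S.toFun (s + t).toNNReal f := by
        refine intervalIntegral.integral_congr fun s hs => ?_
        rw [uIcc_of_le hh.le] at hs
        rw [← toFun_add_apply, Real.toNNReal_add hs.1 t.coe_nonneg, Real.toNNReal_coe, add_comm t]
      rw [this, intervalIntegral.integral_comp_add_right (fun s => S.toFun s.toNNReal f),
        zero_add, add_comm h]
      rw [← intervalIntegral.integral_add_adjacent_intervals (hint 0 t) (hint t (t + h))]
      abel
    · have h1 : HasDerivAt (fun t : ℝ => ∫ s in (0 : ℝ)..t, S.toFun s.toNNReal f)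
          (S.toFun (0 + h).toNNReal f) (0 + h) :=
        (hc.integral_hasStrictDerivAt 0 (0 + h)).hasDerivAt
      have h2 := (hc.integral_hasStrictDerivAt 0 0).hasDerivAt
      have h3 := (h1.comp_add_const (0 : ℝ) h).sub h2
      simp only [zero_add, Real.toNNReal_zero, toFun_zero_apply] at h3 ⊢
      exact h3
  have hlim := (hc.integral_hasStrictDerivAt 0 0).hasDerivAt.tendsto_slope_zero_right
  simp only [zero_add, intervalIntegral.integral_same, sub_zero, Real.toNNReal_zero,
    toFun_zero_apply] at hlim
  refine mem_closure_of_tendsto hlim ?_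
  filter_upwards [self_mem_nhdsWithin] with h hh
  exact S.generator.domain.smul_mem _ (hmem h hh)

section Laplace

variable {K l : ℝ}

theorem integrableOn_laplace (hK : ∀ t : ℝ≥0, ‖S.toFun t‖ ≤ Real.exp (K * t)) (hl : K < l) (f : E) :
    IntegrableOn (fun t : ℝ => Real.exp (-l * t) • S.toFun t.toNNReal f) (Ioi 0) ∧
    ‖∫ t in Ioi (0 : ℝ), Real.exp (-l * t) • S.toFun t.toNNReal f‖ ≤
      (∫ t in Ioi (0 : ℝ), Real.exp (-(l - K) * t)) * ‖f‖ := by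
  have hI := exp_neg_integrableOn_Ioi 0 (sub_pos.2 hl)
  have hb : ∀ᵐ t : ℝ ∂volume.restrict (Ioi 0),
      ‖Real.exp (-l * t) • S.toFun t.toNNReal f‖ ≤ Real.exp (-(l - K) * t) * ‖f‖ := by
    filter_upwards [ae_restrict_mem measurableSet_Ioi] with t ht
    have := (S.toFun t.toNNReal).le_of_opNorm_le (hK t.toNNReal) f
    rw [Real.coe_toNNReal t (le_of_lt ht)] at this
    rw [norm_smul, Real.norm_eq_abs, abs_of_pos (Real.exp_pos _)]
    calc _ ≤ Real.exp (-l * t) * (Real.exp (K * t) * ‖f‖) := by gcongr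
      _ = _ := by rw [← mul_assoc, ← Real.exp_add]; ring_nf
  have hm : AEStronglyMeasurable (fun t : ℝ => Real.exp (-l * t) • S.toFun t.toNNReal f)
      (volume.restrict (Ioi 0)) := by
    have := S.continuous_orbit_toNNReal f
    exact Continuous.aestronglyMeasurable (by fun_prop)
  refine ⟨(hI.mul_const ‖f‖).mono' hm hb, ?_⟩
  rw [← integral_mul_const]
  exact norm_integral_le_of_norm_le (hI.mul_const ‖f‖) hb

/-- The Laplace transform of a semigroup of exponential growth is the resolvent of its
generator. -/
theorem exists_isResolvent_laplace [CompleteSpace E]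
    (hK : ∀ t : ℝ≥0, ‖S.toFun t‖ ≤ Real.exp (K * t)) (hl : K < l) :
    ∃ R : E →L[ℝ] E, IsResolvent S.generator l R ∧
      ∀ f, R f = ∫ t in Ioi (0 : ℝ), Real.exp (-l * t) • S.toFun t.toNNReal f := by
  have hint := fun f => (integrableOn_laplace hK hl f).1
  let R : E →L[ℝ] E := LinearMap.mkContinuous
    { toFun := fun f => ∫ t in Ioi (0 : ℝ), Real.exp (-l * t) • S.toFun t.toNNReal f
      map_add' := fun f g => by
        rw [← integral_add (hint f) (hint g)]
        simp only [ContinuousLinearMap.map_add, smul_add]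
      map_smul' := fun k f => by
        simp only [RingHom.id_apply]
        rw [← integral_smul]
        simp only [ContinuousLinearMap.map_smul]
        refine integral_congr_ae (ae_of_all _ fun t => ?_)
        exact smul_comm _ _ _ } _ fun f => (integrableOn_laplace hK hl f).2
  have hR : ∀ f, R f = ∫ t in Ioi (0 : ℝ), Real.exp (-l * t) • S.toFun t.toNNReal f := fun f => rfl
  have hcont : ∀ f, Continuous fun t : ℝ => Real.exp (-l * t) • S.toFun t.toNNReal f := fun f => by
    have := S.continuous_orbit_toNNReal f
    fun_prop
  have hshift : ∀ (f : E) (h : ℝ≥0), S.toFun h (R f) = Real.exp (l * h) •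
      (R f - ∫ t in (0 : ℝ)..h, Real.exp (-l * t) • S.toFun t.toNNReal f) := by
    intro f h
    have e1 : R f - ∫ t in (0 : ℝ)..h, Real.exp (-l * t) • S.toFun t.toNNReal f =
        ∫ t in Ioi (h : ℝ), Real.exp (-l * t) • S.toFun t.toNNReal f := by
      rw [hR, ← intervalIntegral.integral_interval_add_Ioi (b := (h : ℝ)) (hint f)
        ((hint f).mono_set (Ioi_subset_Ioi h.2))]
      abel
    have e2 : ∫ t in Ioi (h : ℝ), Real.exp (-l * t) • S.toFun t.toNNReal f =
        ∫ t in Ioi (0 : ℝ), Real.exp (-l * (t + h)) • S.toFun (t + h).toNNReal f := by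
      have hp := measurePreserving_add_right (volume : Measure ℝ) (h : ℝ)
      have := hp.setIntegral_preimage_emb (measurableEmbedding_addRight (h : ℝ))
        (fun t => Real.exp (-l * t) • S.toFun t.toNNReal f) (Ioi (h : ℝ))
      rw [← this]
      congr 2
      ext t
      simp
    rw [e1, e2, hR, ← ContinuousLinearMap.integral_comp_comm _ (hint f), ← integral_smul]
    refine setIntegral_congr_fun measurableSet_Ioi fun t ht => ?_
    rw [map_smul, ← toFun_add_apply, smul_smul, ← Real.exp_add,
      Real.toNNReal_add (le_of_lt ht) h.coe_nonneg, Real.toNNReal_coe, add_comm h]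
    congr 2
    ring
  have hgen : ∀ f, S.GeneratorRel (R f) (l • R f - f) := by
    intro f
    refine GeneratorRel.of_hasDerivAt (D := fun h => Real.exp (l * h) •
      (R f - ∫ t in (0 : ℝ)..h, Real.exp (-l * t) • S.toFun t.toNNReal f)) (hshift f) ?_
    have h1 := ((hcont f).integral_hasStrictDerivAt 0 0).hasDerivAt
    have h2 : HasDerivAt (fun h : ℝ => Real.exp (l * h)) (Real.exp (l * 0) * (l * 1)) 0 :=
      ((hasDerivAt_id (0 : ℝ)).const_mul l).exp
    have h3 := h2.smul (h1.const_sub (R f))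
    simp only [intervalIntegral.integral_same, mul_zero, Real.exp_zero, Real.toNNReal_zero,
      toFun_zero_apply, one_smul, mul_one, one_mul, sub_zero] at h3
    rw [sub_eq_neg_add]
    exact h3
  refine ⟨R, ⟨fun f => ⟨(hgen f).mem_domain, ?_⟩, fun f => ?_⟩, hR⟩
  · rw [(hgen f).generator_eq]
    abel
  · -- `R` commutes with the difference quotients of the semigroup
    have hcomm : ∀ (t : ℝ≥0) (g : E), S.toFun t (R g) = R (S.toFun t g) := by
      intro t g
      rw [hR, hR, ← ContinuousLinearMap.integral_comp_comm _ (hint g)]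
      refine integral_congr_ae (ae_of_all _ fun s => ?_)
      simp only
      rw [map_smul, ← toFun_add_apply, ← toFun_add_apply, add_comm]
    have h1 : S.GeneratorRel (R f) (R (S.generator f)) := by
      refine ((R.continuous.tendsto _).comp (S.generatorRel_generator f)).congr fun t => ?_
      simp only [Function.comp, map_smul, map_sub, hcomm]
    have h2 := (hgen f).unique h1
    rw [map_sub, map_smul, ← h2]
    abel

end Laplace

end C0Semigroup

/-! ### Resolvents -/

section Resolvent

variable {E : Type*} [NormedAddCommGroup E] [NormedSpace ℝ E] {A : E →ₗ.[ℝ] E} {l m : ℝ}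
  {R Q : E →L[ℝ] E}

/-- The resolvent identity. -/
theorem IsResolvent.sub_apply (hR : IsResolvent A l R) (hQ : IsResolvent A m Q) (f : E) :
    R f - Q f = (m - l) • R (Q f) := by
  obtain ⟨h, hf⟩ := hQ.1 f
  have h1 := hR.2 ⟨Q f, h⟩
  have h2 : A ⟨Q f, h⟩ = m • Q f - f := by
    rw [eq_sub_iff_add_eq, ← eq_sub_iff_add_eq', hf]
  rw [h2] at h1
  simp only [map_sub, map_smul] at h1
  rw [sub_smul, ← h1]
  simp only [h1]
  rw [← sub_eq_zero]
  have h3 : Q f = l • R (Q f) - (m • R (Q f) - R f) := h1.symm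
  nth_rewrite 1 [h3]
  abel

theorem IsResolvent.unique (hR : IsResolvent A l R) (hQ : IsResolvent A l Q) : R = Q := by
  ext f
  have := hR.sub_apply hQ f
  rwa [sub_self, zero_smul, sub_eq_zero] at this

theorem IsResolvent.commute (hR : IsResolvent A l R) (hQ : IsResolvent A m Q) : Commute R Q := by
  rcases eq_or_ne l m with rfl | hlm
  · rw [hR.unique hQ]
  · ext f
    have h1 := hR.sub_apply hQ f
    have h2 := hQ.sub_apply hR f
    have h3 : (m - l) • R (Q f) = (m - l) • Q (R f) := by
      rw [← h1, ← neg_sub (Q f), h2, ← neg_smul, neg_sub]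
    exact smul_right_injective E (sub_ne_zero.2 hlm.symm) h3

theorem IsResolvent.apply_map (hR : IsResolvent A l R) (f : A.domain) :
    R (A f) = l • R f - f := by
  have := hR.2 f
  rw [map_sub, map_smul] at this
  rw [eq_sub_iff_add_eq, ← eq_sub_iff_add_eq', this]

/-- Two operators, one extending the other, that share a resolvent point coincide. -/
theorem IsResolvent.eq_of_le {G : E →ₗ.[ℝ] E} (hA : IsResolvent A l R) (hG : IsResolvent G l Q)
    (hle : A ≤ G) : G = A := by
  refine (LinearPMap.eq_of_le_of_domain_eq hle (le_antisymm hle.1 fun g hg => ?_)).symm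
  obtain ⟨h, hf⟩ := hA.1 (l • g - G ⟨g, hg⟩)
  have h1 := hG.2 ⟨R (l • g - G ⟨g, hg⟩), hle.1 h⟩
  rw [← hle.2 (x := ⟨_, h⟩) (y := ⟨_, hle.1 h⟩) rfl, hf] at h1
  have h2 : Q (l • g - G ⟨g, hg⟩) = g := hG.2 ⟨g, hg⟩
  rw [h2] at h1
  rw [h1]
  exact h

end Resolvent

/-! ### The Hille–Yosida theorem -/

section Exponential

variable {E : Type*} [NormedAddCommGroup E] [NormedSpace ℝ E]

theorem norm_exp_continuousLinearMap_le [CompleteSpace E] (T : E →L[ℝ] E) :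
    ‖NormedSpace.exp T‖ ≤ Real.exp ‖T‖ := by
  rw [NormedSpace.exp_eq_tsum ℝ]
  have h := NormedSpace.exp_series_hasSum_exp' (𝕂 := ℝ) ‖T‖
  rw [← Real.exp_eq_exp_ℝ] at h
  refine tsum_of_norm_bounded h fun n => ?_
  rw [norm_smul, Real.norm_of_nonneg (by positivity), smul_eq_mul]
  gcongr
  rcases Nat.eq_zero_or_pos n with rfl | hn
  · rw [pow_zero, pow_zero]
    exact ContinuousLinearMap.norm_id_le (𝕜 := ℝ) (E := E)
  · exact norm_pow_le' T hn

theorem norm_exp_smul_apply_sub_le [CompleteSpace E] {A B : E →L[ℝ] E} (hAB : Commute A B) {c t : ℝ}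
    (ht : 0 ≤ t)
    (hA : ∀ s : ℝ, 0 ≤ s → ‖NormedSpace.exp (s • A)‖ ≤ Real.exp (c * s))
    (hB : ∀ s : ℝ, 0 ≤ s → ‖NormedSpace.exp (s • B)‖ ≤ Real.exp (c * s)) (f : E) :
    ‖NormedSpace.exp (t • A) f - NormedSpace.exp (t • B) f‖ ≤
      Real.exp (c * t) * ‖A f - B f‖ * t := by
  -- differentiate `s ↦ exp ((t - s) B) exp (s A) f`
  let D : ℝ → E →L[ℝ] E := fun s => NormedSpace.exp ((t - s) • B) * NormedSpace.exp (s • A)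
  let D' : ℝ → E →L[ℝ] E := fun s =>
    NormedSpace.exp ((t - s) • B) * NormedSpace.exp (s • A) * (A - B)
  have hD : ∀ s, HasDerivAt D (D' s) s := by
    intro s
    have h1 : HasDerivAt (fun s : ℝ => NormedSpace.exp ((t - s) • B))
        (-(NormedSpace.exp ((t - s) • B) * B)) s :=
      (hasDerivAt_exp_smul_const B (t - s)).comp_const_sub t s
    have h2 := h1.mul (hasDerivAt_exp_smul_const A s)
    have h3 : Commute B (NormedSpace.exp (s • A)) :=
      Commute.exp_right (hAB.symm.smul_right s)
    have h4 : D' s = -(NormedSpace.exp ((t - s) • B) * B) * NormedSpace.exp (s • A) +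
        NormedSpace.exp ((t - s) • B) * (NormedSpace.exp (s • A) * A) := by
      rw [neg_mul, mul_assoc _ B, h3.eq]
      simp only [D']
      noncomm_ring
    rw [h4]
    exact h2
  have hDf : ∀ s, HasDerivAt (fun s => D s f) (D' s f) s := fun s =>
    by simpa using (hD s).clm_apply (hasDerivAt_const s f)
  have hb : ∀ s ∈ Ico 0 t, ‖D' s f‖ ≤ Real.exp (c * t) * ‖A f - B f‖ := by
    intro s hs
    have h1 : ‖NormedSpace.exp ((t - s) • B) * NormedSpace.exp (s • A)‖ ≤ Real.exp (c * t) := by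
      refine (norm_mul_le _ _).trans ?_
      calc _ ≤ Real.exp (c * (t - s)) * Real.exp (c * s) :=
            mul_le_mul (hB _ (by linarith [hs.2])) (hA _ hs.1) (norm_nonneg _) (Real.exp_pos _).le
        _ = _ := by rw [← Real.exp_add]; ring_nf
    exact ContinuousLinearMap.le_of_opNorm_le _ h1 ((A - B) f)
  have := norm_image_sub_le_of_norm_deriv_le_segment' (fun s _ => (hDf s).hasDerivWithinAt) hb t
    (right_mem_Icc.2 ht)
  simpa [D] using this

/-- An equibounded family that tends to zero on a dense set tends to zero everywhere. -/
theorem tendsto_zero_of_dense {ι : Type*} {u : Filter ι} {T : ι → E →L[ℝ] E} {M : ℝ}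
    (hM : ∀ᶠ i in u, ‖T i‖ ≤ M) {s : Set E} (hs : Dense s)
    (h : ∀ f ∈ s, Tendsto (fun i => T i f) u (𝓝 0)) (f : E) :
    Tendsto (fun i => T i f) u (𝓝 0) := by
  rw [Metric.tendsto_nhds]
  intro ε hε
  have hM' : 0 < |M| + 1 := by positivity
  obtain ⟨g, hg, hfg⟩ := Metric.dense_iff.1 hs f (ε / (2 * (|M| + 1))) (by positivity)
  rw [Metric.mem_ball, dist_comm, dist_eq_norm] at hg
  filter_upwards [hM, Metric.tendsto_nhds.1 (h g hfg) (ε / 2) (by positivity)] with i h1 h2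
  rw [dist_zero_right] at h2 ⊢
  have h3 : ‖T i (f - g)‖ ≤ (|M| + 1) * ‖f - g‖ :=
    (T i).le_of_opNorm_le (h1.trans ((le_abs_self M).trans (by linarith))) _
  have h4 : (|M| + 1) * ‖f - g‖ < ε / 2 := by
    calc _ < (|M| + 1) * (ε / (2 * (|M| + 1))) := by gcongr
      _ = ε / 2 := by field_simp
  calc ‖T i f‖ = ‖T i (f - g) + T i g‖ := by simp
    _ ≤ ‖T i (f - g)‖ + ‖T i g‖ := norm_add_le _ _
    _ < ε := by linarith

/-- The Yosida approximation `l A (l - A)⁻¹ = l² R - l` of `A`, where `R = (l - A)⁻¹`. -/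
noncomputable def yosida (l : ℝ) (R : E →L[ℝ] E) : E →L[ℝ] E := l ^ 2 • R - l • 1

theorem exp_smul_yosida [CompleteSpace E] (l t : ℝ) (R : E →L[ℝ] E) :
    NormedSpace.exp (t • yosida l R) =
      Real.exp (-(t * l)) • NormedSpace.exp ((t * l ^ 2) • R) := by
  let _ : NormedAlgebra ℚ (E →L[ℝ] E) := NormedAlgebra.restrictScalars ℚ ℝ _
  have h1 : t • yosida l R = algebraMap ℝ (E →L[ℝ] E) (-(t * l)) + (t * l ^ 2) • R := by
    rw [yosida, smul_sub, smul_smul, smul_smul, Algebra.algebraMap_eq_smul_one, neg_smul]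
    abel
  rw [h1, NormedSpace.exp_add_of_commute (Algebra.commutes _ _), ← NormedSpace.algebraMap_exp_comm,
    ← Real.exp_eq_exp_ℝ, ← Algebra.smul_def]

theorem norm_exp_smul_yosida_le [CompleteSpace E] {ω l t : ℝ} (hω : 0 < ω) (hl : 2 * ω ≤ l)
    (ht : 0 ≤ t) {R : E →L[ℝ] E} (hR : ‖R‖ ≤ 1 / (l - ω)) :
    ‖NormedSpace.exp (t • yosida l R)‖ ≤ Real.exp (2 * ω * t) := by
  have hlω : 0 < l - ω := by linarith
  rw [exp_smul_yosida, norm_smul, Real.norm_of_nonneg (Real.exp_pos _).le]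
  calc _ ≤ Real.exp (-(t * l)) * Real.exp ‖(t * l ^ 2) • R‖ := by
        gcongr; exact norm_exp_continuousLinearMap_le _
    _ ≤ Real.exp (-(t * l)) * Real.exp (t * l ^ 2 * (1 / (l - ω))) := by
        rw [norm_smul, Real.norm_of_nonneg (by positivity)]; gcongr
    _ = Real.exp (t * (l * ω / (l - ω))) := by
        rw [← Real.exp_add]; congr 1; field_simp; ring
    _ ≤ Real.exp (2 * ω * t) := by
        have : l * ω / (l - ω) ≤ 2 * ω := by rw [div_le_iff₀ hlω]; nlinarith
        refine Real.exp_le_exp.2 ?_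
        nlinarith

theorem exp_smul_yosida_nonneg [CompleteSpace E] [Lattice E] [IsOrderedAddMonoid E]
    [OrderClosedTopology E] [PosSMulMono ℝ E] (l : ℝ) {t : ℝ} (ht : 0 ≤ t) {R : E →L[ℝ] E}
    (hR : ∀ f, 0 ≤ f → 0 ≤ R f) {f : E} (hf : 0 ≤ f) :
    0 ≤ NormedSpace.exp (t • yosida l R) f := by
  rw [exp_smul_yosida]
  have h1 := (NormedSpace.exp_series_hasSum_exp' (𝕂 := ℝ) ((t * l ^ 2) • R)).mapL
    (ContinuousLinearMap.apply ℝ E f)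
  refine smul_nonneg (Real.exp_pos _).le (h1.nonneg fun n => ?_)
  have h2 : 0 ≤ (R ^ n) f := by
    induction n with
    | zero => simpa using hf
    | succ n ih => rw [pow_succ']; exact hR _ ih
  simp only [ContinuousLinearMap.apply_apply, smul_pow]
  exact smul_nonneg (by positivity) (smul_nonneg (by positivity) h2)

end Exponential

section HilleYosida

variable {E : Type*} [NormedAddCommGroup E] [NormedSpace ℝ E] {A : E →ₗ.[ℝ] E} {ω : ℝ}
  {Q : ℝ → E →L[ℝ] E}

/-- `l (l - A)⁻¹ → 1` strongly as `l → ∞`. -/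
theorem tendsto_smul_resolvent (hA : Dense (A.domain : Set E))
    (hQ : ∀ l, ω < l → IsResolvent A l (Q l)) (hb : ∀ l, ω < l → ‖Q l‖ ≤ 1 / (l - ω)) (f : E) :
    Tendsto (fun l => l • Q l f) atTop (𝓝 f) := by
  have hlim : Tendsto (fun l : ℝ => 1 / (l - ω)) atTop (𝓝 0) := by
    have h : Tendsto (fun l : ℝ => l - ω) atTop atTop :=
      tendsto_atTop_add_const_right _ (-ω) tendsto_id
    simp only [one_div]
    exact tendsto_inv_atTop_zero.comp h
  have h1 : Tendsto (fun l => (l • Q l - ContinuousLinearMap.id ℝ E) f) atTop (𝓝 0) := by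
    refine tendsto_zero_of_dense (M := 3) ?_ hA (fun g hg => ?_) f
    · filter_upwards [eventually_gt_atTop (|ω| + |ω|)] with l hl
      have h0 : 0 ≤ |ω| := abs_nonneg ω
      have hω := le_abs_self ω
      have hlω : 0 < l - ω := by linarith
      calc ‖l • Q l - ContinuousLinearMap.id ℝ E‖
          ≤ ‖l • Q l‖ + ‖ContinuousLinearMap.id ℝ E‖ := norm_sub_le _ _
        _ ≤ l * (1 / (l - ω)) + 1 := by
            refine add_le_add ?_ ContinuousLinearMap.norm_id_le
            rw [norm_smul, Real.norm_of_nonneg (by linarith)]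
            exact mul_le_mul_of_nonneg_left (hb l (by linarith)) (by linarith)
        _ ≤ 3 := by
            have : l * (1 / (l - ω)) ≤ 2 := by
              rw [mul_one_div, div_le_iff₀ hlω]; linarith
            linarith
    · have h2 : Tendsto (fun l : ℝ => 1 / (l - ω) * ‖A ⟨g, hg⟩‖) atTop (𝓝 0) := by
        simpa using hlim.mul_const ‖A ⟨g, hg⟩‖
      refine squeeze_zero_norm' ?_ h2
      filter_upwards [eventually_gt_atTop ω] with l hl
      have h3 : (l • Q l - ContinuousLinearMap.id ℝ E) g = Q l (A ⟨g, hg⟩) := by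
        rw [(hQ l hl).apply_map]
        simp
      rw [h3]
      exact (Q l).le_of_opNorm_le (hb l hl) _
  have h2 := h1.add_const f
  simpa using h2

/-- **Hille–Yosida theorem**: a densely defined operator with `‖(l - A)⁻¹‖ ≤ 1 / (l - ω)` for all
`l > ω` is the generator of a strongly continuous semigroup, which is the strong limit of the
exponentials of the Yosida approximations. -/
theorem exists_c0Semigroup_of_norm_resolvent_le [CompleteSpace E] (hA : Dense (A.domain : Set E))
    (hω : 0 < ω) (hQ : ∀ l, ω < l → IsResolvent A l (Q l))
    (hb : ∀ l, ω < l → ‖Q l‖ ≤ 1 / (l - ω)) :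
    ∃ V : C0Semigroup E, V.generator = A ∧ (∀ t, ‖V.toFun t‖ ≤ Real.exp (2 * ω * t)) ∧
      ∀ (t : ℝ≥0) f, Tendsto
        (fun n : ℕ => NormedSpace.exp ((t : ℝ) • yosida (2 * ω + n) (Q (2 * ω + n))) f)
        atTop (𝓝 (V.toFun t f)) := by
  set Y : ℕ → E →L[ℝ] E := fun n => yosida (2 * ω + n) (Q (2 * ω + n)) with hY
  have hl : ∀ n : ℕ, ω < 2 * ω + n := fun n => by
    have : (0 : ℝ) ≤ n := n.cast_nonneg
    linarith
  have hexp : ∀ (n : ℕ) (s : ℝ), 0 ≤ s → ‖NormedSpace.exp (s • Y n)‖ ≤ Real.exp (2 * ω * s) :=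
    fun n s hs => norm_exp_smul_yosida_le hω (by simp) hs (hb _ (hl n))
  have hcomm : ∀ n m, Commute (Y n) (Y m) := by
    intro n m
    have h := (hQ _ (hl n)).commute (hQ _ (hl m))
    refine Commute.sub_right (Commute.sub_left ?_ ?_) ?_
    · exact (h.smul_left _).smul_right _
    · exact (Commute.one_left _).smul_left _
    · exact (Commute.one_right _).smul_right _
  have hlim : Tendsto (fun n : ℕ => (2 * ω + n : ℝ)) atTop atTop :=
    tendsto_atTop_add_const_left _ _ tendsto_natCast_atTop_atTop
  have hYlim : ∀ f : A.domain, Tendsto (fun n => Y n f) atTop (𝓝 (A f)) := by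
    intro f
    refine ((tendsto_smul_resolvent hA hQ hb (A f)).comp hlim).congr fun n => ?_
    simp only [Function.comp, hY, yosida]
    rw [(hQ _ (hl n)).apply_map, smul_sub, smul_smul, ← pow_two]
    simp
  -- the exponentials converge strongly
  have hconv : ∀ (t : ℝ≥0) (f : E), ∃ g,
      Tendsto (fun n => NormedSpace.exp ((t : ℝ) • Y n) f) atTop (𝓝 g) := by
    intro t f
    refine cauchySeq_tendsto_of_complete (cauchySeq_iff_tendsto_dist_atTop_0.2 ?_)
    simp only [dist_eq_norm]
    refine tendsto_zero_iff_norm_tendsto_zero.1 ?_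
    refine tendsto_zero_of_dense (M := Real.exp (2 * ω * t) + Real.exp (2 * ω * t))
      (T := fun p : ℕ × ℕ => NormedSpace.exp ((t : ℝ) • Y p.1) - NormedSpace.exp ((t : ℝ) • Y p.2))
      (Eventually.of_forall fun p => (norm_sub_le _ _).trans
        (add_le_add (hexp _ _ t.2) (hexp _ _ t.2))) hA (fun g hg => ?_) f
    have hg1 := cauchySeq_iff_tendsto_dist_atTop_0.1 (hYlim ⟨g, hg⟩).cauchySeq
    simp only [dist_eq_norm] at hg1
    have hg2 := (hg1.const_mul (Real.exp (2 * ω * t))).mul_const (t : ℝ)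
    simp only [mul_zero, zero_mul] at hg2
    exact squeeze_zero_norm (fun p =>
      norm_exp_smul_apply_sub_le (hcomm p.1 p.2) t.2 (hexp p.1) (hexp p.2) g) hg2
  choose V hV using hconv
  have hVnorm : ∀ t f, ‖V t f‖ ≤ Real.exp (2 * ω * t) * ‖f‖ := fun t f =>
    le_of_tendsto (hV t f).norm (Eventually.of_forall fun n =>
      ContinuousLinearMap.le_of_opNorm_le _ (hexp n t t.2) f)
  let W : ℝ≥0 → E →L[ℝ] E := fun t => LinearMap.mkContinuous
    { toFun := V t
      map_add' := fun f g => tendsto_nhds_unique (hV t (f + g)) (by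
        simpa only [map_add] using (hV t f).add (hV t g))
      map_smul' := fun k f => tendsto_nhds_unique (hV t (k • f)) (by
        simpa only [map_smul, RingHom.id_apply] using (hV t f).const_smul k) } _ (hVnorm t)
  have hW : ∀ t f, W t f = V t f := fun t f => rfl
  have hWnorm : ∀ t : ℝ≥0, ‖W t‖ ≤ Real.exp (2 * ω * t) := fun t =>
    ContinuousLinearMap.opNorm_le_bound _ (Real.exp_pos _).le (hVnorm t)
  have hW0 : W 0 = ContinuousLinearMap.id ℝ E := by
    ext f
    refine tendsto_nhds_unique (hV 0 f) ?_
    simp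
  have hWadd : ∀ s t, W (s + t) = (W s).comp (W t) := by
    intro s t
    ext f
    refine tendsto_nhds_unique (hV (s + t) f) ?_
    have h1 : ∀ n, NormedSpace.exp (((s + t : ℝ≥0) : ℝ) • Y n) f =
        NormedSpace.exp ((s : ℝ) • Y n) (NormedSpace.exp ((t : ℝ) • Y n) f - V t f) +
          NormedSpace.exp ((s : ℝ) • Y n) (V t f) := by
      intro n
      let _ : NormedAlgebra ℚ (E →L[ℝ] E) := NormedAlgebra.restrictScalars ℚ ℝ _
      rw [← map_add, sub_add_cancel, NNReal.coe_add, add_smul, NormedSpace.exp_add_of_commute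
        (((Commute.refl (Y n)).smul_left _).smul_right _)]
      rfl
    simp only [h1]
    have h2 : Tendsto (fun n => NormedSpace.exp ((s : ℝ) • Y n)
        (NormedSpace.exp ((t : ℝ) • Y n) f - V t f)) atTop (𝓝 0) := by
      have h3 := (((hV t f).sub_const (V t f)).norm).const_mul (Real.exp (2 * ω * s))
      simp only [sub_self, norm_zero, mul_zero] at h3
      exact squeeze_zero_norm (fun n =>
        ContinuousLinearMap.le_of_opNorm_le _ (hexp n s s.2) _) h3
    simpa [hW] using h2.add (hV s (V t f))
  have hWcont : ∀ f, Tendsto (fun t => W t f) (𝓝 0) (𝓝 f) := by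
    intro f
    have h1 : Tendsto (fun t => (W t - ContinuousLinearMap.id ℝ E) f) (𝓝 0) (𝓝 0) := by
      refine tendsto_zero_of_dense (M := Real.exp (2 * ω) + 1) ?_ hA (fun g hg => ?_) f
      · filter_upwards [Iic_mem_nhds (zero_lt_one : (0 : ℝ≥0) < 1)] with t ht
        refine (norm_sub_le _ _).trans (add_le_add ((hWnorm t).trans ?_)
          ContinuousLinearMap.norm_id_le)
        refine Real.exp_le_exp.2 (mul_le_of_le_one_right (by positivity) ?_)
        exact_mod_cast ht
      · have h2 : ∀ t : ℝ≥0, ‖(W t - ContinuousLinearMap.id ℝ E) g‖ ≤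
            Real.exp (2 * ω * t) * ‖A ⟨g, hg⟩‖ * t := by
          intro t
          refine le_of_tendsto_of_tendsto ((hV t g).sub_const g).norm
            (((hYlim ⟨g, hg⟩).norm.const_mul _).mul_const _) (Eventually.of_forall fun n => ?_)
          have h3 := norm_exp_smul_apply_sub_le (Commute.zero_right (Y n)) t.2 (hexp n)
            (c := 2 * ω) (fun s hs => ?_) g
          · simpa using h3
          · rw [smul_zero, NormedSpace.exp_zero]
            exact ContinuousLinearMap.norm_id_le.trans (Real.one_le_exp (by positivity))
        refine squeeze_zero_norm h2 ?_
        have h4 : Continuous fun t : ℝ≥0 => Real.exp (2 * ω * t) * ‖A ⟨g, hg⟩‖ * t := by fun_prop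
        simpa using h4.tendsto 0
    simpa using h1.add_const f
  let S := C0Semigroup.ofTendstoZero W (2 * ω) hW0 hWadd hWnorm hWcont
  have hS : ∀ t f, S.toFun t f = V t f := fun t f => rfl
  refine ⟨S, ?_, hWnorm, hV⟩
  -- `S(t) f = f + ∫₀ᵗ S(s) A f ds` on the domain of `A`
  have hSint : ∀ (f : A.domain) (t : ℝ≥0),
      S.toFun t f = f + ∫ s in (0 : ℝ)..t, S.toFun s.toNNReal (A f) := by
    intro f t
    refine tendsto_nhds_unique (hV t f) ?_
    have h1 : ∀ n, NormedSpace.exp ((t : ℝ) • Y n) (f : E) =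
        f + ∫ s in (0 : ℝ)..t, NormedSpace.exp (s • Y n) (Y n f) := by
      intro n
      have h2 : ∀ s ∈ uIcc (0 : ℝ) t, HasDerivAt (fun s : ℝ => NormedSpace.exp (s • Y n) (f : E))
          (NormedSpace.exp (s • Y n) (Y n f)) s := fun s _ => by
        simpa using (hasDerivAt_exp_smul_const (Y n) s).clm_apply (hasDerivAt_const s (f : E))
      have h3 : Continuous fun s : ℝ => NormedSpace.exp (s • Y n) (Y n f) :=
        (continuous_iff_continuousAt.2 fun s =>
          (hasDerivAt_exp_smul_const (Y n) s).continuousAt).clm_apply continuous_const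
      rw [intervalIntegral.integral_eq_sub_of_hasDerivAt h2 (h3.intervalIntegrable _ _)]
      simp
    simp only [h1]
    refine Tendsto.const_add _ ?_
    refine intervalIntegral.tendsto_integral_filter_of_dominated_convergence
      (fun _ => Real.exp (2 * ω * t) * (‖A f‖ + 1)) ?_ ?_ (by simp) ?_
    · refine Eventually.of_forall fun n => Continuous.aestronglyMeasurable ?_
      exact (continuous_iff_continuousAt.2 fun s =>
          (hasDerivAt_exp_smul_const (Y n) s).continuousAt).clm_apply continuous_const
    · filter_upwards [(hYlim f).norm.eventually_le_const (lt_add_one ‖A f‖)] with n hn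
      refine ae_of_all _ fun s hs => ?_
      rw [uIoc_of_le t.coe_nonneg] at hs
      refine (ContinuousLinearMap.le_of_opNorm_le _ (hexp n s hs.1.le) _).trans ?_
      have : s ≤ t := hs.2
      gcongr
    · refine ae_of_all _ fun s hs => ?_
      rw [uIoc_of_le t.coe_nonneg] at hs
      have h2 := hV s.toNNReal (A f)
      rw [Real.coe_toNNReal s hs.1.le] at h2
      have h3 : Tendsto (fun n => NormedSpace.exp (s • Y n) (Y n f - A f)) atTop (𝓝 0) := by
        have h4 := (((hYlim f).sub_const (A f)).norm).const_mul (Real.exp (2 * ω * s))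
        simp only [sub_self, norm_zero, mul_zero] at h4
        exact squeeze_zero_norm (fun n =>
          ContinuousLinearMap.le_of_opNorm_le _ (hexp n s hs.1.le) _) h4
      simpa [hS] using h3.add h2
  have hgen : ∀ f : A.domain, S.GeneratorRel f (A f) := fun f => by
    refine C0Semigroup.GeneratorRel.of_hasDerivAt
      (D := fun t => f + ∫ s in (0 : ℝ)..t, S.toFun s.toNNReal (A f)) (hSint f) ?_
    have h1 := ((S.continuous_orbit_toNNReal (A f)).integral_hasStrictDerivAt 0 0).hasDerivAt
    rw [Real.toNNReal_zero, S.toFun_zero_apply] at h1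
    exact h1.const_add _
  have hle : A ≤ S.generator := by
    refine ⟨fun f hf => (hgen ⟨f, hf⟩).mem_domain, ?_⟩
    rintro f ⟨g, hg⟩ rfl
    exact (hgen f).generator_eq.symm
  obtain ⟨R, hR, -⟩ := C0Semigroup.exists_isResolvent_laplace (S := S) hWnorm
    (lt_add_one (2 * ω))
  exact (hQ (2 * ω + 1) (by linarith)).eq_of_le hR hle

end HilleYosida

/-! ### The flow of the growth rate -/

/-- A continuous positive growth rate on `(0, ∞)` along which particles do not reach infinity in
finite time. -/
structure IsGrowthRate (r : ℝ → ℝ) : Prop where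
  continuousOn : ContinuousOn r (Ioi 0)
  pos : ∀ x, 0 < x → 0 < r x
  not_integrableOn : ¬ IntegrableOn (fun τ => 1 / r τ) (Ioi 1)

/-- The time that growth needs from size `1` to size `y` (negative for `y < 1`). -/
noncomputable def growthTime (r : ℝ → ℝ) (y : ℝ) : ℝ := ∫ τ in (1 : ℝ)..y, 1 / r τ

open Classical in
/-- The size that is reached from size `1` in time `s`, the inverse of `growthTime` on `(0, ∞)`. By
convention it is `0` for those negative times that correspond to no positive size. -/
noncomputable def growthSize (r : ℝ → ℝ) (s : ℝ) : ℝ :=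
  if s ∈ growthTime r '' Ioi 0 then Function.invFunOn (growthTime r) (Ioi 0) s else 0

section Interval

/-- A locally integrable function on `(0, ∞)` is integrable on compact subintervals. -/
theorem intervalIntegrable_of_locallyIntegrableOn {q : ℝ → ℝ} (hq : LocallyIntegrableOn q (Ioi 0))
    {x y : ℝ} (hx : 0 < x) (hy : 0 < y) : IntervalIntegrable q volume x y := by
  refine (hq.integrableOn_compact_subset ?_ isCompact_uIcc).intervalIntegrable
  exact (convex_Ioi (0 : ℝ)).ordConnected.uIcc_subset hx hy

/-- The elementary inequality `∫_x^∞ q(y) exp (-∫_x^y q) dy ≤ 1` for `q ≥ 0`. -/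
theorem lintegral_mul_exp_neg_integral_le_one {q : ℝ → ℝ} (hq : LocallyIntegrableOn q (Ioi 0))
    (hq0 : ∀ y, 0 < y → 0 ≤ q y) {x : ℝ} (hx : 0 < x) :
    ∫⁻ y in Ioi x, ENNReal.ofReal (q y * Real.exp (-∫ τ in x..y, q τ)) ≤ 1 := by
  have hint : ∀ {u v : ℝ}, x ≤ u → x ≤ v → IntervalIntegrable q volume u v := fun hu hv =>
    intervalIntegrable_of_locallyIntegrableOn hq (hx.trans_le hu) (hx.trans_le hv)
  set F : ℝ → ℝ := fun y => -Real.exp (-∫ τ in x..y, q τ) with hF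
  have hmono : ∀ b, x ≤ b → MonotoneOn F (uIcc x b) := by
    intro b hb u hu v hv huv
    rw [uIcc_of_le hb] at hu hv
    have h1 : 0 ≤ ∫ τ in u..v, q τ := intervalIntegral.integral_nonneg huv fun τ hτ =>
      hq0 τ (hx.trans_le (hu.1.trans hτ.1))
    have h2 := intervalIntegral.integral_add_adjacent_intervals (hint le_rfl hu.1)
      (hint hu.1 hv.1)
    simp only [hF]
    gcongr
    linarith
  have hstep : ∀ b, x ≤ b →
      ∫⁻ y in Ioc x b, ENNReal.ofReal (q y * Real.exp (-∫ τ in x..y, q τ)) ≤ 1 := by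
    intro b hb
    have hder : ∀ᵐ y ∂volume.restrict (Ioc x b),
        deriv F y = q y * Real.exp (-∫ τ in x..y, q τ) := by
      rw [ae_restrict_iff' measurableSet_Ioc]
      filter_upwards [(hint le_rfl hb).ae_hasDerivAt_integral] with y hy hyb
      have h1 := hy (by rw [uIcc_of_le hb]; exact Ioc_subset_Icc_self hyb) x left_mem_uIcc
      have h2 : HasDerivAt F (-(Real.exp (-∫ τ in x..y, q τ) * -q y)) y := h1.neg.exp.neg
      rw [h2.deriv]
      ring
    have hI : IntervalIntegrable (deriv F) volume x b := (hmono b hb).intervalIntegrable_deriv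
    rw [intervalIntegrable_iff_integrableOn_Ioc_of_le hb] at hI
    have hle : ∫ y in Ioc x b, deriv F y ≤ 1 := by
      rw [← intervalIntegral.integral_of_le hb]
      have h1 := (hmono b hb).intervalIntegral_deriv_mem_uIcc
      have h2 : F x ≤ F b := hmono b hb left_mem_uIcc right_mem_uIcc hb
      rw [uIcc_of_le (by linarith)] at h1
      refine h1.2.trans ?_
      have h3 : 0 < Real.exp (-∫ τ in x..b, q τ) := Real.exp_pos _
      simp only [hF, intervalIntegral.integral_same, neg_zero, Real.exp_zero]
      linarith
    have hnn : 0 ≤ᵐ[volume.restrict (Ioc x b)] deriv F := by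
      filter_upwards [hder, ae_restrict_mem measurableSet_Ioc] with y hy hyb
      rw [hy]
      exact mul_nonneg (hq0 y (hx.trans hyb.1)) (Real.exp_pos _).le
    calc _ = ∫⁻ y in Ioc x b, ENNReal.ofReal (deriv F y) :=
          lintegral_congr_ae (hder.mono fun y hy => by simp only [hy])
      _ = ENNReal.ofReal (∫ y in Ioc x b, deriv F y) :=
          (ofReal_integral_eq_lintegral_ofReal hI hnn).symm
      _ ≤ 1 := ENNReal.ofReal_le_one.2 hle
  have hU : Ioi x = ⋃ n : ℕ, Ioc x (x + n) := by
    ext y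
    simp only [mem_Ioi, mem_iUnion, mem_Ioc]
    refine ⟨fun h => ?_, fun ⟨n, h, _⟩ => h⟩
    obtain ⟨n, hn⟩ := exists_nat_ge (y - x)
    exact ⟨n, h, by linarith⟩
  rw [hU, setLIntegral_iUnion_of_directed]
  · exact iSup_le fun n => hstep _ (by simp)
  · refine Monotone.directed_le fun n m hnm => Ioc_subset_Ioc_right ?_
    have : (n : ℝ) ≤ m := by exact_mod_cast hnm
    linarith

end Interval

namespace IsGrowthRate

variable {r : ℝ → ℝ} (h : IsGrowthRate r)
include h

theorem continuousOn_inv : ContinuousOn (fun τ => 1 / r τ) (Ioi 0) :=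
  continuousOn_const.div h.continuousOn fun x hx => (h.pos x hx).ne'

theorem locallyIntegrableOn_inv : LocallyIntegrableOn (fun τ => 1 / r τ) (Ioi 0) :=
  h.continuousOn_inv.locallyIntegrableOn measurableSet_Ioi

theorem intervalIntegrable_inv {x y : ℝ} (hx : 0 < x) (hy : 0 < y) :
    IntervalIntegrable (fun τ => 1 / r τ) volume x y :=
  intervalIntegrable_of_locallyIntegrableOn h.locallyIntegrableOn_inv hx hy

theorem integral_inv {x y : ℝ} (hx : 0 < x) (hy : 0 < y) :
    ∫ τ in x..y, 1 / r τ = growthTime r y - growthTime r x := by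
  have := intervalIntegral.integral_add_adjacent_intervals
    (h.intervalIntegrable_inv one_pos hx) (h.intervalIntegrable_inv hx hy)
  simp only [growthTime]
  linarith

theorem hasDerivAt_growthTime {y : ℝ} (hy : 0 < y) : HasDerivAt (growthTime r) (1 / r y) y := by
  have hc : ContinuousAt (fun τ => 1 / r τ) y :=
    h.continuousOn_inv.continuousAt (Ioi_mem_nhds hy)
  refine intervalIntegral.integral_hasDerivAt_right (h.intervalIntegrable_inv one_pos hy) ?_ hc
  exact h.continuousOn_inv.stronglyMeasurableAtFilter isOpen_Ioi y hy

theorem continuousOn_growthTime : ContinuousOn (growthTime r) (Ioi 0) := fun _ hy =>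
  (h.hasDerivAt_growthTime hy).continuousAt.continuousWithinAt

theorem strictMonoOn_growthTime : StrictMonoOn (growthTime r) (Ioi 0) := by
  refine strictMonoOn_of_deriv_pos (convex_Ioi 0) h.continuousOn_growthTime fun y hy => ?_
  rw [interior_Ioi] at hy
  rw [(h.hasDerivAt_growthTime hy).deriv]
  exact one_div_pos.2 (h.pos y hy)

/-- The set of times is closed upwards since sizes stay finite. -/
theorem add_mem_image {s t : ℝ} (hs : s ∈ growthTime r '' Ioi 0) (ht : 0 ≤ t) :
    s + t ∈ growthTime r '' Ioi 0 := by
  obtain ⟨x, hx, rfl⟩ := hs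
  obtain ⟨y, hxy, hy⟩ : ∃ y, x ≤ y ∧ growthTime r x + t ≤ growthTime r y := by
    by_contra! hcon
    refine h.not_integrableOn (integrableOn_Ioi_of_intervalIntegral_norm_bounded
      (growthTime r x + t) 1 (fun y : ℝ => ?_) tendsto_id ?_)
    · rcases le_total 1 y with hy | hy
      · exact (intervalIntegrable_iff_integrableOn_Ioc_of_le hy).1
          (h.intervalIntegrable_inv one_pos (one_pos.trans_le hy))
      · simp [Ioc_eq_empty (not_lt.2 hy)]
    · filter_upwards [eventually_ge_atTop (max x 1)] with y hy
      have hy1 : 1 ≤ y := (le_max_right _ _).trans hy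
      refine le_trans (le_of_eq ?_) (hcon y ((le_max_left _ _).trans hy)).le
      refine intervalIntegral.integral_congr fun τ hτ => ?_
      rw [id, uIcc_of_le hy1] at hτ
      exact Real.norm_of_nonneg (one_div_pos.2 (h.pos τ (one_pos.trans_le hτ.1))).le
  have hsub : Icc x y ⊆ Ioi 0 := fun z hz => lt_of_lt_of_le hx hz.1
  obtain ⟨z, hz, hz'⟩ := intermediate_value_Icc hxy (h.continuousOn_growthTime.mono hsub)
    ⟨by linarith, hy⟩
  exact ⟨z, hsub hz, hz'⟩

omit h in
theorem growthSize_of_notMem {s : ℝ} (hs : s ∉ growthTime r '' Ioi 0) : growthSize r s = 0 :=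
  if_neg hs

omit h in
theorem growthSize_pos_of_mem {s : ℝ} (hs : s ∈ growthTime r '' Ioi 0) : 0 < growthSize r s := by
  rw [growthSize, if_pos hs]
  exact Function.invFunOn_mem hs

omit h in
theorem growthTime_growthSize {s : ℝ} (hs : s ∈ growthTime r '' Ioi 0) :
    growthTime r (growthSize r s) = s := by
  rw [growthSize, if_pos hs]
  exact Function.invFunOn_eq hs

theorem growthSize_growthTime {y : ℝ} (hy : 0 < y) : growthSize r (growthTime r y) = y := by
  have hs : growthTime r y ∈ growthTime r '' Ioi 0 := mem_image_of_mem _ hy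
  exact h.strictMonoOn_growthTime.injOn (growthSize_pos_of_mem hs) hy (growthTime_growthSize hs)

omit h in
theorem growthSize_nonneg (s : ℝ) : 0 ≤ growthSize r s := by
  by_cases hs : s ∈ growthTime r '' Ioi 0
  · exact (growthSize_pos_of_mem hs).le
  · rw [growthSize_of_notMem hs]

theorem monotone_growthSize : Monotone (growthSize r) := by
  intro s t hst
  by_cases hs : s ∈ growthTime r '' Ioi 0
  · have ht : t ∈ growthTime r '' Ioi 0 := by
      have := h.add_mem_image hs (sub_nonneg.2 hst)
      rwa [add_sub_cancel] at this
    refine (h.strictMonoOn_growthTime.le_iff_le (growthSize_pos_of_mem hs)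
      (growthSize_pos_of_mem ht)).1 ?_
    rwa [growthTime_growthSize hs, growthTime_growthSize ht]
  · rw [growthSize_of_notMem hs]
    exact growthSize_nonneg t

theorem measurable_growthSize : Measurable (growthSize r) := h.monotone_growthSize.measurable

theorem measurableSet_image : MeasurableSet (growthTime r '' Ioi 0) := by
  have : growthTime r '' Ioi 0 = growthSize r ⁻¹' Ioi 0 := by
    ext s
    refine ⟨fun hs => growthSize_pos_of_mem hs, fun hs => ?_⟩
    by_contra hcon
    rw [mem_preimage, growthSize_of_notMem hcon] at hs
    exact lt_irrefl (0 : ℝ) hs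
  rw [this]
  exact h.measurable_growthSize measurableSet_Ioi

theorem aemeasurable_growthTime : AEMeasurable (growthTime r) (volume.restrict (Ioi 0)) :=
  h.continuousOn_growthTime.aemeasurable measurableSet_Ioi

/-- Change of variables from sizes to times. -/
theorem lintegral_eq_lintegral_image (G : ℝ → ℝ≥0∞) :
    ∫⁻ y in Ioi 0, G y = ∫⁻ s in growthTime r '' Ioi 0,
      ENNReal.ofReal (r (growthSize r s)) * G (growthSize r s) := by
  rw [lintegral_image_eq_lintegral_abs_deriv_mul measurableSet_Ioi
    (fun x hx => (h.hasDerivAt_growthTime hx).hasDerivWithinAt) h.strictMonoOn_growthTime.injOn]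
  refine setLIntegral_congr_fun measurableSet_Ioi fun y hy => ?_
  have hr := h.pos y hy
  rw [h.growthSize_growthTime hy, ← mul_assoc, ← ENNReal.ofReal_mul (abs_nonneg _),
    abs_of_pos (one_div_pos.2 hr), one_div_mul_cancel hr.ne', ENNReal.ofReal_one, one_mul]

/-- Change of variables from sizes to times, with a delay `t`: `F` is evaluated at the size from
which growth leads to `y` in time `t`. -/
theorem lintegral_mul_growthSize_sub (H F : ℝ → ℝ≥0∞) (hF : F 0 = 0) {t : ℝ} (ht : 0 ≤ t) :
    ∫⁻ y in Ioi 0, H y * F (growthSize r (growthTime r y - t)) =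
      ∫⁻ s in growthTime r '' Ioi 0, ENNReal.ofReal (r (growthSize r (s + t))) *
        H (growthSize r (s + t)) * F (growthSize r s) := by
  set I := growthTime r '' Ioi 0
  have hI : MeasurableSet I := h.measurableSet_image
  have h1 : ∫⁻ y in Ioi 0, H y * F (growthSize r (growthTime r y - t)) =
      ∫⁻ s in I, ENNReal.ofReal (r (growthSize r s)) * (H (growthSize r s) *
        F (growthSize r (s - t))) := by
    rw [h.lintegral_eq_lintegral_image]
    refine setLIntegral_congr_fun hI fun s hs => ?_
    rw [growthTime_growthSize hs]
  rw [h1, ← lintegral_indicator hI, ← lintegral_indicator hI,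
    ← lintegral_add_right_eq_self _ t]
  refine lintegral_congr fun s => ?_
  by_cases hs : s ∈ I
  · rw [indicator_of_mem hs, indicator_of_mem (h.add_mem_image hs ht), add_sub_cancel_right,
      mul_assoc]
  · rw [indicator_of_notMem hs]
    by_cases hs' : s + t ∈ I
    · rw [indicator_of_mem hs', add_sub_cancel_right, growthSize_of_notMem hs, hF, mul_zero,
        mul_zero]
    · rw [indicator_of_notMem hs']

/-- The flow pulls null sets back to null sets. -/
theorem ae_growthSize_sub {P : ℝ → Prop} (hP : ∀ᵐ x ∂volume.restrict (Ioi 0), P x) {t : ℝ}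
    (ht : 0 ≤ t) : ∀ᵐ y ∂volume.restrict (Ioi 0),
      growthTime r y - t ∈ growthTime r '' Ioi 0 → P (growthSize r (growthTime r y - t)) := by
  set N := toMeasurable (volume.restrict (Ioi 0)) {x | ¬ P x} ∩ Ioi 0 with hN
  have hNm : MeasurableSet N := (measurableSet_toMeasurable _ _).inter measurableSet_Ioi
  set F : ℝ → ℝ≥0∞ := N.indicator 1
  have hFm : Measurable F := measurable_one.indicator hNm
  have hF0 : F 0 = 0 := indicator_of_notMem (fun h0 => lt_irrefl (0 : ℝ) h0.2) _
  have h1 : ∫⁻ y in Ioi 0, F y = 0 := by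
    rw [lintegral_indicator_one hNm]
    refine measure_mono_null inter_subset_left ?_
    rw [measure_toMeasurable]
    exact hP
  rw [h.lintegral_eq_lintegral_image, lintegral_eq_zero_iff'] at h1
  · have h2 : ∫⁻ y in Ioi 0, 1 * F (growthSize r (growthTime r y - t)) = 0 := by
      rw [h.lintegral_mul_growthSize_sub (fun _ => 1) F hF0 ht]
      refine (lintegral_congr_ae ?_).trans lintegral_zero
      filter_upwards [h1, ae_restrict_mem h.measurableSet_image] with s hs hsI
      have h3 : ENNReal.ofReal (r (growthSize r s)) ≠ 0 := by
        simpa using h.pos _ (growthSize_pos_of_mem hsI)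
      have h4 : F (growthSize r s) = 0 := (mul_eq_zero.1 hs).resolve_left h3
      simp [h4]
    simp only [one_mul] at h2
    have h5 : AEMeasurable (fun y => F (growthSize r (growthTime r y - t)))
        (volume.restrict (Ioi 0)) :=
      hFm.comp_aemeasurable (h.measurable_growthSize.comp_aemeasurable
        (h.aemeasurable_growthTime.sub_const t))
    rw [lintegral_eq_zero_iff' h5] at h2
    filter_upwards [h2] with y hy hyI
    by_contra hcon
    have : growthSize r (growthTime r y - t) ∈ N :=
      ⟨subset_toMeasurable _ _ hcon, growthSize_pos_of_mem hyI⟩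
    simp [F, this] at hy
  · have hrm : AEMeasurable (fun s => r (growthSize r s))
        (volume.restrict (growthTime r '' Ioi 0)) := by
      have hm : Measurable ((Ioi 0).indicator r) := by
        have := h.continuousOn.measurable_piecewise (g := fun _ => (0 : ℝ))
          (s := Ioi 0) continuousOn_const measurableSet_Ioi
        exact this
      refine (hm.comp h.measurable_growthSize).aemeasurable.congr ?_
      filter_upwards [ae_restrict_mem h.measurableSet_image] with s hs
      exact indicator_of_mem (growthSize_pos_of_mem hs) r
    exact hrm.ennreal_ofReal.mul (hFm.comp h.measurable_growthSize).aemeasurable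

/-- Along the flow the weight grows at most exponentially. -/
theorem weight_le {C α : ℝ} {c : ℝ≥0} (hα : 0 ≤ α)
    (hr : ∀ z, 0 < z → r z ≤ C * (c + z)) {x y : ℝ} (hx : 0 < x) (hxy : x ≤ y) :
    weight c α y ≤ Real.exp (α * C * (growthTime r y - growthTime r x)) * weight c α x := by
  have hc : (0 : ℝ) ≤ c := c.2
  have hy := hx.trans_le hxy
  -- `C * growthTime r z - log (c + z)` increases
  have hmono : MonotoneOn (fun z => C * growthTime r z - Real.log (c + z)) (Ioi 0) := by
    have hd : ∀ z ∈ Ioi (0 : ℝ), HasDerivAt (fun z => C * growthTime r z - Real.log (c + z))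
        (C * (1 / r z) - 1 / (c + z)) z := fun z hz => by
      have hz' : (0 : ℝ) < c + z := add_pos_of_nonneg_of_pos hc hz
      exact ((h.hasDerivAt_growthTime hz).const_mul C).sub
        (((hasDerivAt_id z).const_add (c : ℝ)).log hz'.ne')
    refine monotoneOn_of_deriv_nonneg (convex_Ioi 0)
      (fun z hz => (hd z hz).continuousAt.continuousWithinAt)
      (fun z hz => (hd z (interior_subset hz)).differentiableAt.differentiableWithinAt)
      fun z hz => ?_
    have hz0 : 0 < z := interior_subset hz
    rw [(hd z hz0).deriv, sub_nonneg, mul_one_div, div_le_div_iff₀ (by linarith) (h.pos z hz0),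
      one_mul]
    exact hr z hz0
  have h1 := hmono hx hy hxy
  simp only at h1
  have hcx : (0 : ℝ) < c + x := by linarith
  have hcy : (0 : ℝ) < c + y := by linarith
  rw [weight, weight, Real.rpow_def_of_pos hcx, Real.rpow_def_of_pos hcy, ← Real.exp_add]
  refine Real.exp_le_exp.2 ?_
  nlinarith

end IsGrowthRate

/-- Exchange of the order of integration over a triangle, for a product kernel. -/
theorem lintegral_triangle_swap {p q : ℝ → ℝ≥0∞} (hp : AEMeasurable p (volume.restrict (Ioi 0)))
    (hq : AEMeasurable q (volume.restrict (Ioi 0))) :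
    ∫⁻ y in Ioi 0, p y * ∫⁻ x in Ioo 0 y, q x = ∫⁻ x in Ioi 0, q x * ∫⁻ y in Ioi x, p y := by
  have h1 : ∀ y : ℝ, p y * ∫⁻ x in Ioo 0 y, q x =
      ∫⁻ x in Ioi 0, {z : ℝ × ℝ | z.2 < z.1}.indicator (fun z => p z.1 * q z.2) (y, x) := by
    intro y
    rw [← lintegral_const_mul'' _ (hq.mono_measure (Measure.restrict_mono Ioo_subset_Ioi_self
      le_rfl)), ← Ioi_inter_Iio, inter_comm, ← Measure.restrict_restrict measurableSet_Iio,
      ← lintegral_indicator measurableSet_Iio]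
    rfl
  have h2 : ∀ x ∈ Ioi (0 : ℝ), q x * ∫⁻ y in Ioi x, p y =
      ∫⁻ y in Ioi 0, {z : ℝ × ℝ | z.2 < z.1}.indicator (fun z => p z.1 * q z.2) (y, x) := by
    intro x hx
    have hsub : Ioi x ⊆ Ioi 0 := Ioi_subset_Ioi (le_of_lt hx)
    rw [← lintegral_const_mul'' _ (hp.mono_measure (Measure.restrict_mono hsub le_rfl)),
      ← inter_eq_left.2 hsub, ← Measure.restrict_restrict measurableSet_Ioi,
      ← lintegral_indicator measurableSet_Ioi]
    refine lintegral_congr fun y => ?_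
    simp only [indicator, mem_Ioi, mem_ofPred_eq, mul_comm]
  rw [lintegral_congr h1, setLIntegral_congr_fun measurableSet_Ioi h2, lintegral_lintegral_swap]
  refine AEMeasurable.indicator ?_ (measurableSet_lt measurable_snd measurable_fst)
  exact hp.comp_fst.mul hq.comp_snd

/-! ### Transport along the flow -/

theorem lintegral_momentMeasure (c : ℝ≥0) (α : ℝ) (F : ℝ → ℝ≥0∞) :
    ∫⁻ x, F x ∂momentMeasure c α = ∫⁻ x in Ioi 0, ENNReal.ofReal (weight c α x) * F x := by
  have hm : Measurable fun x : ℝ => ENNReal.ofReal (weight c α x) := by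
    unfold weight; fun_prop
  rw [momentMeasure, lintegral_withDensity_eq_lintegral_mul_non_measurable _ hm
    (ae_of_all _ fun _ => ENNReal.ofReal_lt_top)]
  rfl

theorem measurable_indicator_of_continuousOn {f : ℝ → ℝ} (hf : ContinuousOn f (Ioi 0)) :
    Measurable ((Ioi 0).indicator f) :=
  hf.measurable_piecewise (g := fun _ => (0 : ℝ)) continuousOn_const measurableSet_Ioi

/-- Translations act continuously on integrable functions. -/
theorem tendsto_lintegral_enorm_translate_sub {H : ℝ → ℝ} (hH : Integrable H) :
    Tendsto (fun t : ℝ≥0 => ∫⁻ s, ‖H (s - t) - H s‖ₑ) (𝓝 0) (𝓝 0) := by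
  have hm : MemLp H 1 := memLp_one_iff_integrable.2 hH
  let G : C(ℝ≥0, C(ℝ, ℝ)) := ContinuousMap.curry ⟨fun p : ℝ≥0 × ℝ => p.2 - p.1, by fun_prop⟩
  have hp : ∀ t : ℝ≥0, MeasurePreserving (G t) := fun t =>
    measurePreserving_sub_right volume (t : ℝ)
  have h1 := (tendsto_const_nhds (x := hm.toLp H)).compMeasurePreservingLp (G.continuous.tendsto 0)
    hp (hp 0) ENNReal.one_ne_top
  have h2 := tendsto_iff_edist_tendsto_0.1 h1
  refine h2.congr fun t => ?_
  rw [Lp.edist_def, eLpNorm_one_eq_lintegral_enorm]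
  refine lintegral_congr_ae ?_
  filter_upwards [Lp.coeFn_compMeasurePreserving (hm.toLp H) (hp t),
    Lp.coeFn_compMeasurePreserving (hm.toLp H) (hp 0), hm.coeFn_toLp,
    (hp t).quasiMeasurePreserving.ae hm.coeFn_toLp] with s e1 e2 e3 e4
  have e5 : G 0 s = s := by simp [G]
  have e6 : G t s = s - t := rfl
  rw [e6] at e4
  rw [Pi.sub_apply, e1, e2, Function.comp, Function.comp, e5, e3, e6, e4]

/-- The logarithmic loss by fragmentation along the flow, counted from size `1`. -/
noncomputable def lossExponent (r a : ℝ → ℝ) (y : ℝ) : ℝ := ∫ τ in (1 : ℝ)..y, a τ / r τ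

/-- The stationary profile `exp (-∫ a / r) / r` of `∂ₓ(r u) + a u = 0`, extended by zero to
nonpositive sizes. -/
noncomputable def steadyProfile (r a : ℝ → ℝ) : ℝ → ℝ :=
  (Ioi 0).indicator fun y => Real.exp (-lossExponent r a y) / r y

/-- The solution of `∂ₜu + ∂ₓ(r u) + a u = 0` at time `t`: the quotient of `u` by the stationary
profile is constant along the flow. -/
noncomputable def transport (r a : ℝ → ℝ) (t : ℝ) (f : ℝ → ℝ) (y : ℝ) : ℝ :=
  steadyProfile r a y * ((steadyProfile r a (growthSize r (growthTime r y - t)))⁻¹ *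
    f (growthSize r (growthTime r y - t)))

/-- The moment weight damped by the loss, extended by zero to nonpositive sizes. -/
noncomputable def dampedWeight (c : ℝ≥0) (α : ℝ) (r a : ℝ → ℝ) : ℝ → ℝ :=
  (Ioi 0).indicator fun y => weight c α y * Real.exp (-lossExponent r a y)

theorem continuousOn_weight (c : ℝ≥0) (α : ℝ) : ContinuousOn (weight c α) (Ioi 0) := by
  unfold weight
  refine ContinuousOn.rpow_const (by fun_prop) fun x hx => Or.inl ?_
  exact (add_pos_of_nonneg_of_pos c.2 hx).ne'

theorem steadyProfile_zero (r a : ℝ → ℝ) : steadyProfile r a 0 = 0 := by simp [steadyProfile]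

theorem dampedWeight_nonneg (c : ℝ≥0) (α : ℝ) (r a : ℝ → ℝ) (y : ℝ) :
    0 ≤ dampedWeight c α r a y :=
  indicator_nonneg (fun _ hy => mul_nonneg (weight_pos c α hy).le (Real.exp_pos _).le) y

namespace IsGrowthRate

variable {r a : ℝ → ℝ} (h : IsGrowthRate r)
include h

theorem locallyIntegrableOn_div (ha : LocallyIntegrableOn a (Ioi 0)) :
    LocallyIntegrableOn (fun τ => a τ / r τ) (Ioi 0) := by
  have := ha.mul_continuousOn h.continuousOn_inv isOpen_Ioi.isLocallyClosed
  simpa only [mul_one_div] using this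

theorem integral_div (ha : LocallyIntegrableOn a (Ioi 0)) {x y : ℝ} (hx : 0 < x) (hy : 0 < y) :
    ∫ τ in x..y, a τ / r τ = lossExponent r a y - lossExponent r a x := by
  have hq := h.locallyIntegrableOn_div ha
  have := intervalIntegral.integral_add_adjacent_intervals
    (intervalIntegrable_of_locallyIntegrableOn hq one_pos hx)
    (intervalIntegrable_of_locallyIntegrableOn hq hx hy)
  simp only [lossExponent]
  linarith

theorem lossExponent_mono (ha : LocallyIntegrableOn a (Ioi 0)) (ha0 : ∀ y, 0 < y → 0 ≤ a y)
    {x y : ℝ} (hx : 0 < x) (hxy : x ≤ y) : lossExponent r a x ≤ lossExponent r a y := by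
  rw [← sub_nonneg, ← h.integral_div ha hx (hx.trans_le hxy)]
  refine intervalIntegral.integral_nonneg hxy fun τ hτ => ?_
  have hτ0 := hx.trans_le hτ.1
  exact div_nonneg (ha0 τ hτ0) (h.pos τ hτ0).le

theorem continuousOn_lossExponent (ha : LocallyIntegrableOn a (Ioi 0)) :
    ContinuousOn (lossExponent r a) (Ioi 0) := by
  intro y hy
  have hy : 0 < y := hy
  have h0 : 0 < min 1 y / 2 := by positivity
  have h1 : min 1 y / 2 < min 1 y := by linarith
  have h2 := intervalIntegral.continuousOn_primitive_interval'
    (intervalIntegrable_of_locallyIntegrableOn (h.locallyIntegrableOn_div ha) h0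
      (show 0 < max 1 y + 1 by positivity)) (a := 1) (by
        rw [uIcc_of_le (by linarith [min_le_left 1 y, le_max_left 1 y])]
        exact ⟨by linarith [min_le_left 1 y], by linarith [le_max_left 1 y]⟩)
  refine ((h2 y ?_).continuousAt ?_).continuousWithinAt
  all_goals rw [uIcc_of_le (by linarith [min_le_left 1 y, le_max_left 1 y])]
  · exact ⟨by linarith [min_le_right 1 y], by linarith [le_max_right 1 y]⟩
  · exact Icc_mem_nhds (by linarith [min_le_right 1 y]) (by linarith [le_max_right 1 y])

theorem steadyProfile_pos {y : ℝ} (hy : 0 < y) : 0 < steadyProfile r a y := by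
  rw [steadyProfile, indicator_of_mem (mem_Ioi.2 hy)]
  exact div_pos (Real.exp_pos _) (h.pos y hy)

theorem measurable_steadyProfile (ha : LocallyIntegrableOn a (Ioi 0)) :
    Measurable (steadyProfile r a) :=
  measurable_indicator_of_continuousOn ((h.continuousOn_lossExponent ha).neg.rexp.div
    h.continuousOn fun x hx => (h.pos x hx).ne')

theorem continuousOn_dampedWeight_aux (c : ℝ≥0) (α : ℝ) (ha : LocallyIntegrableOn a (Ioi 0)) :
    ContinuousOn (fun y => weight c α y * Real.exp (-lossExponent r a y)) (Ioi 0) :=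
  (continuousOn_weight c α).mul (h.continuousOn_lossExponent ha).neg.rexp

theorem measurable_dampedWeight (c : ℝ≥0) (α : ℝ) (ha : LocallyIntegrableOn a (Ioi 0)) :
    Measurable (dampedWeight c α r a) :=
  measurable_indicator_of_continuousOn (h.continuousOn_dampedWeight_aux c α ha)

theorem continuousAt_dampedWeight (c : ℝ≥0) (α : ℝ) (ha : LocallyIntegrableOn a (Ioi 0)) {y : ℝ}
    (hy : 0 < y) : ContinuousAt (dampedWeight c α r a) y := by
  refine ((h.continuousOn_dampedWeight_aux c α ha).continuousAt (Ioi_mem_nhds hy)).congr ?_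
  filter_upwards [Ioi_mem_nhds hy] with z hz
  rw [dampedWeight, indicator_of_mem hz]

theorem mul_weight_mul_steadyProfile (c : ℝ≥0) (α : ℝ) {y : ℝ} (hy : 0 < y) :
    r y * (weight c α y * steadyProfile r a y) = dampedWeight c α r a y := by
  have := (h.pos y hy).ne'
  rw [steadyProfile, dampedWeight, indicator_of_mem (mem_Ioi.2 hy),
    indicator_of_mem (mem_Ioi.2 hy)]
  field_simp

theorem tendsto_growthSize_add {x : ℝ} (hx : 0 < x) :
    Tendsto (fun t : ℝ≥0 => growthSize r (growthTime r x + t)) (𝓝 0) (𝓝 x) := by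
  have hmem : ∀ t : ℝ≥0, growthTime r x + t ∈ growthTime r '' Ioi 0 := fun t =>
    h.add_mem_image (mem_image_of_mem _ hx) t.2
  refine tendsto_order.2 ⟨fun z hz => Eventually.of_forall fun t => ?_, fun z hz => ?_⟩
  · calc z < growthSize r (growthTime r x) := by rwa [h.growthSize_growthTime hx]
      _ ≤ _ := h.monotone_growthSize (by simp)
  · have hz0 : 0 < z := hx.trans hz
    have h1 : growthTime r x < growthTime r z := h.strictMonoOn_growthTime hx hz0 hz
    have h2 : Tendsto (fun t : ℝ≥0 => growthTime r x + t) (𝓝 0) (𝓝 (growthTime r x)) := by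
      have : Continuous fun t : ℝ≥0 => growthTime r x + t := by fun_prop
      simpa using this.tendsto 0
    filter_upwards [h2.eventually_lt_const h1] with t ht
    refine (h.strictMonoOn_growthTime.lt_iff_lt (growthSize_pos_of_mem (hmem t)) hz0).1 ?_
    rwa [growthTime_growthSize (hmem t)]

theorem dampedWeight_growthSize_add_le {c : ℝ≥0} {α C : ℝ} (hα : 0 ≤ α)
    (hr : ∀ z, 0 < z → r z ≤ C * (c + z)) (ha : LocallyIntegrableOn a (Ioi 0))
    (ha0 : ∀ y, 0 < y → 0 ≤ a y) {s t : ℝ} (hs : s ∈ growthTime r '' Ioi 0) (ht : 0 ≤ t) :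
    dampedWeight c α r a (growthSize r (s + t)) ≤
      Real.exp (α * C * t) * dampedWeight c α r a (growthSize r s) := by
  have hst := h.add_mem_image hs ht
  have h0 := growthSize_pos_of_mem hs
  have h1 := growthSize_pos_of_mem hst
  have hle : growthSize r s ≤ growthSize r (s + t) := h.monotone_growthSize (by linarith)
  have hw := h.weight_le hα hr h0 hle
  rw [growthTime_growthSize hs, growthTime_growthSize hst, add_sub_cancel_left] at hw
  rw [dampedWeight, indicator_of_mem (mem_Ioi.2 h0), indicator_of_mem (mem_Ioi.2 h1), ← mul_assoc]
  have := h.lossExponent_mono ha ha0 h0 hle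
  have h2 := weight_pos c α h0
  gcongr

/-- The moment norm of the transported function in the time variable. -/
theorem lintegral_transport (c : ℝ≥0) (α : ℝ) (φ f : ℝ → ℝ) {t : ℝ} (ht : 0 ≤ t) :
    ∫⁻ y in Ioi 0, ENNReal.ofReal (weight c α y) * ‖φ y * transport r a t f y‖ₑ =
      ∫⁻ s in growthTime r '' Ioi 0,
        ENNReal.ofReal (dampedWeight c α r a (growthSize r (s + t))) * ‖φ (growthSize r (s + t))‖ₑ *
          ‖(steadyProfile r a (growthSize r s))⁻¹ * f (growthSize r s)‖ₑ := by
  have h1 := h.lintegral_mul_growthSize_sub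
    (fun y => ENNReal.ofReal (weight c α y) * ‖φ y‖ₑ * ‖steadyProfile r a y‖ₑ)
    (fun x => ‖(steadyProfile r a x)⁻¹ * f x‖ₑ) (by simp [steadyProfile_zero]) ht
  simp only [transport, enorm_mul, mul_assoc] at h1 ⊢
  rw [h1]
  refine setLIntegral_congr_fun h.measurableSet_image fun s hs => ?_
  have h2 := growthSize_pos_of_mem (h.add_mem_image hs ht)
  rw [← h.mul_weight_mul_steadyProfile c α h2, ENNReal.ofReal_mul (h.pos _ h2).le,
    ENNReal.ofReal_mul (weight_pos c α h2).le,
    Real.enorm_of_nonneg (h.steadyProfile_pos h2).le]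
  ring

theorem transport_zero (f : ℝ → ℝ) {y : ℝ} (hy : 0 < y) : transport r a 0 f y = f y := by
  rw [transport, sub_zero, h.growthSize_growthTime hy, ← mul_assoc,
    mul_inv_cancel₀ (h.steadyProfile_pos hy).ne', one_mul]

theorem lintegral_weight_eq (c : ℝ≥0) (α : ℝ) (φ f : ℝ → ℝ) :
    ∫⁻ y in Ioi 0, ENNReal.ofReal (weight c α y) * ‖φ y * f y‖ₑ =
      ∫⁻ s in growthTime r '' Ioi 0,
        ENNReal.ofReal (dampedWeight c α r a (growthSize r s)) * ‖φ (growthSize r s)‖ₑ *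
          ‖(steadyProfile r a (growthSize r s))⁻¹ * f (growthSize r s)‖ₑ := by
  have := h.lintegral_transport c α (a := a) φ f le_rfl
  simp only [add_zero] at this
  rw [← this]
  refine setLIntegral_congr_fun measurableSet_Ioi fun y hy => ?_
  rw [h.transport_zero f hy]

theorem lintegral_transport_le {c : ℝ≥0} {α C : ℝ} (hα : 0 ≤ α)
    (hr : ∀ z, 0 < z → r z ≤ C * (c + z)) (ha : LocallyIntegrableOn a (Ioi 0))
    (ha0 : ∀ y, 0 < y → 0 ≤ a y) (f : ℝ → ℝ) {t : ℝ} (ht : 0 ≤ t) :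
    ∫⁻ y, ‖transport r a t f y‖ₑ ∂momentMeasure c α ≤
      ENNReal.ofReal (Real.exp (α * C * t)) * ∫⁻ y, ‖f y‖ₑ ∂momentMeasure c α := by
  have h1 := h.lintegral_transport c α (a := a) (fun _ => 1) f ht
  have h2 := h.lintegral_weight_eq c α (a := a) (fun _ => 1) f
  simp only [one_mul] at h1 h2
  rw [lintegral_momentMeasure, lintegral_momentMeasure, h1, h2,
    ← lintegral_const_mul' _ _ ENNReal.ofReal_ne_top]
  refine setLIntegral_mono' h.measurableSet_image fun s hs => ?_
  rw [← mul_assoc, ← mul_assoc, ← ENNReal.ofReal_mul (Real.exp_pos _).le]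
  gcongr
  exact h.dampedWeight_growthSize_add_le hα hr ha ha0 hs ht

theorem transport_add (f : ℝ → ℝ) {s t : ℝ} (ht : 0 ≤ t) {y : ℝ} :
    transport r a (s + t) f y = transport r a s (transport r a t f) y := by
  by_cases hI : growthTime r y - s ∈ growthTime r '' Ioi 0
  · have h1 := (h.steadyProfile_pos (a := a) (growthSize_pos_of_mem hI)).ne'
    simp only [transport]
    rw [growthTime_growthSize hI, sub_add_eq_sub_sub, ← mul_assoc (steadyProfile r a
      (growthSize r (growthTime r y - s)))⁻¹, inv_mul_cancel₀ h1, one_mul]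
  · have hI' : growthTime r y - (s + t) ∉ growthTime r '' Ioi 0 := fun hcon => hI (by
      have := h.add_mem_image hcon ht
      rwa [← sub_sub, sub_add_cancel] at this)
    simp only [transport, growthSize_of_notMem hI, growthSize_of_notMem hI', steadyProfile_zero]
    simp

theorem aestronglyMeasurable_transport {c : ℝ≥0} {α : ℝ} (ha : LocallyIntegrableOn a (Ioi 0))
    {f : ℝ → ℝ} (hf : Measurable f) (t : ℝ) :
    AEStronglyMeasurable (transport r a t f) (momentMeasure c α) := by
  have h1 : AEMeasurable (fun y => growthSize r (growthTime r y - t)) (volume.restrict (Ioi 0)) :=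
    h.measurable_growthSize.comp_aemeasurable (h.aemeasurable_growthTime.sub_const t)
  have h2 := h.measurable_steadyProfile ha
  have h3 : AEMeasurable (transport r a t f) (volume.restrict (Ioi 0)) :=
    h2.aemeasurable.mul ((h2.comp_aemeasurable h1).inv.mul (hf.comp_aemeasurable h1))
  exact h3.aestronglyMeasurable.mono_ac (withDensity_absolutelyContinuous _ _)

theorem transport_congr {c : ℝ≥0} {α : ℝ} {f g : ℝ → ℝ} (hfg : f =ᵐ[momentMeasure c α] g) {t : ℝ}
    (ht : 0 ≤ t) : transport r a t f =ᵐ[momentMeasure c α] transport r a t g := by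
  refine (ae_momentMeasure_iff c α).2 ?_
  filter_upwards [h.ae_growthSize_sub ((ae_momentMeasure_iff c α).1 hfg) ht] with y hy
  by_cases hI : growthTime r y - t ∈ growthTime r '' Ioi 0
  · rw [transport, transport, hy hI]
  · simp [transport, growthSize_of_notMem hI, steadyProfile_zero]

/-- Strong continuity of the transport at `t = 0`. -/
theorem tendsto_lintegral_transport_sub {c : ℝ≥0} {α C : ℝ} (hα : 0 ≤ α)
    (hr : ∀ z, 0 < z → r z ≤ C * (c + z)) (ha : LocallyIntegrableOn a (Ioi 0))
    (ha0 : ∀ y, 0 < y → 0 ≤ a y) {f : ℝ → ℝ} (hf : Measurable f)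
    (hfi : ∫⁻ y, ‖f y‖ₑ ∂momentMeasure c α ≠ ∞) :
    Tendsto (fun t : ℝ≥0 => ∫⁻ y, ‖transport r a t f y - f y‖ₑ ∂momentMeasure c α)
      (𝓝 0) (𝓝 0) := by
  set I := growthTime r '' Ioi 0
  have hI : MeasurableSet I := h.measurableSet_image
  -- in the time variable the transport is a translation of `q`
  let q : ℝ → ℝ := fun s => (steadyProfile r a (growthSize r s))⁻¹ * f (growthSize r s)
  let m : ℝ → ℝ := fun s => dampedWeight c α r a (growthSize r s)
  have hq : Measurable q := ((h.measurable_steadyProfile ha).comp h.measurable_growthSize).inv.mul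
    (hf.comp h.measurable_growthSize)
  have hm : Measurable m := (h.measurable_dampedWeight c α ha).comp h.measurable_growthSize
  have hq0 : ∀ s ∉ I, q s = 0 := fun s hs => by
    simp [q, growthSize_of_notMem hs, steadyProfile_zero]
  have hm0 : ∀ s, 0 ≤ m s := fun s => dampedWeight_nonneg c α r a _
  have hH : Integrable fun s => m s * q s := by
    refine ⟨(hm.mul hq).aestronglyMeasurable, ?_⟩
    have h2 := h.lintegral_weight_eq c α (a := a) (fun _ => 1) f
    simp only [one_mul, enorm_one, mul_one] at h2
    rw [lintegral_momentMeasure, h2, ← lintegral_indicator hI] at hfi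
    rw [HasFiniteIntegral, lt_top_iff_ne_top]
    refine ne_of_eq_of_ne (lintegral_congr fun s => ?_) hfi
    by_cases hs : s ∈ I
    · rw [indicator_of_mem hs, enorm_mul, Real.enorm_of_nonneg (hm0 s)]
    · rw [indicator_of_notMem hs, hq0 s hs]
      simp
  have hbound : ∀ t : ℝ≥0, ∫⁻ y, ‖transport r a t f y - f y‖ₑ ∂momentMeasure c α ≤
      (∫⁻ s, ‖(m (s + t) - m s) * q s‖ₑ) +
        ∫⁻ s, ‖(m (s - t) * q (s - t)) - m s * q s‖ₑ := by
    intro t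
    have h1 : ∫⁻ y, ‖transport r a t f y - f y‖ₑ ∂momentMeasure c α =
        ∫⁻ s in I, ‖m s * q (s - t) - m s * q s‖ₑ := by
      rw [lintegral_momentMeasure, h.lintegral_eq_lintegral_image]
      refine setLIntegral_congr_fun hI fun s hs => ?_
      have hs0 := growthSize_pos_of_mem hs
      have hp := h.steadyProfile_pos (a := a) hs0
      simp only [transport]
      rw [growthTime_growthSize hs, ← mul_assoc, ← ENNReal.ofReal_mul (h.pos _ hs0).le,
        ← Real.enorm_of_nonneg (mul_nonneg (h.pos _ hs0).le (weight_pos c α hs0).le), ← enorm_mul]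
      simp only [m, q]
      rw [← h.mul_weight_mul_steadyProfile c α hs0]
      congr 1
      field_simp
    rw [h1]
    calc ∫⁻ s in I, ‖m s * q (s - t) - m s * q s‖ₑ
        ≤ ∫⁻ s, ‖m s * q (s - t) - m s * q s‖ₑ := setLIntegral_le_lintegral _ _
      _ ≤ ∫⁻ s, (‖(m s - m (s - t)) * q (s - t)‖ₑ +
            ‖(m (s - t) * q (s - t)) - m s * q s‖ₑ) := by
          refine lintegral_mono fun s => ?_
          refine le_trans (le_of_eq ?_) (enorm_add_le _ _)
          congr 1
          ring
      _ = (∫⁻ s, ‖(m s - m (s - t)) * q (s - t)‖ₑ) +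
            ∫⁻ s, ‖(m (s - t) * q (s - t)) - m s * q s‖ₑ := by
          refine lintegral_add_left ?_ _
          fun_prop
      _ = _ := by
          rw [← lintegral_add_right_eq_self (fun s => ‖(m s - m (s - t)) * q (s - t)‖ₑ) (t : ℝ)]
          simp only [add_sub_cancel_right]
  have hlim1 : Tendsto (fun t : ℝ≥0 => ∫⁻ s, ‖(m (s + t) - m s) * q s‖ₑ) (𝓝 0) (𝓝 0) := by
    have h0 : ∫⁻ _ : ℝ, (0 : ℝ≥0∞) = 0 := by simp
    rw [← h0]
    refine tendsto_lintegral_filter_of_dominated_convergence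
      (fun s => ENNReal.ofReal (Real.exp |α * C| + 1) * ‖m s * q s‖ₑ) ?_ ?_ ?_ ?_
    · exact Eventually.of_forall fun t => by fun_prop
    · filter_upwards [Iic_mem_nhds (zero_lt_one : (0 : ℝ≥0) < 1)] with t ht
      refine ae_of_all _ fun s => ?_
      by_cases hs : s ∈ I
      · rw [enorm_mul _ (q s), enorm_mul _ (q s), ← mul_assoc, Real.enorm_of_nonneg (hm0 s),
          ← ENNReal.ofReal_mul (by positivity), Real.enorm_eq_ofReal_abs]
        gcongr
        have h1 := h.dampedWeight_growthSize_add_le (c := c) (a := a) hα hr ha ha0 hs t.2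
        have h2 : Real.exp (α * C * t) ≤ Real.exp |α * C| := by
          refine Real.exp_le_exp.2 ?_
          have ht1 : (t : ℝ) ≤ 1 := by exact_mod_cast ht
          calc α * C * t ≤ |α * C| * t := by gcongr; exact le_abs_self _
            _ ≤ |α * C| := mul_le_of_le_one_right (abs_nonneg _) ht1
        have h3 : m (s + t) ≤ Real.exp |α * C| * m s := 
          h1.trans (mul_le_mul_of_nonneg_right h2 (hm0 s))
        have h4 := hm0 s
        have h5 := hm0 (s + t)
        rw [abs_le]
        constructor <;> nlinarith [Real.exp_pos |α * C|]
      · simp [hq0 s hs]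
    · rw [lintegral_const_mul' _ _ ENNReal.ofReal_ne_top]
      exact ENNReal.mul_ne_top ENNReal.ofReal_ne_top hH.2.ne
    · refine ae_of_all _ fun s => ?_
      by_cases hs : s ∈ I
      · obtain ⟨x, hx, rfl⟩ := hs
        have h1 := (h.continuousAt_dampedWeight c α ha hx).tendsto.comp
          (h.tendsto_growthSize_add hx)
        have h2 : m (growthTime r x) = dampedWeight c α r a x := by
          simp only [m]
          rw [h.growthSize_growthTime hx]
        rw [← h2] at h1
        have h3 := ((h1.sub_const (m (growthTime r x))).mul_const (q (growthTime r x))).enorm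
        simpa using h3
      · simp [hq0 s hs]
  have hlim := hlim1.add (tendsto_lintegral_enorm_translate_sub hH)
  rw [add_zero] at hlim
  exact tendsto_of_tendsto_of_tendsto_of_le_of_le tendsto_const_nhds hlim (fun _ => zero_le) hbound

end IsGrowthRate

/-! ### The growth semigroup and its resolvent -/

theorem MomentSpace.enorm_eq {c : ℝ≥0} {α : ℝ} (f : MomentSpace c α) :
    ‖f‖ₑ = ∫⁻ x, ‖f x‖ₑ ∂momentMeasure c α := by
  rw [Lp.enorm_def, eLpNorm_one_eq_lintegral_enorm]

theorem MomentSpace.lintegral_enorm_ne_top {c : ℝ≥0} {α : ℝ} (f : MomentSpace c α) :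
    ∫⁻ x, ‖f x‖ₑ ∂momentMeasure c α ≠ ∞ := by
  rw [← MomentSpace.enorm_eq]
  exact enorm_ne_top

theorem MomentSpace.lintegral_ofReal_eq {c : ℝ≥0} {α : ℝ} {f : MomentSpace c α} (hf : 0 ≤ f) :
    ∫⁻ x, ENNReal.ofReal (f x) ∂momentMeasure c α = ‖f‖ₑ := by
  rw [MomentSpace.enorm_eq]
  refine lintegral_congr_ae ?_
  filter_upwards [(Lp.coeFn_nonneg f).2 hf] with x hx
  exact (Real.enorm_of_nonneg hx).symm

namespace IsGrowthRate

variable {r a : ℝ → ℝ} {c : ℝ≥0} {α C : ℝ} (h : IsGrowthRate r)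
include h

/-- Transport along the flow is a strongly continuous semigroup on the moment space. -/
theorem exists_growthSemigroup (hα : 0 ≤ α) (hr : ∀ z, 0 < z → r z ≤ C * (c + z))
    (ha : LocallyIntegrableOn a (Ioi 0)) (ha0 : ∀ y, 0 < y → 0 ≤ a y) :
    ∃ U : C0Semigroup (MomentSpace c α), (∀ t : ℝ≥0, ‖U.toFun t‖ ≤ Real.exp (α * C * t)) ∧
      ∀ (t : ℝ≥0) (f : MomentSpace c α), U.toFun t f =ᵐ[momentMeasure c α] transport r a t f := by
  have hle := fun (t : ℝ≥0) (f : MomentSpace c α) =>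
    h.lintegral_transport_le hα hr ha ha0 f t.coe_nonneg
  have hmem : ∀ (t : ℝ≥0) (f : MomentSpace c α),
      MemLp (transport r a t f) 1 (momentMeasure c α) := by
    refine fun t f =>
      ⟨h.aestronglyMeasurable_transport ha (Lp.stronglyMeasurable f).measurable t, ?_⟩
    rw [eLpNorm_one_eq_lintegral_enorm]
    exact (hle t f).trans_lt (ENNReal.mul_lt_top ENNReal.ofReal_lt_top
      (MomentSpace.lintegral_enorm_ne_top f).lt_top)
  have hnorm : ∀ (t : ℝ≥0) (f : MomentSpace c α),
      ‖(hmem t f).toLp‖ ≤ Real.exp (α * C * t) * ‖f‖ := by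
    intro t f
    rw [Lp.norm_toLp, Lp.norm_def, eLpNorm_one_eq_lintegral_enorm, eLpNorm_one_eq_lintegral_enorm,
      ← ENNReal.toReal_ofReal (Real.exp_pos (α * C * t)).le, ← ENNReal.toReal_mul]
    exact ENNReal.toReal_mono (ENNReal.mul_ne_top ENNReal.ofReal_ne_top
      (MomentSpace.lintegral_enorm_ne_top f)) (hle t f)
  let W : ℝ≥0 → MomentSpace c α →L[ℝ] MomentSpace c α := fun t => LinearMap.mkContinuous
    { toFun := fun f => (hmem t f).toLp
      map_add' := fun f g => by
        rw [← MemLp.toLp_add]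
        refine MemLp.toLp_congr _ _ ?_
        refine (h.transport_congr (Lp.coeFn_add f g) t.coe_nonneg).trans (ae_of_all _ fun y => ?_)
        simp only [transport, Pi.add_apply]
        ring
      map_smul' := fun k f => by
        rw [RingHom.id_apply, ← MemLp.toLp_const_smul]
        refine MemLp.toLp_congr _ _ ?_
        refine (h.transport_congr (Lp.coeFn_smul k f) t.coe_nonneg).trans (ae_of_all _ fun y => ?_)
        simp only [transport, Pi.smul_apply, smul_eq_mul]
        ring } _ (hnorm t)
  have hW : ∀ t f, W t f =ᵐ[momentMeasure c α] transport r a t f := fun t f =>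
    (hmem t f).coeFn_toLp
  have hWnorm : ∀ t : ℝ≥0, ‖W t‖ ≤ Real.exp (α * C * t) := fun t =>
    ContinuousLinearMap.opNorm_le_bound _ (Real.exp_pos _).le (hnorm t)
  refine ⟨C0Semigroup.ofTendstoZero W (α * C) ?_ ?_ hWnorm ?_, hWnorm, hW⟩
  · ext1 f
    refine Lp.ext ((hW 0 f).trans ?_)
    filter_upwards [ae_momentMeasure_pos c α] with y hy
    exact h.transport_zero f hy
  · intro s t
    ext1 f
    refine Lp.ext ((hW (s + t) f).trans ?_)
    refine EventuallyEq.trans ?_ (hW s (W t f)).symm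
    refine EventuallyEq.trans ?_ (h.transport_congr (hW t f) s.coe_nonneg).symm
    refine ae_of_all _ fun y => ?_
    rw [NNReal.coe_add, h.transport_add _ t.coe_nonneg]
  · intro f
    rw [tendsto_iff_edist_tendsto_0]
    refine (h.tendsto_lintegral_transport_sub hα hr ha ha0 (Lp.stronglyMeasurable f).measurable
      (MomentSpace.lintegral_enorm_ne_top f)).congr fun t => ?_
    rw [Lp.edist_def, eLpNorm_one_eq_lintegral_enorm]
    refine lintegral_congr_ae ?_
    filter_upwards [hW t f] with y hy
    rw [Pi.sub_apply, hy]

theorem lintegral_inv {x y : ℝ} (hx : 0 < x) (hxy : x ≤ y) :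
    ∫⁻ τ in Ioo x y, ENNReal.ofReal (1 / r τ) =
      ENNReal.ofReal (growthTime r y - growthTime r x) := by
  rw [← h.integral_inv hx (hx.trans_le hxy), intervalIntegral.integral_of_le hxy,
    integral_Ioc_eq_integral_Ioo, ofReal_integral_eq_lintegral_ofReal]
  · have := (intervalIntegrable_iff_integrableOn_Ioc_of_le hxy).1
      (h.intervalIntegrable_inv hx (hx.trans_le hxy))
    exact this.mono_set Ioo_subset_Ioc_self
  · filter_upwards [ae_restrict_mem measurableSet_Ioo] with τ hτ
    exact (one_div_pos.2 (h.pos τ (hx.trans hτ.1))).le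

theorem isGrowthAbsorptionSemigroup (ha : LocallyIntegrableOn a (Ioi 0))
    {U : C0Semigroup (MomentSpace c α)}
    (hU : ∀ (t : ℝ≥0) (f : MomentSpace c α),
      U.toFun t f =ᵐ[momentMeasure c α] transport r a t f) :
    IsGrowthAbsorptionSemigroup r a U := by
  intro t f
  filter_upwards [hU t f, ae_momentMeasure_pos c α] with y hy hy0
  rw [hy]
  refine ⟨fun hle => ?_, fun x hx hxt => ?_⟩
  · have hI : growthTime r y - t ∉ growthTime r '' Ioi 0 := by
      rintro ⟨x, hx, hxt⟩
      have hx : 0 < x := hx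
      have hxy : x ≤ y := by
        refine (h.strictMonoOn_growthTime.le_iff_le hx hy0).1 ?_
        have := t.coe_nonneg
        linarith
      -- the time needed from `x / 2` to `y` exceeds `t`
      have h1 : growthTime r (x / 2) < growthTime r x :=
        h.strictMonoOn_growthTime (half_pos hx) hx (half_lt_self hx)
      have h2 : ∫⁻ τ in Ioo (x / 2) y, ENNReal.ofReal (1 / r τ) ≤ t :=
        (lintegral_mono_set (Ioo_subset_Ioo_left (half_pos hx).le)).trans hle
      rw [h.lintegral_inv (half_pos hx) ((half_le_self hx.le).trans hxy),
        ENNReal.ofReal_le_iff_le_toReal ENNReal.coe_ne_top, ENNReal.coe_toReal] at h2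
      linarith
    simp [transport, growthSize_of_notMem hI, steadyProfile_zero]
  · have hx0 : 0 < x := hx.1
    rw [h.integral_inv hx0 hy0] at hxt
    have h1 : growthTime r y - t = growthTime r x := by linarith
    have hrx := (h.pos x hx0).ne'
    have hry := (h.pos y hy0).ne'
    rw [transport, h1, h.growthSize_growthTime hx0, h.integral_div ha hx0 hy0, steadyProfile,
      indicator_of_mem (mem_Ioi.2 hx0), indicator_of_mem (mem_Ioi.2 hy0), neg_sub, Real.exp_sub,
      Real.exp_neg, Real.exp_neg]
    field_simp

/-- The explicit resolvent kernel of the growth semigroup, applied to the positive part of `f`. -/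
theorem lintegral_exp_mul_transport (l : ℝ) (f : ℝ → ℝ) {y : ℝ} (hy : 0 < y) :
    ∫⁻ t in Ioi 0, ENNReal.ofReal (Real.exp (-l * t)) * ENNReal.ofReal (transport r a t f y) =
      ENNReal.ofReal (Real.exp (-(l * growthTime r y)) * steadyProfile r a y) *
        ∫⁻ x in Ioo 0 y, ENNReal.ofReal (Real.exp (l * growthTime r x) /
          (r x * steadyProfile r a x)) * ENNReal.ofReal (f x) := by
  set ρ := growthTime r
  set g := steadyProfile r a
  set I := ρ '' Ioi 0
  have hI : MeasurableSet I := h.measurableSet_image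
  have hgy : 0 < g y := h.steadyProfile_pos hy
  let F : ℝ → ℝ≥0∞ := fun x => ENNReal.ofReal (g x)⁻¹ * ENNReal.ofReal (f x)
  have hg0 : ∀ x, 0 ≤ g x := fun x =>
    indicator_nonneg (fun z hz => (div_pos (Real.exp_pos _) (h.pos z hz)).le) x
  have h1 : ∀ t : ℝ, ENNReal.ofReal (transport r a t f y) =
      ENNReal.ofReal (g y) * F (growthSize r (ρ y - t)) := by
    intro t
    rw [transport, ENNReal.ofReal_mul (hg0 _), ENNReal.ofReal_mul (inv_nonneg.2 (hg0 _))]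
  have h2 : ∀ s : ℝ, (Ioi (0 : ℝ)).indicator (fun t => ENNReal.ofReal (Real.exp (-l * t)) *
      ENNReal.ofReal (transport r a t f y)) (ρ y - s) =
      I.indicator (fun s => ENNReal.ofReal (r (growthSize r s)) * (Iio y).indicator
        (fun x => ENNReal.ofReal (Real.exp (-(l * ρ y)) * g y) *
          (ENNReal.ofReal (Real.exp (l * ρ x) / (r x * g x)) * ENNReal.ofReal (f x)))
        (growthSize r s)) s := by
    intro s
    by_cases hs : s ∈ I
    · have hx := growthSize_pos_of_mem hs
      have hρ : ρ (growthSize r s) = s := growthTime_growthSize hs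
      rw [indicator_of_mem hs]
      by_cases hlt : growthSize r s < y
      · have hmem : ρ y - s ∈ Ioi (0 : ℝ) := by
          have := h.strictMonoOn_growthTime hx hy hlt
          rw [mem_Ioi, sub_pos, ← hρ]
          exact this
        have hgx := h.steadyProfile_pos (a := a) hx
        have hrx := h.pos _ hx
        have hgx' : 0 < g (growthSize r s) := hgx
        rw [indicator_of_mem hmem, indicator_of_mem (mem_Iio.2 hlt), h1, sub_sub_cancel, hρ]
        simp only [F, ← mul_assoc]
        congr 1
        rw [← ENNReal.ofReal_mul (by positivity), ← ENNReal.ofReal_mul (by positivity),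
          ← ENNReal.ofReal_mul (by positivity), ← ENNReal.ofReal_mul (by positivity)]
        congr 1
        rw [neg_mul, mul_sub, neg_sub, sub_eq_add_neg, Real.exp_add]
        field_simp
      · have hmem : ρ y - s ∉ Ioi (0 : ℝ) := by
          have := (h.strictMonoOn_growthTime.le_iff_le hy hx).2 (not_lt.1 hlt)
          rw [mem_Ioi, sub_pos, not_lt, ← hρ]
          exact this
        rw [indicator_of_notMem hmem, indicator_of_notMem (fun hcon => hlt (mem_Iio.1 hcon)),
          mul_zero]
    · rw [indicator_of_notMem hs]
      by_cases hmem : ρ y - s ∈ Ioi (0 : ℝ)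
      · rw [indicator_of_mem hmem, h1, sub_sub_cancel, growthSize_of_notMem hs]
        simp [F, g, steadyProfile_zero]
      · rw [indicator_of_notMem hmem]
  rw [← lintegral_indicator measurableSet_Ioi, ← lintegral_sub_left_eq_self _ (ρ y),
    lintegral_congr h2, lintegral_indicator hI,
    ← h.lintegral_eq_lintegral_image, ← lintegral_const_mul' _ _ ENNReal.ofReal_ne_top,
    ← lintegral_indicator measurableSet_Ioi, ← lintegral_indicator measurableSet_Ioo]
  refine lintegral_congr fun x => ?_
  by_cases hx : 0 < x <;> by_cases hxy : x < y <;> simp [indicator, hx, hxy]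

/-- The resolvent of the growth semigroup is given by the explicit kernel. -/
theorem ofReal_resolvent_apply (ha : LocallyIntegrableOn a (Ioi 0))
    {U : C0Semigroup (MomentSpace c α)} {K l : ℝ}
    (hK : ∀ t : ℝ≥0, ‖U.toFun t‖ ≤ Real.exp (K * t))
    (hU : ∀ (t : ℝ≥0) (f : MomentSpace c α),
      U.toFun t f =ᵐ[momentMeasure c α] transport r a t f)
    (hl : K < l) {R : MomentSpace c α →L[ℝ] MomentSpace c α} (hR : IsResolvent U.generator l R)
    {f : MomentSpace c α} (hf : 0 ≤ f) :
    0 ≤ R f ∧ ∀ᵐ y ∂momentMeasure c α, ENNReal.ofReal (R f y) =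
      ENNReal.ofReal (Real.exp (-(l * growthTime r y)) * steadyProfile r a y) *
        ∫⁻ x in Ioo 0 y, ENNReal.ofReal (Real.exp (l * growthTime r x) /
          (r x * steadyProfile r a x)) * ENNReal.ofReal (f x) := by
  set μ := momentMeasure c α with hμ
  have hgm := h.measurable_steadyProfile ha
  have hfm : Measurable f := (Lp.stronglyMeasurable f).measurable
  have hUf : ∀ t, 0 ≤ U.toFun t f := by
    intro t
    refine (Lp.coeFn_nonneg _).1 ?_
    have h1 : (f : ℝ → ℝ) =ᵐ[μ] fun x => |f x| := by
      filter_upwards [(Lp.coeFn_nonneg f).2 hf] with x hx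
      exact (abs_of_nonneg hx).symm
    filter_upwards [hU t f, h.transport_congr (a := a) h1 t.coe_nonneg] with y e1 e2
    rw [e1, e2, Pi.zero_apply]
    have hg0 : ∀ x, 0 ≤ steadyProfile r a x := fun x =>
      indicator_nonneg (fun z hz => (div_pos (Real.exp_pos _) (h.pos z hz)).le) x
    exact mul_nonneg (hg0 _) (mul_nonneg (inv_nonneg.2 (hg0 _)) (abs_nonneg _))
  obtain ⟨R', hR', hR'f⟩ := C0Semigroup.exists_isResolvent_laplace hK hl
  obtain rfl := hR'.unique hR
  -- integrate the Laplace transform over an arbitrary measurable set `S`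
  let φ : Set ℝ → MomentSpace c α →L[ℝ] ℝ := fun S =>
    { toFun := fun u => ∫ x in S, u x ∂μ
      map_add' := fun u v => by
        rw [← integral_add (L1.integrable_coeFn u).integrableOn
          (L1.integrable_coeFn v).integrableOn]
        exact integral_congr_ae (ae_restrict_of_ae (Lp.coeFn_add u v))
      map_smul' := fun k u => by
        rw [RingHom.id_apply, ← integral_smul]
        exact integral_congr_ae (ae_restrict_of_ae (Lp.coeFn_smul k u))
      cont := continuous_setIntegral S }
  have hφ : ∀ S u, φ S u = ∫ x in S, u x ∂μ := fun S u => rfl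
  have hφ0 : ∀ S u, 0 ≤ u → 0 ≤ φ S u := fun S u hu =>
    integral_nonneg_of_ae (ae_restrict_of_ae ((Lp.coeFn_nonneg u).2 hu))
  have hφl : ∀ S u, 0 ≤ u → ENNReal.ofReal (φ S u) = ∫⁻ x in S, ENNReal.ofReal (u x) ∂μ :=
    fun S u hu => ofReal_integral_eq_lintegral_ofReal (L1.integrable_coeFn u).integrableOn
      (ae_restrict_of_ae ((Lp.coeFn_nonneg u).2 hu))
  have hint := (C0Semigroup.integrableOn_laplace hK hl f).1
  have hφR : ∀ S, φ S (R' f) =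
      ∫ t in Ioi (0 : ℝ), Real.exp (-l * t) * φ S (U.toFun t.toNNReal f) := by
    intro S
    rw [hR'f, ← ContinuousLinearMap.integral_comp_comm _ hint]
    refine integral_congr_ae (ae_of_all _ fun t => ?_)
    simp only [map_smul, smul_eq_mul]
  have hpos : 0 ≤ R' f := by
    refine (Lp.coeFn_nonneg _).1 (ae_nonneg_of_forall_setIntegral_nonneg
      (L1.integrable_coeFn (R' f)) fun S _ _ => ?_)
    rw [← hφ, hφR]
    exact integral_nonneg fun t => mul_nonneg (Real.exp_pos _).le (hφ0 S _ (hUf _))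
  refine ⟨hpos, ?_⟩
  have hμac : μ ≪ volume.restrict (Ioi 0) := withDensity_absolutelyContinuous _ _
  have hρm := h.aemeasurable_growthTime
  have hrm : AEMeasurable r (volume.restrict (Ioi 0)) :=
    h.continuousOn.aemeasurable measurableSet_Ioi
  have hwm : Measurable (weight c α) := by unfold weight; fun_prop
  have : SigmaFinite μ := by
    rw [hμ, momentMeasure]
    exact SigmaFinite.withDensity_ofReal _
  -- the kernel in a measurable form
  have hkm : AEMeasurable (fun y => ∫⁻ t in Ioi (0 : ℝ), ENNReal.ofReal (Real.exp (-l * t)) *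
      ENNReal.ofReal (transport r a t f y)) (volume.restrict (Ioi 0)) ∧
      AEMeasurable (fun p : ℝ × ℝ => ENNReal.ofReal (Real.exp (-l * p.1)) *
        ENNReal.ofReal (transport r a p.1 f p.2))
        ((volume.restrict (Ioi 0)).prod (volume.restrict (Ioi 0))) := by
    have e1 : AEMeasurable (fun p : ℝ × ℝ => growthSize r (growthTime r p.2 - p.1))
        ((volume.restrict (Ioi 0)).prod (volume.restrict (Ioi 0))) :=
      h.measurable_growthSize.comp_aemeasurable (hρm.comp_snd.sub measurable_fst.aemeasurable)
    have e2 : AEMeasurable (fun p : ℝ × ℝ => transport r a p.1 f p.2)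
        ((volume.restrict (Ioi 0)).prod (volume.restrict (Ioi 0))) :=
      (hgm.comp measurable_snd).aemeasurable.mul
        ((hgm.comp_aemeasurable e1).inv.mul (hfm.comp_aemeasurable e1))
    have e3 : Measurable fun p : ℝ × ℝ => ENNReal.ofReal (Real.exp (-l * p.1)) := by fun_prop
    have e4 := e3.aemeasurable.mul e2.ennreal_ofReal
    exact ⟨e4.prod_swap.lintegral_prod_right', e4⟩
  have hae : (fun y => ENNReal.ofReal (R' f y)) =ᵐ[μ] fun y =>
      ∫⁻ t in Ioi (0 : ℝ), ENNReal.ofReal (Real.exp (-l * t)) *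
        ENNReal.ofReal (transport r a t f y) := by
    refine ae_eq_of_forall_setLIntegral_eq_of_sigmaFinite₀
      (Lp.stronglyMeasurable (R' f)).measurable.ennreal_ofReal.aemeasurable
      (hkm.1.mono_ac hμac) fun S hS _ => ?_
    rw [← hφl S _ hpos, hφR, ofReal_integral_eq_lintegral_ofReal]
    · have e1 : ∀ t ∈ Ioi (0 : ℝ), ENNReal.ofReal (Real.exp (-l * t) *
          φ S (U.toFun t.toNNReal f)) = ∫⁻ y in Ioi 0, S.indicator (fun y =>
            ENNReal.ofReal (weight c α y)) y * (ENNReal.ofReal (Real.exp (-l * t)) *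
              ENNReal.ofReal (transport r a t f y)) := by
        intro t ht
        rw [ENNReal.ofReal_mul (Real.exp_pos _).le, hφl S _ (hUf _), ← lintegral_indicator hS]
        have e2 : ∫⁻ y, S.indicator (fun y => ENNReal.ofReal (U.toFun t.toNNReal f y)) y ∂μ =
            ∫⁻ y, S.indicator (fun y => ENNReal.ofReal (transport r a t f y)) y ∂μ := by
          refine lintegral_congr_ae ?_
          filter_upwards [hU t.toNNReal f] with y hy
          rw [Real.coe_toNNReal t (le_of_lt ht)] at hy
          simp only [indicator, hy]
        rw [e2, lintegral_momentMeasure, ← lintegral_const_mul' _ _ ENNReal.ofReal_ne_top]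
        refine lintegral_congr fun y => ?_
        by_cases hy : y ∈ S
        · simp only [indicator_of_mem hy]; ring
        · simp only [indicator_of_notMem hy]; ring
      rw [setLIntegral_congr_fun measurableSet_Ioi e1, lintegral_lintegral_swap,
        ← lintegral_indicator hS, lintegral_momentMeasure]
      · refine lintegral_congr fun y => ?_
        by_cases hy : y ∈ S
        · simp only [indicator_of_mem hy]
          rw [lintegral_const_mul' _ _ ENNReal.ofReal_ne_top]
        · simp only [indicator_of_notMem hy]
          simp
      · have e5 : Measurable fun p : ℝ × ℝ => S.indicator (fun y =>
            ENNReal.ofReal (weight c α y)) p.2 :=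
          (hwm.ennreal_ofReal.indicator hS).comp measurable_snd
        exact e5.aemeasurable.mul hkm.2
    · have := (φ S).integrable_comp hint
      refine this.congr (ae_of_all _ fun t => ?_)
      simp only [map_smul, smul_eq_mul]
    · exact ae_of_all _ fun t => mul_nonneg (Real.exp_pos _).le (hφ0 S _ (hUf _))
  filter_upwards [hae, ae_momentMeasure_pos c α] with y hy hy0
  rw [hy, h.lintegral_exp_mul_transport l f hy0]

end IsGrowthRate

namespace IsGrowthRate

variable {r a : ℝ → ℝ} {c : ℝ≥0} {α C : ℝ} (h : IsGrowthRate r)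
include h

/-- The pointwise estimate behind the dissipativity of the growth semigroup: a unit mass that starts
at size `x` loses at most its moment by fragmentation and by the discount `l`. -/
theorem lintegral_resolvent_kernel_le (hα : 0 ≤ α) (hr : ∀ z, 0 < z → r z ≤ C * (c + z))
    (ha : LocallyIntegrableOn a (Ioi 0)) (ha0 : ∀ y, 0 < y → 0 ≤ a y) {l : ℝ} (hl : α * C < l)
    {x : ℝ} (hx : 0 < x) :
    ENNReal.ofReal (Real.exp (l * growthTime r x) / (r x * steadyProfile r a x)) *
      ∫⁻ y in Ioi x, ENNReal.ofReal (weight c α y) * (ENNReal.ofReal (a y + (l - α * C)) *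
        ENNReal.ofReal (Real.exp (-(l * growthTime r y)) * steadyProfile r a y)) ≤
      ENNReal.ofReal (weight c α x) := by
  set κ := l - α * C with hκ
  have hκ0 : 0 < κ := sub_pos.2 hl
  set q : ℝ → ℝ := fun τ => (a τ + κ) / r τ with hq
  have hqloc : LocallyIntegrableOn q (Ioi 0) :=
    h.locallyIntegrableOn_div (ha.add (locallyIntegrableOn_const κ))
  have hq0 : ∀ y, 0 < y → 0 ≤ q y := fun y hy =>
    div_nonneg (add_nonneg (ha0 y hy) hκ0.le) (h.pos y hy).le
  have hqint : ∀ y, x ≤ y → ∫ τ in x..y, q τ =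
      lossExponent r a y - lossExponent r a x + κ * (growthTime r y - growthTime r x) := by
    intro y hxy
    have hy := hx.trans_le hxy
    rw [← h.integral_div ha hx hy, ← h.integral_inv hx hy, ← intervalIntegral.integral_const_mul,
      ← intervalIntegral.integral_add
        (intervalIntegrable_of_locallyIntegrableOn (h.locallyIntegrableOn_div ha) hx hy)
        ((h.intervalIntegrable_inv hx hy).const_mul κ)]
    refine intervalIntegral.integral_congr fun τ _ => ?_
    simp only [hq]
    ring
  have hrx := h.pos x hx
  rw [← lintegral_const_mul' _ _ ENNReal.ofReal_ne_top]
  calc _ ≤ ∫⁻ y in Ioi x, ENNReal.ofReal (weight c α x) *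
        ENNReal.ofReal (q y * Real.exp (-∫ τ in x..y, q τ)) := by
        refine setLIntegral_mono' measurableSet_Ioi fun y hxy => ?_
        have hxy : x < y := hxy
        have hy := hx.trans hxy
        have hry := h.pos y hy
        have hw := h.weight_le hα hr hx hxy.le
        have hwx := weight_pos c α hx
        have hwy := weight_pos c α hy
        have hay := ha0 y hy
        rw [← ENNReal.ofReal_mul (by positivity), ← ENNReal.ofReal_mul hwy.le,
          ← ENNReal.ofReal_mul (div_nonneg (Real.exp_pos _).le
            (mul_nonneg hrx.le (h.steadyProfile_pos hx).le)), ← ENNReal.ofReal_mul hwx.le]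
        refine ENNReal.ofReal_le_ofReal ?_
        rw [hqint y hxy.le, steadyProfile, indicator_of_mem (mem_Ioi.2 hx),
          indicator_of_mem (mem_Ioi.2 hy)]
        calc _ = weight c α y * (q y * Real.exp (-(l * (growthTime r y - growthTime r x)) -
                (lossExponent r a y - lossExponent r a x))) := by
              have e1 : -(l * (growthTime r y - growthTime r x)) -
                  (lossExponent r a y - lossExponent r a x) = l * growthTime r x +
                    -(l * growthTime r y) + lossExponent r a x + -lossExponent r a y := by ring
              rw [e1, Real.exp_add, Real.exp_add, Real.exp_add, Real.exp_neg (lossExponent r a x)]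
              simp only [hq]
              field_simp
          _ ≤ Real.exp (α * C * (growthTime r y - growthTime r x)) * weight c α x *
                (q y * Real.exp (-(l * (growthTime r y - growthTime r x)) -
                (lossExponent r a y - lossExponent r a x))) :=
              mul_le_mul_of_nonneg_right hw (mul_nonneg (hq0 y hy) (Real.exp_pos _).le)
          _ = weight c α x * (q y * (Real.exp (α * C * (growthTime r y - growthTime r x)) *
                Real.exp (-(l * (growthTime r y - growthTime r x)) -
                (lossExponent r a y - lossExponent r a x)))) := by ring
          _ = _ := by
              rw [← Real.exp_add, hκ]
              congr 3
              ring
    _ = ENNReal.ofReal (weight c α x) *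
        ∫⁻ y in Ioi x, ENNReal.ofReal (q y * Real.exp (-∫ τ in x..y, q τ)) :=
        lintegral_const_mul' _ _ ENNReal.ofReal_ne_top
    _ ≤ ENNReal.ofReal (weight c α x) * 1 := by
        gcongr
        exact lintegral_mul_exp_neg_integral_le_one hqloc hq0 hx
    _ = _ := mul_one _

/-- The resolvent of the growth semigroup gains integrability against the fragmentation rate. -/
theorem lintegral_resolvent_le (hα : 0 ≤ α) (hr : ∀ z, 0 < z → r z ≤ C * (c + z))
    (ha : LocallyIntegrableOn a (Ioi 0)) (ha0 : ∀ y, 0 < y → 0 ≤ a y)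
    {l : ℝ} (hl : α * C < l) {f u : MomentSpace c α} (hf : 0 ≤ f)
    (hu : ∀ᵐ y ∂momentMeasure c α, ENNReal.ofReal (u y) =
      ENNReal.ofReal (Real.exp (-(l * growthTime r y)) * steadyProfile r a y) *
        ∫⁻ x in Ioo 0 y, ENNReal.ofReal (Real.exp (l * growthTime r x) /
          (r x * steadyProfile r a x)) * ENNReal.ofReal (f x)) :
    ∫⁻ y, ENNReal.ofReal (a y + (l - α * C)) * ENNReal.ofReal (u y) ∂momentMeasure c α ≤ ‖f‖ₑ := by
  have hrm : AEMeasurable r (volume.restrict (Ioi 0)) :=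
    h.continuousOn.aemeasurable measurableSet_Ioi
  have hρm := h.aemeasurable_growthTime
  have hgm : AEMeasurable (steadyProfile r a) (volume.restrict (Ioi 0)) :=
    (h.measurable_steadyProfile ha).aemeasurable
  have ham : AEMeasurable a (volume.restrict (Ioi 0)) := ha.aestronglyMeasurable.aemeasurable
  have hwm : AEMeasurable (weight c α) (volume.restrict (Ioi 0)) :=
    (continuousOn_weight c α).aemeasurable measurableSet_Ioi
  have hfm : AEMeasurable f (volume.restrict (Ioi 0)) :=
    (Lp.stronglyMeasurable f).measurable.aemeasurable
  calc _ = ∫⁻ y in Ioi 0, (ENNReal.ofReal (weight c α y) *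
        (ENNReal.ofReal (a y + (l - α * C)) *
          ENNReal.ofReal (Real.exp (-(l * growthTime r y)) * steadyProfile r a y))) *
        ∫⁻ x in Ioo 0 y, ENNReal.ofReal (Real.exp (l * growthTime r x) /
          (r x * steadyProfile r a x)) * ENNReal.ofReal (f x) := by
        rw [lintegral_momentMeasure]
        refine lintegral_congr_ae ?_
        filter_upwards [(ae_momentMeasure_iff c α).1 hu] with y hy
        rw [hy]
        ring
    _ = ∫⁻ x in Ioi 0, (ENNReal.ofReal (Real.exp (l * growthTime r x) /
          (r x * steadyProfile r a x)) * ENNReal.ofReal (f x)) * ∫⁻ y in Ioi x,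
          (ENNReal.ofReal (weight c α y) * (ENNReal.ofReal (a y + (l - α * C)) *
          ENNReal.ofReal (Real.exp (-(l * growthTime r y)) * steadyProfile r a y))) := by
        refine lintegral_triangle_swap ?_ ?_
        · exact hwm.ennreal_ofReal.mul ((ham.add_const _).ennreal_ofReal.mul
            ((Real.measurable_exp.comp_aemeasurable (hρm.const_mul l).neg).mul hgm).ennreal_ofReal)
        · exact ((Real.measurable_exp.comp_aemeasurable (hρm.const_mul l)).div
            (hrm.mul hgm)).ennreal_ofReal.mul hfm.ennreal_ofReal
    _ ≤ ∫⁻ x in Ioi 0, ENNReal.ofReal (weight c α x) * ENNReal.ofReal (f x) := by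
        refine setLIntegral_mono' measurableSet_Ioi fun x hx => ?_
        rw [mul_right_comm]
        gcongr
        exact h.lintegral_resolvent_kernel_le hα hr ha ha0 hl hx
    _ = ‖f‖ₑ := by
        rw [← MomentSpace.lintegral_ofReal_eq hf, lintegral_momentMeasure]

/-- The resolvent of the growth semigroup spreads positivity to all larger sizes. -/
theorem resolvent_pos_of_lt (ha : LocallyIntegrableOn a (Ioi 0)) {l : ℝ} {f u : MomentSpace c α}
    (hf : 0 ≤ f)
    (hu : ∀ᵐ y ∂momentMeasure c α, ENNReal.ofReal (u y) =
      ENNReal.ofReal (Real.exp (-(l * growthTime r y)) * steadyProfile r a y) *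
        ∫⁻ x in Ioo 0 y, ENNReal.ofReal (Real.exp (l * growthTime r x) /
          (r x * steadyProfile r a x)) * ENNReal.ofReal (f x))
    {z : ℝ} (hz : ¬ ∀ᵐ x ∂volume.restrict (Ioo 0 z), f x = 0) :
    ∀ᵐ y ∂momentMeasure c α, z ≤ y → 0 < u y := by
  filter_upwards [hu, ae_momentMeasure_pos c α] with y hy hy0 hzy
  by_contra hcon
  rw [ENNReal.ofReal_eq_zero.2 (not_lt.1 hcon), eq_comm, mul_eq_zero] at hy
  have h1 : ENNReal.ofReal (Real.exp (-(l * growthTime r y)) * steadyProfile r a y) ≠ 0 := by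
    have := h.steadyProfile_pos (a := a) hy0
    have h2 := Real.exp_pos (-(l * growthTime r y))
    simpa using mul_pos h2 this
  have h2 := hy.resolve_left h1
  have hm : AEMeasurable (fun x => ENNReal.ofReal (Real.exp (l * growthTime r x) /
      (r x * steadyProfile r a x)) * ENNReal.ofReal (f x)) (volume.restrict (Ioo 0 y)) := by
    refine AEMeasurable.mono_measure ?_ (Measure.restrict_mono Ioo_subset_Ioi_self le_rfl)
    exact ((Real.measurable_exp.comp_aemeasurable (h.aemeasurable_growthTime.const_mul l)).div
      ((h.continuousOn.aemeasurable measurableSet_Ioi).mul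
        (h.measurable_steadyProfile ha).aemeasurable)).ennreal_ofReal.mul
      (Lp.stronglyMeasurable f).measurable.aemeasurable.ennreal_ofReal
  rw [lintegral_eq_zero_iff' hm] at h2
  refine hz ?_
  have hsub : Ioo 0 z ⊆ Ioo 0 y := Ioo_subset_Ioo_right hzy
  have hf0 := (ae_momentMeasure_iff c α).1 ((Lp.coeFn_nonneg f).2 hf)
  filter_upwards [ae_restrict_of_ae_restrict_of_subset hsub h2,
    ae_restrict_of_ae_restrict_of_subset (Ioo_subset_Ioi_self : Ioo 0 z ⊆ Ioi 0) hf0,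
    ae_restrict_mem measurableSet_Ioo] with x e1 e2 e3
  have h3 : ENNReal.ofReal (Real.exp (l * growthTime r x) / (r x * steadyProfile r a x)) ≠ 0 := by
    have h4 := h.pos x e3.1
    have h5 := h.steadyProfile_pos (a := a) e3.1
    have h6 : 0 < Real.exp (l * growthTime r x) / (r x * steadyProfile r a x) := by positivity
    simpa using h6
  have h7 := (mul_eq_zero.1 e1).resolve_left h3
  exact le_antisymm (ENNReal.ofReal_eq_zero.1 h7) e2

end IsGrowthRate

/-! ### The fragmentation operator -/

section Fragmentation

variable {a : ℝ → ℝ} {b : ℝ → ℝ → ℝ} {c : ℝ≥0} {α : ℝ}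

/-- A nonnegative `u` with `∫ a u n / w < ∞` belongs to the domain of the fragmentation operator,
and this integral controls the norm of `B u`. -/
theorem inFragmentationDomain_of_lintegral_lt_top
    (ha : AEMeasurable a (volume.restrict (Ioi 0))) (ha0 : ∀ y, 0 < y → 0 ≤ a y)
    (hb : AEMeasurable (Function.uncurry b) (volume.restrict (Ioi 0 ×ˢ Ioi 0)))
    (hb0 : ∀ x y, 0 < x → 0 < y → 0 ≤ b x y) {u : MomentSpace c α} (hu : 0 ≤ u)
    (hfin : ∫⁻ y, ENNReal.ofReal (a y) * ENNReal.ofReal (u y) * momentRatio c α b y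
      ∂momentMeasure c α < ∞) :
    InFragmentationDomain c α a b u ∧
      ∫⁻ x, ‖fragmentationFun a b u x‖ₑ ∂momentMeasure c α ≤
        ∫⁻ y, ENNReal.ofReal (a y) * ENNReal.ofReal (u y) * momentRatio c α b y
          ∂momentMeasure c α := by
  set ν : Measure ℝ := volume.restrict (Ioi 0) with hν
  have hνν : (volume : Measure (ℝ × ℝ)).restrict (Ioi 0 ×ˢ Ioi 0) = ν.prod ν := by
    rw [Measure.volume_eq_prod, Measure.prod_restrict]
  rw [hνν] at hb
  have hum : AEMeasurable u ν := (Lp.stronglyMeasurable u).measurable.aemeasurable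
  have hu0 : ∀ᵐ y ∂ν, 0 ≤ u y := (ae_momentMeasure_iff c α).1 ((Lp.coeFn_nonneg u).2 hu)
  have hmem : ∀ᵐ y ∂ν, 0 < y := ae_restrict_mem measurableSet_Ioi
  have htri : MeasurableSet {p : ℝ × ℝ | p.1 < p.2} := measurableSet_lt measurable_fst measurable_snd
  let k : ℝ × ℝ → ℝ := fun p => a p.2 * b p.1 p.2 * u p.2
  have hk : AEMeasurable k (ν.prod ν) := (ha.comp_snd.mul hb).mul hum.comp_snd
  let k' : ℝ × ℝ → ℝ := {p : ℝ × ℝ | p.1 < p.2}.indicator k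
  have hk' : AEMeasurable k' (ν.prod ν) := hk.indicator htri
  -- integrals over `(x, ∞)` as integrals over `(0, ∞)`
  have hrestrict : ∀ x : ℝ, 0 < x → volume.restrict (Ioi x) = ν.restrict (Ioi x) := fun x hx => by
    rw [hν, Measure.restrict_restrict measurableSet_Ioi,
      inter_eq_left.2 (Ioi_subset_Ioi hx.le)]
  let G : ℝ → ℝ≥0∞ := fun x => ∫⁻ y in Ioi x, ‖k (x, y)‖ₑ
  have hG : ∀ x, 0 < x → G x = ∫⁻ y, ‖k' (x, y)‖ₑ ∂ν := by
    intro x hx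
    simp only [G]
    rw [hrestrict x hx, ← lintegral_indicator measurableSet_Ioi]
    refine lintegral_congr fun y => ?_
    by_cases hxy : x < y <;> simp [k', indicator, hxy]
  have hGm : AEMeasurable G ν := by
    refine AEMeasurable.congr hk'.enorm.lintegral_prod_right' ?_
    filter_upwards [hmem] with x hx
    exact (hG x hx).symm
  have hwm : AEMeasurable (weight c α) ν :=
    (continuousOn_weight c α).aemeasurable measurableSet_Ioi
  have hmain : ∫⁻ x, ENNReal.ofReal (weight c α x) * G x ∂ν =
      ∫⁻ y, ENNReal.ofReal (a y) * ENNReal.ofReal (u y) * momentRatio c α b y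
        ∂momentMeasure c α := by
    calc ∫⁻ x, ENNReal.ofReal (weight c α x) * G x ∂ν
        = ∫⁻ x, ∫⁻ y, ENNReal.ofReal (weight c α x) * ‖k' (x, y)‖ₑ ∂ν ∂ν := by
          refine lintegral_congr_ae ?_
          filter_upwards [hmem] with x hx
          rw [hG x hx, lintegral_const_mul' _ _ ENNReal.ofReal_ne_top]
      _ = ∫⁻ y, ∫⁻ x, ENNReal.ofReal (weight c α x) * ‖k' (x, y)‖ₑ ∂ν ∂ν := by
          refine lintegral_lintegral_swap ?_
          exact hwm.ennreal_ofReal.comp_fst.mul hk'.enorm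
      _ = _ := by
          rw [lintegral_momentMeasure]
          refine lintegral_congr_ae ?_
          filter_upwards [hmem, hu0] with y hy huy
          have hwy : ENNReal.ofReal (weight c α y) ≠ 0 := by
            simpa using weight_pos c α hy
          have e1 : ENNReal.ofReal (weight c α y) * (ENNReal.ofReal (a y) * ENNReal.ofReal (u y) *
              momentRatio c α b y) = ENNReal.ofReal (a y * u y) *
                ∫⁻ x in Ioo 0 y, ENNReal.ofReal (weight c α x * b x y) := by
            rw [momentRatio, ENNReal.ofReal_mul (ha0 y hy), mul_left_comm,
              ENNReal.mul_div_cancel hwy ENNReal.ofReal_ne_top]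
          rw [e1, ← Ioi_inter_Iio, inter_comm, ← Measure.restrict_restrict measurableSet_Iio, ← hν,
            ← lintegral_indicator measurableSet_Iio,
            ← lintegral_const_mul' _ _ ENNReal.ofReal_ne_top]
          refine lintegral_congr_ae ?_
          filter_upwards [hmem] with x hx
          by_cases hxy : x < y
          · have hbxy := hb0 x y hx hy
            have hay := ha0 y hy
            have hwx := weight_pos c α hx
            simp only [k', indicator, mem_ofPred_eq, mem_Iio, hxy, if_true, k]
            rw [Real.enorm_of_nonneg (by positivity), ← ENNReal.ofReal_mul hwx.le,
              ← ENNReal.ofReal_mul (by positivity)]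
            congr 1
            ring
          · simp [k', indicator, hxy]
  have hGfin : ∀ᵐ x ∂ν, G x < ∞ := by
    have h1 := ae_lt_top' (hwm.ennreal_ofReal.mul hGm) (ne_of_eq_of_ne hmain hfin.ne)
    filter_upwards [h1, hmem] with x hx hx0
    have hwx : ENNReal.ofReal (weight c α x) ≠ 0 := by simpa using weight_pos c α hx0
    by_contra hcon
    rw [not_lt, top_le_iff] at hcon
    rw [Pi.mul_apply, hcon, ENNReal.mul_top hwx] at hx
    exact lt_irrefl _ hx
  have hle : ∫⁻ x, ‖fragmentationFun a b u x‖ₑ ∂momentMeasure c α ≤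
      ∫⁻ x, ENNReal.ofReal (weight c α x) * G x ∂ν := by
    rw [lintegral_momentMeasure]
    refine lintegral_mono fun x => ?_
    gcongr
    exact enorm_integral_le_lintegral_enorm _
  refine ⟨⟨?_, ?_, ?_⟩, hle.trans hmain.le⟩
  · refine (ae_momentMeasure_iff c α).2 ?_
    filter_upwards [hGfin, hmem, hk.aestronglyMeasurable.prodMk_left] with x h1 h2 h3
    refine ⟨?_, h1⟩
    rw [hrestrict x h2]
    exact h3.restrict
  · have h1 : AEStronglyMeasurable (fun x => ∫ y, k' (x, y) ∂ν) ν :=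
      hk'.aestronglyMeasurable.integral_prod_right'
    refine AEStronglyMeasurable.mono_ac (withDensity_absolutelyContinuous _ _) (h1.congr ?_)
    filter_upwards [hmem] with x hx
    rw [fragmentationFun, hrestrict x hx]
    exact integral_indicator (f := fun y => a y * b x y * u y) measurableSet_Ioi
  · rw [eLpNorm_one_eq_lintegral_enorm]
    exact (hle.trans hmain.le).trans_lt hfin

theorem fragmentation_coeFn (f : (fragmentation c α a b).domain) :
    (fragmentation c α a b f : ℝ → ℝ) =ᵐ[momentMeasure c α] fragmentationFun a b f :=
  MemLp.coeFn_toLp f.2.2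

theorem fragmentation_nonneg (ha0 : ∀ y, 0 < y → 0 ≤ a y)
    (hb0 : ∀ x y, 0 < x → 0 < y → 0 ≤ b x y) (f : (fragmentation c α a b).domain)
    (hf : 0 ≤ (f : MomentSpace c α)) : 0 ≤ fragmentation c α a b f := by
  refine (Lp.coeFn_nonneg _).1 ?_
  have hf0 := (Lp.coeFn_nonneg _).2 hf
  filter_upwards [fragmentation_coeFn f, ae_momentMeasure_pos c α] with x hx hx0
  rw [hx]
  refine setIntegral_nonneg_of_ae_restrict ?_
  filter_upwards [ae_restrict_of_ae_momentMeasure hf0 hx0, ae_restrict_mem measurableSet_Ioi]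
    with y hy hxy
  have hy0 : 0 < y := lt_trans hx0 hxy
  exact mul_nonneg (mul_nonneg (ha0 y hy0) (hb0 x y hx0 hy0)) hy

end Fragmentation

/-! ### Positive resolvents and positive perturbations -/

section PositivePerturbation

variable {E : Type*} [NormedAddCommGroup E] [NormedSpace ℝ E] [Lattice E] [HasSolidNorm E]
  [IsOrderedAddMonoid E]

/-- A positive contraction `P` has a positive Neumann series: `(1 - P) v ≥ 0` implies `v ≥ 0`. -/
theorem nonneg_of_nonneg_sub_apply [CompleteSpace E] {P : E →L[ℝ] E} (hP : ∀ f, 0 ≤ f → 0 ≤ P f)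
    (hP1 : ‖P‖ < 1) {v : E} (hv : 0 ≤ v - P v) : 0 ≤ v := by
  have h1 : ((Units.oneSub P hP1)⁻¹ : (E →L[ℝ] E)ˣ).val (v - P v) = v := by
    have := (Units.oneSub P hP1).inv_mul
    rw [Units.val_oneSub] at this
    exact congrArg (fun T : E →L[ℝ] E => T v) this
  have h2 : HasSum (fun n => P ^ n) ((Units.oneSub P hP1)⁻¹ : (E →L[ℝ] E)ˣ).val :=
    (summable_geometric_of_norm_lt_one hP1).hasSum
  have h3 := h2.mapL (ContinuousLinearMap.apply ℝ E (v - P v))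
  rw [ContinuousLinearMap.apply_apply, h1] at h3
  refine h3.nonneg fun n => ?_
  rw [ContinuousLinearMap.apply_apply]
  induction n with
  | zero => simpa using hv
  | succ n ih => rw [pow_succ']; exact hP _ ih

/-- If all points of `[l, ∞)` belong to the resolvent set and the resolvent is positive near
infinity, then it is positive at `l`: positivity propagates downwards by the Neumann series. -/
theorem IsResolvent.nonneg_of_Ici_subset [CompleteSpace E] [PosSMulMono ℝ E] {A : E →ₗ.[ℝ] E}
    {l M : ℝ} (hl : Ici l ⊆ realResolventSet A)
    (hM : ∀ m, M < m → ∀ Q, IsResolvent A m Q → ∀ f, 0 ≤ f → 0 ≤ Q f)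
    {R : E →L[ℝ] E} (hR : IsResolvent A l R) {f : E} (hf : 0 ≤ f) : 0 ≤ R f := by
  have hex : ∀ m, l ≤ m → ∃ Q, IsResolvent A m Q := fun m hm => hl hm
  choose! ρ hρ using hex
  have hstep : ∀ m m', l ≤ m' → m' ≤ m → (m - m') * ‖ρ m‖ < 1 → (∀ f, 0 ≤ f → 0 ≤ ρ m f) →
      ∀ f, 0 ≤ f → 0 ≤ ρ m' f := by
    intro m m' hlm' hm'm hlt hpos f hf
    have h1 := (hρ m (hlm'.trans hm'm)).sub_apply (hρ m' hlm') f
    refine nonneg_of_nonneg_sub_apply (P := (m - m') • ρ m) (fun g hg => ?_) ?_ ?_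
    · exact smul_nonneg (sub_nonneg.2 hm'm) (hpos g hg)
    · rwa [norm_smul, Real.norm_of_nonneg (sub_nonneg.2 hm'm)]
    · have h2 : ρ m' f - ((m - m') • ρ m) (ρ m' f) = ρ m f := by
        rw [_root_.smul_apply, sub_eq_iff_eq_add, ← sub_eq_iff_eq_add', ← neg_sub,
          h1, ← neg_smul, neg_sub]
      rw [h2]
      exact hpos f hf
  have hbound : ∀ m m', l ≤ m → l ≤ m' → |m - m'| * ‖ρ m‖ ≤ 1 / 2 → ‖ρ m'‖ ≤ 2 * ‖ρ m‖ := by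
    intro m m' hm hm' hlt
    have h1 : ρ m' = ρ m + (m - m') • (ρ m' * ρ m) := by
      ext g
      have := (hρ m' hm').sub_apply (hρ m hm) g
      rw [sub_eq_iff_eq_add'] at this
      exact this
    have h2 : ‖ρ m'‖ ≤ ‖ρ m‖ + |m - m'| * (‖ρ m'‖ * ‖ρ m‖) := by
      calc ‖ρ m'‖ = ‖ρ m + (m - m') • (ρ m' * ρ m)‖ := by rw [← h1]
        _ ≤ ‖ρ m‖ + ‖(m - m') • (ρ m' * ρ m)‖ := norm_add_le _ _
        _ ≤ _ := by
            rw [norm_smul, Real.norm_eq_abs]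
            gcongr
            exact norm_mul_le _ _
    nlinarith [norm_nonneg (ρ m')]
  let S : Set ℝ := {m | l ≤ m ∧ ∀ m', m ≤ m' → ∀ f, 0 ≤ f → 0 ≤ ρ m' f}
  have hSne : S.Nonempty := by
    refine ⟨max l (M + 1), le_max_left _ _, fun m' hm' => ?_⟩
    have h1 : M < m' := by linarith [le_max_right l (M + 1)]
    exact hM m' h1 _ (hρ m' ((le_max_left _ _).trans hm'))
  have hSbdd : BddBelow S := ⟨l, fun m hm => hm.1⟩
  have hlS : l ≤ sInf S := le_csInf hSne fun m hm => hm.1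
  -- near the infimum of `S` the resolvents are bounded, so one Neumann step leads below it
  set δ := 1 / (4 * (‖ρ (sInf S)‖ + 1)) with hδ
  have hρ0 := norm_nonneg (ρ (sInf S))
  have hδ0 : 0 < δ := by positivity
  have hδ1 : 4 * δ * (‖ρ (sInf S)‖ + 1) = 1 := by rw [hδ]; field_simp
  obtain ⟨m, hmS, hmlt⟩ := exists_lt_of_csInf_lt hSne (lt_add_of_pos_right (sInf S) hδ0)
  have hmge : sInf S ≤ m := csInf_le hSbdd hmS
  have hmb : ‖ρ m‖ ≤ 2 * ‖ρ (sInf S)‖ := by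
    refine hbound _ _ hlS hmS.1 ?_
    have : |sInf S - m| ≤ δ := by rw [abs_le]; constructor <;> linarith
    nlinarith
  have hmem : max l (sInf S - δ / 2) ∈ S := by
    refine ⟨le_max_left _ _, fun m' hm' => ?_⟩
    rcases le_total m m' with h | h
    · exact hmS.2 m' h
    · refine hstep m m' ((le_max_left _ _).trans hm') h ?_ (hmS.2 m le_rfl)
      have h1 : sInf S - δ / 2 ≤ m' := (le_max_right _ _).trans hm'
      nlinarith [norm_nonneg (ρ m)]
  have h1 := csInf_le hSbdd hmem
  have h2 : max l (sInf S - δ / 2) = l := by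
    refine max_eq_left ?_
    by_contra hcon
    rw [max_eq_right (not_le.1 hcon).le] at h1
    linarith
  rw [h2] at hmem
  rw [hR.unique (hρ l le_rfl)]
  exact hmem.2 l le_rfl f hf

variable (hadd : ∀ f g : E, 0 ≤ f → 0 ≤ g → ‖f + g‖ = ‖f‖ + ‖g‖)
include hadd

/-- In a space with additive norm on the positive cone, bounds on the positive cone extend to the
whole space with the same constant. -/
theorem norm_apply_le_of_nonneg {F : Type*} [SeminormedAddCommGroup F] [Module ℝ F] {φ : E →ₗ[ℝ] F}
    {q : ℝ} (hφ : ∀ f, 0 ≤ f → ‖φ f‖ ≤ q * ‖f‖) (f : E) : ‖φ f‖ ≤ q * ‖f‖ := by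
  have h1 : ‖f‖ = ‖f⁺‖ + ‖f⁻‖ := by
    rw [← hadd _ _ (posPart_nonneg f) (negPart_nonneg f), posPart_add_negPart, norm_abs_eq_norm]
  calc ‖φ f‖ = ‖φ f⁺ - φ f⁻‖ := by rw [← map_sub, posPart_sub_negPart]
    _ ≤ ‖φ f⁺‖ + ‖φ f⁻‖ := norm_sub_le _ _
    _ ≤ q * ‖f⁺‖ + q * ‖f⁻‖ := add_le_add (hφ _ (posPart_nonneg f)) (hφ _ (negPart_nonneg f))
    _ = q * ‖f‖ := by rw [h1]; ring

/-- Let `R` be the positive resolvent of `T` at `l`, and let `B` be positive with `‖B R‖ < 1`. Then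
`l` is a resolvent point of `T + B`, the resolvent `R (1 - B R)⁻¹` is positive, and the
dissipativity estimate `‖B R f‖ + (l - ω) ‖R f‖ ≤ ‖f‖` on the positive cone bounds its norm
by `1 / (l - ω)`. -/
theorem exists_isResolvent_add [CompleteSpace E] {T B : E →ₗ.[ℝ] E} {l ω θ : ℝ} (hl : ω < l)
    {R : E →L[ℝ] E} (hR : IsResolvent T l R) (hR0 : ∀ f, 0 ≤ f → 0 ≤ R f)
    (hdom : T.domain ≤ B.domain) (hB0 : ∀ f : B.domain, 0 ≤ (f : E) → 0 ≤ B f)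
    (hθ0 : 0 ≤ θ) (hθ : θ < 1)
    (hB : ∀ f, 0 ≤ f → ∀ hf : R f ∈ B.domain, ‖B ⟨R f, hf⟩‖ ≤ θ * ‖f‖ ∧
      ‖B ⟨R f, hf⟩‖ + (l - ω) * ‖R f‖ ≤ ‖f‖) :
    ∃ Q : E →L[ℝ] E, IsResolvent (T + B) l Q ∧ (∀ f, 0 ≤ f → 0 ≤ Q f) ∧ ‖Q‖ ≤ 1 / (l - ω) := by
  have hRT : ∀ f, R f ∈ T.domain := fun f => (hR.1 f).1
  have hRB : ∀ f, R f ∈ B.domain := fun f => hdom (hRT f)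
  let P₀ : E →ₗ[ℝ] E :=
    { toFun := fun f => B ⟨R f, hRB f⟩
      map_add' := fun f g => by
        rw [← LinearPMap.map_add]
        congr 1
        ext1
        simp
      map_smul' := fun k f => by
        rw [RingHom.id_apply, ← LinearPMap.map_smul]
        congr 1
        ext1
        simp }
  let P : E →L[ℝ] E := P₀.mkContinuous θ
    (norm_apply_le_of_nonneg hadd fun f hf => (hB f hf (hRB f)).1)
  have hPB : ∀ f, P f = B ⟨R f, hRB f⟩ := fun f => rfl
  have hP0 : ∀ f, 0 ≤ f → 0 ≤ P f := fun f hf => hB0 _ (hR0 f hf)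
  have hP1 : ‖P‖ < 1 := (LinearMap.mkContinuous_norm_le _ hθ0 _).trans_lt hθ
  set W := Units.oneSub P hP1 with hW
  have hWf : ∀ f, W.inv f - P (W.inv f) = f := fun f =>
    congrArg (fun T : E →L[ℝ] E => T f) W.val_inv
  have hWf' : ∀ f, W.inv (f - P f) = f := fun f =>
    congrArg (fun T : E →L[ℝ] E => T f) W.inv_val
  have hW0 : ∀ f, 0 ≤ f → 0 ≤ W.inv f := fun f hf =>
    nonneg_of_nonneg_sub_apply hP0 hP1 (by rwa [hWf])
  refine ⟨R.comp W.inv, ⟨fun f => ⟨⟨hRT _, hRB _⟩, ?_⟩, fun f => ?_⟩,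
    fun f hf => hR0 _ (hW0 f hf), ?_⟩
  · obtain ⟨h1, h2⟩ := hR.1 (W.inv f)
    have h3 : (T + B) ⟨R (W.inv f), ⟨hRT _, hRB _⟩⟩ = T ⟨R (W.inv f), h1⟩ + P (W.inv f) := rfl
    simp only [ContinuousLinearMap.comp_apply]
    rw [h3, ← sub_sub, h2, hWf]
  · have h1 : (T + B) f = T ⟨f, f.2.1⟩ + B ⟨f, f.2.2⟩ := rfl
    have h2 := hR.2 ⟨f, f.2.1⟩
    have h3 : P (l • (f : E) - T ⟨f, f.2.1⟩) = B ⟨f, f.2.2⟩ := by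
      rw [hPB]
      congr 1
      exact Subtype.ext h2
    rw [h1, ← sub_sub, ← h3, ContinuousLinearMap.comp_apply, hWf', h2]
  · have hlω : 0 < l - ω := sub_pos.2 hl
    refine ContinuousLinearMap.opNorm_le_bound _ (by positivity)
      (norm_apply_le_of_nonneg (φ := (R.comp W.inv).toLinearMap) hadd fun f hf => ?_)
    have h1 := (hB _ (hW0 f hf) (hRB _)).2
    rw [← hPB] at h1
    have h2 : ‖W.inv f‖ = ‖f‖ + ‖P (W.inv f)‖ := by
      rw [← hadd _ _ hf (hP0 _ (hW0 f hf))]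
      nth_rewrite 2 [← hWf f]
      rw [sub_add_cancel]
    change ‖R (W.inv f)‖ ≤ _
    rw [one_div, inv_mul_eq_div, le_div_iff₀ hlω]
    linarith

end PositivePerturbation

/-! ### The moment space as a Banach lattice -/

namespace MomentSpace

variable {c : ℝ≥0} {α : ℝ}

theorem norm_add_of_nonneg (f g : MomentSpace c α) (hf : 0 ≤ f) (hg : 0 ≤ g) :
    ‖f + g‖ = ‖f‖ + ‖g‖ := by
  have h1 : ‖f + g‖ₑ = ‖f‖ₑ + ‖g‖ₑ := by
    rw [← lintegral_ofReal_eq hf, ← lintegral_ofReal_eq hg, ← lintegral_ofReal_eq (add_nonneg hf hg),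
      ← lintegral_add_left (Lp.stronglyMeasurable f).measurable.ennreal_ofReal]
    refine lintegral_congr_ae ?_
    filter_upwards [Lp.coeFn_add f g, (Lp.coeFn_nonneg f).2 hf, (Lp.coeFn_nonneg g).2 hg]
      with x h1 h2 h3
    rw [h1, Pi.add_apply, ENNReal.ofReal_add h2 h3]
  rw [← toReal_enorm, h1, ENNReal.toReal_add enorm_ne_top enorm_ne_top, toReal_enorm, toReal_enorm]

instance : PosSMulMono ℝ (MomentSpace c α) where
  smul_le_smul_of_nonneg_left := by
    intro k hk f g hfg
    refine (Lp.coeFn_le _ _).1 ?_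
    filter_upwards [(Lp.coeFn_le _ _).2 hfg, Lp.coeFn_smul k f, Lp.coeFn_smul k g] with x h1 h2 h3
    rw [h2, h3]
    exact mul_le_mul_of_nonneg_left h1 hk

/-- A function that is positive almost everywhere is a quasi-interior point of the positive cone. -/
theorem tendsto_inf_smul {f u : MomentSpace c α} (hf : 0 ≤ f)
    (hu : ∀ᵐ x ∂momentMeasure c α, 0 < u x) :
    Tendsto (fun n : ℕ => f ⊓ (n : ℝ) • u) atTop (𝓝 f) := by
  rw [tendsto_iff_edist_tendsto_0]
  have hval : ∀ᵐ x ∂momentMeasure c α, ∀ n : ℕ,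
      (f ⊓ (n : ℝ) • u : MomentSpace c α) x = min (f x) (n * u x) := by
    rw [ae_all_iff]
    intro n
    filter_upwards [Lp.coeFn_inf f ((n : ℝ) • u), Lp.coeFn_smul (n : ℝ) u] with x h1 h2
    rw [h1, Pi.inf_apply, h2, Pi.smul_apply, smul_eq_mul]
  have h0 : ∫⁻ _ : ℝ, (0 : ℝ≥0∞) ∂momentMeasure c α = 0 := lintegral_zero
  rw [← h0]
  have hed : ∀ n : ℕ, edist (f ⊓ (n : ℝ) • u) f =
      ∫⁻ x, ‖(f ⊓ (n : ℝ) • u : MomentSpace c α) x - f x‖ₑ ∂momentMeasure c α := fun n => by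
    rw [Lp.edist_def, eLpNorm_one_eq_lintegral_enorm]
    rfl
  simp only [hed]
  refine tendsto_lintegral_of_dominated_convergence' (fun x => ‖f x‖ₑ) ?_ ?_
    (lintegral_enorm_ne_top f) ?_
  · intro n
    exact ((Lp.stronglyMeasurable (f ⊓ (n : ℝ) • u)).measurable.sub
      (Lp.stronglyMeasurable f).measurable).enorm.aemeasurable
  · intro n
    filter_upwards [hval, hu, (Lp.coeFn_nonneg f).2 hf] with x h1 h2 h3
    have h3 : 0 ≤ f x := h3
    rw [h1, enorm_le_iff_norm_le, Real.norm_eq_abs, Real.norm_eq_abs, abs_of_nonneg h3, abs_le]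
    have h4 : 0 ≤ n * u x := by positivity
    have h5 : 0 ≤ min (f x) (n * u x) := le_min h3 h4
    constructor <;> linarith [min_le_left (f x) (n * u x)]
  · filter_upwards [hval, hu] with x h1 h2
    obtain ⟨N, hN⟩ := exists_nat_ge (f x / u x)
    refine tendsto_const_nhds.congr' ?_
    filter_upwards [eventually_ge_atTop N] with n hn
    have h3 : f x ≤ n * u x := by
      rw [div_le_iff₀ h2] at hN
      have : (N : ℝ) ≤ n := by exact_mod_cast hn
      nlinarith
    rw [h1, min_eq_left h3, sub_self, enorm_zero]

end MomentSpace

/-- A closed ideal that contains a function that is positive almost everywhere is the whole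
space. -/
theorem eq_top_of_isClosed_of_pos {c : ℝ≥0} {α : ℝ} {J : Submodule ℝ (MomentSpace c α)}
    (hJ : IsClosed (J : Set (MomentSpace c α))) (hideal : ∀ f ∈ J, ∀ g, |g| ≤ |f| → g ∈ J)
    {u : MomentSpace c α} (huJ : u ∈ J) (hu : ∀ᵐ x ∂momentMeasure c α, 0 < u x) : J = ⊤ := by
  have hu0 : 0 ≤ u := (Lp.coeFn_nonneg u).1 (hu.mono fun x hx => le_of_lt hx)
  have hpos : ∀ f, 0 ≤ f → f ∈ J := by
    intro f hf
    refine hJ.mem_of_tendsto (MomentSpace.tendsto_inf_smul hf hu) (Eventually.of_forall fun n => ?_)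
    have hnu : 0 ≤ (n : ℝ) • u := smul_nonneg n.cast_nonneg hu0
    refine hideal _ (J.smul_mem (n : ℝ) huJ) _ ?_
    rw [abs_of_nonneg (le_inf hf hnu), abs_of_nonneg hnu]
    exact inf_le_right
  refine (Submodule.eq_top_iff').2 fun f => ?_
  rw [← posPart_sub_negPart f]
  exact J.sub_mem (hpos _ (posPart_nonneg f)) (hpos _ (negPart_nonneg f))

/-- A closed subspace invariant under a semigroup is invariant under the resolvents of its
generator. -/
theorem C0Semigroup.resolvent_mem_of_invariant {E : Type*} [NormedAddCommGroup E] [NormedSpace ℝ E]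
    [CompleteSpace E] {S : C0Semigroup E} {K l : ℝ}
    (hK : ∀ t : ℝ≥0, ‖S.toFun t‖ ≤ Real.exp (K * t)) (hl : K < l) {R : E →L[ℝ] E}
    (hR : IsResolvent S.generator l R) {J : Submodule ℝ E} (hJ : IsClosed (J : Set E))
    (hinv : ∀ t, ∀ f ∈ J, S.toFun t f ∈ J) {f : E} (hf : f ∈ J) : R f ∈ J := by
  obtain ⟨R', hR', hR'f⟩ := exists_isResolvent_laplace hK hl
  obtain rfl := hR'.unique hR
  have : CompleteSpace J := hJ.completeSpace_coe
  let φ : ℝ → J := fun t =>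
    ⟨Real.exp (-l * t) • S.toFun t.toNNReal f, J.smul_mem _ (hinv _ f hf)⟩
  have hφc : Continuous φ := by
    have := S.continuous_orbit_toNNReal f
    exact Continuous.subtype_mk (by fun_prop) _
  have hφ : IntegrableOn φ (Ioi 0) :=
    ⟨hφc.aestronglyMeasurable, (integrableOn_laplace hK hl f).1.2⟩
  have h1 := J.subtypeL.integral_comp_comm hφ
  rw [hR'f]
  have h2 : ∫ t in Ioi (0 : ℝ), Real.exp (-l * t) • S.toFun t.toNNReal f =
      ((∫ t in Ioi (0 : ℝ), φ t : J) : E) := h1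
  rw [h2]
  exact Subtype.mem _

/-! ### Absence of gaps in the fragmentation kernel -/

section Gap

variable {a : ℝ → ℝ} {b : ℝ → ℝ → ℝ}

theorem essSupport_nonempty {f : ℝ → ℝ} {s : Set ℝ} (hs : s ⊆ Ioi 0) (hsm : MeasurableSet s)
    (hf : ¬ ∀ᵐ x ∂volume.restrict s, f x = 0) : (essSupport f).Nonempty := by
  by_contra hcon
  rw [not_nonempty_iff_eq_empty] at hcon
  have h1 : volume {z : ℝ | 0 < z ∧ f z ≠ 0} = 0 := by
    refine measure_null_of_locally_null _ fun x _ => ?_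
    have hx : x ∉ essSupport f := by rw [hcon]; exact notMem_empty x
    simp only [essSupport, mem_ofPred_eq, not_forall, not_lt, nonpos_iff_eq_zero] at hx
    obtain ⟨N, hN, hN0⟩ := hx
    exact ⟨_, inter_mem (mem_nhdsWithin_of_mem_nhds hN) self_mem_nhdsWithin, hN0⟩
  refine hf ?_
  rw [ae_restrict_iff' hsm]
  refine measure_mono_null ?_ h1
  intro x hx
  simp only [mem_compl_iff, mem_ofPred_eq, Classical.not_imp] at hx ⊢
  exact ⟨hs hx.1, hx.2⟩

/-- Under either alternative, particles of sizes below `z` can only fail to be produced by those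
above `z₀` if `z ≤ p z₀`, for some fixed `p < 1`. -/
theorem exists_le_mul_of_gap
    (hb_meas : AEMeasurable (Function.uncurry b) (volume.restrict (Ioi 0 ×ˢ Ioi 0)))
    (hb_mass : ∀ y, 0 < y →
      ∫⁻ x in Ioo 0 y, ENNReal.ofReal (x * b x y) = ENNReal.ofReal y)
    (h_alt : (∀ x, 0 < x → ¬ BddAbove (essSupport fun y => a y * b x y)) ∨
      ((∀ᵐ y ∂volume.restrict (Ioi 0), 0 < a y) ∧
        ∃ p : ℝ, 0 ≤ p ∧ p < 1 ∧
          ∀ y, 0 < y → sInf (essSupport fun x => b x y) ≤ p * y)) :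
    ∃ p : ℝ, 0 ≤ p ∧ p < 1 ∧ ∀ z z₀ : ℝ, 0 < z → z ≤ z₀ →
      (∀ᵐ x ∂volume.restrict (Ioo 0 z), ∀ᵐ y ∂volume.restrict (Ioi z₀), a y * b x y = 0) →
      z ≤ p * z₀ := by
  have hne : ∀ u v : ℝ, u < v → (ae (volume.restrict (Ioo u v))).NeBot := fun u v huv => by
    rw [ae_neBot, Ne, Measure.restrict_eq_zero, Real.volume_Ioo]
    simpa using huv
  rcases h_alt with h | ⟨ha, p, hp0, hp1, hp⟩
  · refine ⟨0, le_rfl, one_pos, fun z z₀ hz _ hgap => ?_⟩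
    have := hne 0 z hz
    obtain ⟨x, hx, hx0⟩ := (hgap.and (ae_restrict_mem measurableSet_Ioo)).exists
    refine (h x hx0.1 ⟨z₀, fun w hw => ?_⟩).elim
    by_contra hcon
    refine (hw (Ioi z₀) (Ioi_mem_nhds (not_le.1 hcon))).ne' ?_
    rw [ae_restrict_iff' measurableSet_Ioi] at hx
    refine measure_mono_null ?_ hx
    intro y hy
    simp only [mem_compl_iff, mem_ofPred_eq, Classical.not_imp]
    exact ⟨hy.1, hy.2.2⟩
  · refine ⟨p, hp0, hp1, fun z z₀ hz hzz hgap => ?_⟩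
    have hz₀ : 0 < z₀ := hz.trans_le hzz
    set ν₁ := (volume : Measure ℝ).restrict (Ioo 0 z)
    set ν₂ := (volume : Measure ℝ).restrict (Ioi z₀)
    have hbm : AEMeasurable (Function.uncurry b) (ν₁.prod ν₂) := by
      rw [Measure.prod_restrict, ← Measure.volume_eq_prod]
      exact hb_meas.mono_measure (Measure.restrict_mono
        (Set.prod_mono Ioo_subset_Ioi_self (Ioi_subset_Ioi hz₀.le)) le_rfl)
    have h1 : ∀ᵐ x ∂ν₁, ∀ᵐ y ∂ν₂, b x y = 0 := by
      filter_upwards [hgap] with x hx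
      filter_upwards [hx, ae_restrict_of_ae_restrict_of_subset (Ioi_subset_Ioi hz₀.le) ha]
        with y e1 e2
      exact (mul_eq_zero.1 e1).resolve_left e2.ne'
    have h2 : ∀ᵐ q ∂ν₁.prod ν₂, Function.uncurry b q = 0 := by
      have h3 : ∫⁻ q, ‖Function.uncurry b q‖ₑ ∂ν₁.prod ν₂ = 0 := by
        rw [lintegral_prod _ hbm.enorm]
        refine (lintegral_congr_ae ?_).trans lintegral_zero
        filter_upwards [h1] with x hx
        refine (lintegral_congr_ae ?_).trans lintegral_zero
        filter_upwards [hx] with y hy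
        simp [Function.uncurry, hy]
      rw [lintegral_eq_zero_iff' hbm.enorm] at h3
      filter_upwards [h3] with q hq
      simpa using hq
    have h3 : ∀ᵐ y ∂ν₂, ∀ᵐ x ∂ν₁, b x y = 0 :=
      Measure.ae_ae_of_ae_prod
        ((Measure.measurePreserving_swap (μ := ν₂) (ν := ν₁)).quasiMeasurePreserving.ae h2)
    have h4 : ∀ᵐ y ∂ν₂, z ≤ p * y := by
      filter_upwards [h3, ae_restrict_mem measurableSet_Ioi] with y hy hy0
      have hy0 : 0 < y := hz₀.trans hy0
      refine le_trans (le_csInf ?_ fun x hx => ?_) (hp y hy0)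
      · refine essSupport_nonempty (s := Ioo 0 y) Ioo_subset_Ioi_self measurableSet_Ioo fun hcon => ?_
        have h5 : ∫⁻ x in Ioo 0 y, ENNReal.ofReal (x * b x y) = 0 := by
          refine (lintegral_congr_ae ?_).trans lintegral_zero
          filter_upwards [hcon] with x hx
          simp [hx]
        rw [hb_mass y hy0, ENNReal.ofReal_eq_zero] at h5
        exact absurd h5 (not_le.2 hy0)
      · by_contra hcon
        refine (hx (Iio z) (Iio_mem_nhds (not_le.1 hcon))).ne' ?_
        rw [ae_restrict_iff' measurableSet_Ioo] at hy
        refine measure_mono_null ?_ hy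
        intro w hw
        simp only [mem_compl_iff, mem_ofPred_eq, Classical.not_imp]
        exact ⟨⟨hw.2.1, hw.1⟩, hw.2.2⟩
    by_contra hcon
    rw [not_le] at hcon
    -- choose `y > z₀` so close to `z₀` that still `p * y < z`
    have := hne z₀ (z₀ + (z - p * z₀)) (by linarith)
    obtain ⟨y, e1, e2⟩ := ((ae_restrict_of_ae_restrict_of_subset (Ioo_subset_Ioi_self) h4).and
      (ae_restrict_mem (μ := volume)
        (measurableSet_Ioo (a := z₀) (b := z₀ + (z - p * z₀))))).exists
    have e3 := e2.2
    nlinarith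

end Gap

/-! ### The generation conditions -/

section Generation

variable {a : ℝ → ℝ} {b : ℝ → ℝ → ℝ} {c : ℝ≥0} {α : ℝ}

/-- The two generation conditions combined: `a n / w ≤ θ a + D` with some `θ < 1`. Where `a` is
large this is the condition on the limit superior, elsewhere it is the boundedness of `n / w`. -/
theorem exists_mul_momentRatio_le (ha0 : ∀ y, 0 < y → 0 ≤ a y)
    (h_bdd : (⨆ y ∈ Ioi (0 : ℝ), momentRatio c α b y) < ∞)
    (h_limsup : limsup (momentRatio c α b) (comap a atTop ⊓ 𝓟 (Ioi 0)) < 1) :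
    ∃ θ D : ℝ, 0 < θ ∧ θ < 1 ∧ 0 ≤ D ∧ ∀ y, 0 < y →
      ENNReal.ofReal (a y) * momentRatio c α b y ≤ ENNReal.ofReal (θ * a y + D) := by
  obtain ⟨q, hq, hq1⟩ := exists_between h_limsup
  have hev := eventually_lt_of_limsup_lt hq
  rw [eventually_inf_principal, eventually_comap] at hev
  obtain ⟨N, hN⟩ := eventually_atTop.1 hev
  set s := ⨆ y ∈ Ioi (0 : ℝ), momentRatio c α b y with hs
  have hsy : ∀ y, 0 < y → momentRatio c α b y ≤ s := fun y hy =>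
    le_iSup₂ (f := fun y (_ : y ∈ Ioi (0 : ℝ)) => momentRatio c α b y) y hy
  have hqr : q.toReal < 1 := by
    simpa using (ENNReal.toReal_lt_toReal (hq1.trans ENNReal.one_lt_top).ne ENNReal.one_ne_top).2 hq1
  have hq0 : 0 ≤ q.toReal := ENNReal.toReal_nonneg
  have hs0 : 0 ≤ s.toReal := ENNReal.toReal_nonneg
  refine ⟨(q.toReal + 1) / 2, |N| * s.toReal, by linarith, by linarith, by positivity,
    fun y hy => ?_⟩
  have hay := ha0 y hy
  rcases le_total N (a y) with h | h
  · have h1 := (hN (a y) h y rfl hy).le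
    calc _ ≤ ENNReal.ofReal (a y) * ENNReal.ofReal q.toReal := by
          rw [ENNReal.ofReal_toReal (hq1.trans ENNReal.one_lt_top).ne]; gcongr
      _ = ENNReal.ofReal (a y * q.toReal) := (ENNReal.ofReal_mul hay).symm
      _ ≤ _ := by
          refine ENNReal.ofReal_le_ofReal ?_
          have : 0 ≤ |N| * s.toReal := by positivity
          nlinarith
  · calc _ ≤ ENNReal.ofReal (a y) * ENNReal.ofReal s.toReal := by
          rw [ENNReal.ofReal_toReal h_bdd.ne]; gcongr; exact hsy y hy
      _ = ENNReal.ofReal (a y * s.toReal) := (ENNReal.ofReal_mul hay).symm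
      _ ≤ _ := by
          refine ENNReal.ofReal_le_ofReal ?_
          have h2 : a y * s.toReal ≤ |N| * s.toReal := by
            gcongr; exact h.trans (le_abs_self N)
          nlinarith

theorem lintegral_mul_add_mul (ha0 : ∀ y, 0 < y → 0 ≤ a y) {u : MomentSpace c α} (hu : 0 ≤ u) {θ k : ℝ} (hθ : 0 ≤ θ)
    (hk : 0 ≤ k) :
    ∫⁻ y, ENNReal.ofReal (θ * a y + k) * ENNReal.ofReal (u y) ∂momentMeasure c α =
      ENNReal.ofReal θ * ∫⁻ y, ENNReal.ofReal (a y) * ENNReal.ofReal (u y) ∂momentMeasure c α +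
        ENNReal.ofReal k * ‖u‖ₑ := by
  have hum : Measurable fun y => ENNReal.ofReal (u y) :=
    (Lp.stronglyMeasurable u).measurable.ennreal_ofReal
  rw [← MomentSpace.lintegral_ofReal_eq hu, ← lintegral_const_mul' _ _ ENNReal.ofReal_ne_top,
    ← lintegral_const_mul' _ _ ENNReal.ofReal_ne_top,
    ← lintegral_add_right _ (hum.const_mul _)]
  refine lintegral_congr_ae ?_
  filter_upwards [ae_momentMeasure_pos c α] with y hy
  rw [ENNReal.ofReal_add (mul_nonneg hθ (ha0 y hy)) hk, ENNReal.ofReal_mul hθ]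
  ring

/-- If `u` is the resolvent at `f ≥ 0` of the growth semigroup, so that `‖a u‖ + κ ‖u‖ ≤ ‖f‖`, then
the generation condition makes `B u` exist and bounds it. -/
theorem norm_fragmentation_le (ha : AEMeasurable a (volume.restrict (Ioi 0)))
    (ha0 : ∀ y, 0 < y → 0 ≤ a y)
    (hb : AEMeasurable (Function.uncurry b) (volume.restrict (Ioi 0 ×ˢ Ioi 0)))
    (hb0 : ∀ x y, 0 < x → 0 < y → 0 ≤ b x y) {θ D κ : ℝ} (hθ : 0 ≤ θ) (hD : 0 ≤ D) (hκ : 0 ≤ κ)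
    (hn : ∀ y, 0 < y →
      ENNReal.ofReal (a y) * momentRatio c α b y ≤ ENNReal.ofReal (θ * a y + D))
    {f u : MomentSpace c α} (hu : 0 ≤ u)
    (hfu : ∫⁻ y, ENNReal.ofReal (a y + κ) * ENNReal.ofReal (u y) ∂momentMeasure c α ≤ ‖f‖ₑ) :
    ∃ hdom : u ∈ (fragmentation c α a b).domain,
      ‖fragmentation c α a b ⟨u, hdom⟩‖ ≤ θ * (‖f‖ - κ * ‖u‖) + D * ‖u‖ ∧ κ * ‖u‖ ≤ ‖f‖ := by
  set A := ∫⁻ y, ENNReal.ofReal (a y) * ENNReal.ofReal (u y) ∂momentMeasure c α with hA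
  have h1 := lintegral_mul_add_mul ha0 hu zero_le_one hκ
  simp only [one_mul, ENNReal.ofReal_one] at h1
  rw [h1, ← hA] at hfu
  have hAtop : A ≠ ∞ := ((le_self_add.trans hfu).trans_lt enorm_lt_top).ne
  have h2 : A.toReal + κ * ‖u‖ ≤ ‖f‖ := by
    have := ENNReal.toReal_mono enorm_ne_top hfu
    rwa [ENNReal.toReal_add hAtop (ENNReal.mul_ne_top ENNReal.ofReal_ne_top enorm_ne_top),
      ENNReal.toReal_mul, ENNReal.toReal_ofReal hκ, toReal_enorm, toReal_enorm] at this
  have h3 : ∫⁻ y, ENNReal.ofReal (a y) * ENNReal.ofReal (u y) * momentRatio c α b y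
      ∂momentMeasure c α ≤ ENNReal.ofReal θ * A + ENNReal.ofReal D * ‖u‖ₑ := by
    rw [hA, ← lintegral_mul_add_mul ha0 hu hθ hD]
    refine lintegral_mono_ae ?_
    filter_upwards [ae_momentMeasure_pos c α] with y hy
    rw [mul_right_comm]
    gcongr
    exact hn y hy
  have h4 : ENNReal.ofReal θ * A + ENNReal.ofReal D * ‖u‖ₑ ≠ ∞ :=
    ENNReal.add_ne_top.2 ⟨ENNReal.mul_ne_top ENNReal.ofReal_ne_top hAtop,
      ENNReal.mul_ne_top ENNReal.ofReal_ne_top enorm_ne_top⟩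
  obtain ⟨hdom, h5⟩ := inFragmentationDomain_of_lintegral_lt_top ha ha0 hb hb0 hu
    (h3.trans_lt h4.lt_top)
  refine ⟨hdom, ?_, ?_⟩
  · have h6 : ‖fragmentation c α a b ⟨u, hdom⟩‖ₑ ≤
        ENNReal.ofReal θ * A + ENNReal.ofReal D * ‖u‖ₑ := by
      refine (le_of_eq ?_).trans (h5.trans h3)
      rw [MomentSpace.enorm_eq]
      refine lintegral_congr_ae ?_
      filter_upwards [fragmentation_coeFn (a := a) (b := b) ⟨u, hdom⟩] with x hx
      rw [hx]
    have h7 := ENNReal.toReal_mono h4 h6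
    rw [ENNReal.toReal_add (ENNReal.mul_ne_top ENNReal.ofReal_ne_top hAtop)
      (ENNReal.mul_ne_top ENNReal.ofReal_ne_top enorm_ne_top), ENNReal.toReal_mul,
      ENNReal.toReal_mul, ENNReal.toReal_ofReal hθ, ENNReal.toReal_ofReal hD, toReal_enorm,
      toReal_enorm] at h7
    have h8 : θ * A.toReal ≤ θ * (‖f‖ - κ * ‖u‖) :=
      mul_le_mul_of_nonneg_left (by linarith) hθ
    linarith
  · have : 0 ≤ A.toReal := ENNReal.toReal_nonneg
    linarith

end Generation

/-! ### Strict positivity -/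

/-- Let `u = R (g + B u)`, where `R` spreads positivity to all larger sizes. If fragmentation leaves
no gap, then `u` is positive almost everywhere: otherwise let `z₀` be the largest size below which
`g + B u` vanishes. Then `u` is positive above `z₀`, while particles above `z₀` produce none
below `z₀`. -/
theorem ae_pos_of_no_gap {a : ℝ → ℝ} {b : ℝ → ℝ → ℝ} {c : ℝ≥0} {α : ℝ}
    (ha0 : ∀ y, 0 < y → 0 ≤ a y) (hb0 : ∀ x y, 0 < x → 0 < y → 0 ≤ b x y)
    (hgap : ∃ p : ℝ, 0 ≤ p ∧ p < 1 ∧ ∀ z z₀ : ℝ, 0 < z → z ≤ z₀ →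
      (∀ᵐ x ∂volume.restrict (Ioo 0 z), ∀ᵐ y ∂volume.restrict (Ioi z₀), a y * b x y = 0) →
      z ≤ p * z₀)
    {g : MomentSpace c α} (hg : 0 ≤ g) (hg0 : g ≠ 0) (u : (fragmentation c α a b).domain)
    (hu : 0 ≤ (u : MomentSpace c α))
    (hspread : ∀ z : ℝ, (¬ ∀ᵐ x ∂volume.restrict (Ioo 0 z),
      (g + fragmentation c α a b u : MomentSpace c α) x = 0) →
      ∀ᵐ y ∂momentMeasure c α, z ≤ y → 0 < (u : MomentSpace c α) y) :
    ∀ᵐ y ∂momentMeasure c α, 0 < (u : MomentSpace c α) y := by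
  obtain ⟨p, hp0, hp1, hp⟩ := hgap
  set v : MomentSpace c α := g + fragmentation c α a b u with hv
  have hBu := fragmentation_nonneg ha0 hb0 u hu
  have hvsum : ∀ᵐ x ∂momentMeasure c α, 0 ≤ g x ∧ 0 ≤ fragmentationFun a b u x ∧
      v x = g x + fragmentationFun a b u x := by
    filter_upwards [(Lp.coeFn_nonneg g).2 hg, (Lp.coeFn_nonneg _).2 hBu, fragmentation_coeFn u,
      Lp.coeFn_add g (fragmentation c α a b u)] with x h1 h2 h3 h4
    rw [h3] at h2
    rw [Pi.add_apply, h3] at h4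
    exact ⟨h1, h2, h4⟩
  let S : Set ℝ := {z | 0 < z ∧ ∀ᵐ x ∂volume.restrict (Ioo 0 z), v x = 0}
  have habove : ∀ z₀, 0 ≤ z₀ → (∀ z ∈ S, z ≤ z₀) →
      ∀ᵐ y ∂momentMeasure c α, z₀ < y → 0 < (u : MomentSpace c α) y := by
    intro z₀ hz₀ hS
    have h1 : ∀ᵐ y ∂momentMeasure c α, ∀ n : ℕ, z₀ + 1 / ((n : ℝ) + 1) ≤ y →
        0 < (u : MomentSpace c α) y := by
      rw [ae_all_iff]
      intro n
      have hn : 0 < 1 / ((n : ℝ) + 1) := by positivity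
      refine hspread _ fun hcon => ?_
      have := hS _ ⟨by linarith, hcon⟩
      linarith
    filter_upwards [h1] with y hy hzy
    obtain ⟨n, hn⟩ := exists_nat_one_div_lt (sub_pos.2 hzy)
    exact hy n (by linarith)
  rcases S.eq_empty_or_nonempty with hS | hS
  · filter_upwards [habove 0 le_rfl (by simp [hS]), ae_momentMeasure_pos c α] with y h1 h2
    exact h1 h2
  have hbdd : BddAbove S := by
    by_contra hcon
    refine hg0 ((Lp.eq_zero_iff_ae_eq_zero).2 ?_)
    have h1 : ∀ᵐ x ∂momentMeasure c α, ∀ n : ℕ, x < (n : ℝ) → v x = 0 := by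
      rw [ae_all_iff]
      intro n
      obtain ⟨z, hz, hnz⟩ := not_bddAbove_iff.1 hcon n
      rw [ae_momentMeasure_iff, ae_restrict_iff' measurableSet_Ioi]
      filter_upwards [(ae_restrict_iff' measurableSet_Ioo).1 hz.2] with x hx hx0 hxn
      exact hx ⟨hx0, hxn.trans hnz⟩
    filter_upwards [h1, hvsum] with x hx hx'
    obtain ⟨n, hn⟩ := exists_nat_gt x
    have := hx n hn
    rw [Pi.zero_apply]
    linarith
  set z₀ := sSup S with hz₀
  have hzz : ∀ z ∈ S, z ≤ z₀ := fun z hz => le_csSup hbdd hz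
  obtain ⟨z₁, hz₁⟩ := hS
  have hz₀0 : 0 < z₀ := hz₁.1.trans_le (hzz z₁ hz₁)
  have hle : z₀ ≤ p * z₀ := by
    refine csSup_le ⟨z₁, hz₁⟩ fun z hz => hp z z₀ hz.1 (hzz z hz) ?_
    filter_upwards [hz.2, ae_restrict_mem measurableSet_Ioo,
      ae_restrict_of_ae_restrict_of_subset Ioo_subset_Ioi_self ((ae_momentMeasure_iff c α).1 hvsum),
      ae_restrict_of_ae_restrict_of_subset Ioo_subset_Ioi_self ((ae_momentMeasure_iff c α).1 u.2.1)]
      with x h1 h2 h3 h4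
    have h5 : fragmentationFun a b u x = 0 := by linarith
    have h6 : 0 ≤ᵐ[volume.restrict (Ioi x)] fun y => a y * b x y * (u : MomentSpace c α) y := by
      filter_upwards [ae_restrict_of_ae_momentMeasure ((Lp.coeFn_nonneg _).2 hu) h2.1,
        ae_restrict_mem measurableSet_Ioi] with y hy hxy
      have hy0 : 0 < y := h2.1.trans hxy
      exact mul_nonneg (mul_nonneg (ha0 y hy0) (hb0 x y h2.1 hy0)) hy
    have h7 := (integral_eq_zero_iff_of_nonneg_ae h6 h4).1 h5
    have hxz : x ≤ z₀ := h2.2.le.trans (hzz z hz)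
    filter_upwards [ae_restrict_of_ae_restrict_of_subset (Ioi_subset_Ioi hxz) h7,
      ae_restrict_of_ae_momentMeasure (habove z₀ hz₀0.le hzz) hz₀0,
      ae_restrict_mem measurableSet_Ioi] with y e1 e2 e3
    exact (mul_eq_zero.1 e1).resolve_right (e2 e3).ne'
  nlinarith

/-! ### The growth–fragmentation semigroup -/

theorem mainTheorem3 (α : ℝ) (hα : 0 < α) (c : ℝ≥0)
    (r a : ℝ → ℝ) (b : ℝ → ℝ → ℝ)
    -- the growth rate
    (hr : ContinuousOn r (Ioi 0)) (hr_pos : ∀ x, 0 < x → 0 < r x)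
    (hr_infty : ¬ IntegrableOn (fun τ => 1 / r τ) (Ioi 1))
    -- the space `X_{0,α}` (`c = 1`) when `1 / r` is integrable near zero,
    -- the space `X_α` (`c = 0`) when it is not
    (hcase : (c = 1 ∧ IntegrableOn (fun τ => 1 / r τ) (Ioc 0 1)) ∨
      (c = 0 ∧ ¬ IntegrableOn (fun τ => 1 / r τ) (Ioc 0 1)))
    (hr_growth : ∃ C : ℝ, 0 < C ∧ ∀ z, 0 < z → r z ≤ C * (c + z))
    -- the total fragmentation rate
    (ha_nonneg : ∀ y, 0 < y → 0 ≤ a y) (ha_loc : LocallyIntegrableOn a (Ioi 0))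
    -- the fragmentation kernel
    (hb_meas : AEMeasurable (Function.uncurry b) (volume.restrict (Ioi 0 ×ˢ Ioi 0)))
    (hb_nonneg : ∀ x y, 0 < x → 0 < y → 0 ≤ b x y)
    (hb_zero : ∀ x y, 0 < y → y ≤ x → b x y = 0)
    (hb_mass : ∀ y, 0 < y →
      ∫⁻ x in Ioo 0 y, ENNReal.ofReal (x * b x y) = ENNReal.ofReal y)
    -- the generation conditions
    (h_bdd : (⨆ y ∈ Ioi (0 : ℝ), momentRatio c α b y) < ∞)
    (h_limsup : limsup (momentRatio c α b) (comap a atTop ⊓ 𝓟 (Ioi 0)) < 1)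
    -- the alternative
    (h_alt : (∀ x, 0 < x → ¬ BddAbove (essSupport fun y => a y * b x y)) ∨
      ((∀ᵐ y ∂volume.restrict (Ioi 0), 0 < a y) ∧
        ∃ p : ℝ, 0 ≤ p ∧ p < 1 ∧
          ∀ y, 0 < y → sInf (essSupport fun x => b x y) ≤ p * y)) :
    ∃ U V : C0Semigroup (MomentSpace c α),
      IsGrowthAbsorptionSemigroup r a U ∧
      U.generator.domain ≤ (fragmentation c α a b).domain ∧
      V.generator = U.generator + fragmentation c α a b ∧
      V.IsPositive ∧
      (∃ ω : ℝ, Ioi ω ⊆ realResolventSet (U.generator + fragmentation c α a b)) ∧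
      (∀ l : ℝ, Ici l ⊆ realResolventSet (U.generator + fragmentation c α a b) →
        ∀ R, IsResolvent (U.generator + fragmentation c α a b) l R →
          IsPositivityImproving R) ∧
      V.IsIrreducible := by
  obtain ⟨C, hC, hrC⟩ := hr_growth
  have h : IsGrowthRate r := ⟨hr, hr_pos, hr_infty⟩
  obtain ⟨U, hUK, hU⟩ := h.exists_growthSemigroup (c := c) hα.le hrC ha_loc ha_nonneg
  have ham : AEMeasurable a (volume.restrict (Ioi 0)) := ha_loc.aestronglyMeasurable.aemeasurable
  obtain ⟨θ, D, hθ0, hθ1, hD, hn⟩ := exists_mul_momentRatio_le ha_nonneg h_bdd h_limsup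
  set T := U.generator with hT
  set B := fragmentation c α a b with hB
  set K := α * C with hK
  have hK0 : 0 < K := mul_pos hα hC
  have hRex : ∀ l, K < l → ∃ R, IsResolvent T l R := fun l hl =>
    (C0Semigroup.exists_isResolvent_laplace hUK hl).imp fun _ hR => hR.1
  have hest : ∀ l, K < l → ∀ R, IsResolvent T l R → ∀ f, 0 ≤ f → ∃ hf : R f ∈ B.domain,
      ‖B ⟨R f, hf⟩‖ ≤ θ * (‖f‖ - (l - K) * ‖R f‖) + D * ‖R f‖ ∧ (l - K) * ‖R f‖ ≤ ‖f‖ := by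
    intro l hl R hR f hf
    obtain ⟨h1, h2⟩ := h.ofReal_resolvent_apply ha_loc hUK hU hl hR hf
    exact norm_fragmentation_le ham ha_nonneg hb_meas hb_nonneg hθ0.le hD (sub_pos.2 hl).le hn h1
      (h.lintegral_resolvent_le hα.le hrC ha_loc ha_nonneg hl hf h2)
  have hdom : T.domain ≤ B.domain := by
    intro u hu
    obtain ⟨R, hR⟩ := hRex (K + 1) (lt_add_one K)
    have h1 := hR.2 ⟨u, hu⟩
    rw [← posPart_sub_negPart ((K + 1) • u - T ⟨u, hu⟩), map_sub] at h1
    change _ = u at h1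
    rw [← h1]
    exact B.domain.sub_mem (hest _ (lt_add_one K) R hR _ (posPart_nonneg _)).1
      (hest _ (lt_add_one K) R hR _ (negPart_nonneg _)).1
  have hB0 : ∀ f : B.domain, 0 ≤ (f : MomentSpace c α) → 0 ≤ B f :=
    fragmentation_nonneg ha_nonneg hb_nonneg
  -- beyond `ω` the gain `D ‖u‖` is compensated by the discount `(l - K) ‖u‖`
  set ω := K + D / θ + D with hω
  have hDθ : 0 ≤ D / θ := by positivity
  have hω0 : 0 < ω := by linarith
  have hKω : K ≤ ω := by linarith
  have hQex : ∀ l, ω < l → ∃ Q, IsResolvent (T + B) l Q ∧ (∀ f, 0 ≤ f → 0 ≤ Q f) ∧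
      ‖Q‖ ≤ 1 / (l - ω) := by
    intro l hl
    have hKl := hKω.trans_lt hl
    obtain ⟨R, hR⟩ := hRex l hKl
    refine exists_isResolvent_add MomentSpace.norm_add_of_nonneg hl hR
      (fun f hf => (h.ofReal_resolvent_apply ha_loc hUK hU hKl hR hf).1) hdom hB0 hθ0.le hθ1
      fun f hf hRf => ?_
    obtain ⟨_, h1, h2⟩ := hest l hKl R hR f hf
    have h3 : 0 ≤ ‖R f‖ := norm_nonneg _
    have h4 : D ≤ θ * (l - K) := by
      have : θ * (D / θ) = D := by field_simp
      nlinarith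
    have h5 : 0 ≤ (θ * (l - K) - D) * ‖R f‖ := mul_nonneg (sub_nonneg.2 h4) h3
    refine ⟨by linarith, ?_⟩
    have h6 : (1 - θ) * ((l - K) * ‖R f‖) ≤ (1 - θ) * ‖f‖ :=
      mul_le_mul_of_nonneg_left h2 (by linarith)
    have h7 : 0 ≤ D / θ * ‖R f‖ := mul_nonneg hDθ h3
    have h8 : (l - ω) * ‖R f‖ = (l - K) * ‖R f‖ - D / θ * ‖R f‖ - D * ‖R f‖ := by rw [hω]; ring
    linarith
  choose! Q hQ hQ0 hQn using hQex
  have hdense : Dense ((T + B).domain : Set (MomentSpace c α)) := by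
    have h1 : (T + B).domain = T.domain := inf_eq_left.2 hdom
    rw [h1]
    exact C0Semigroup.dense_generator_domain U
  obtain ⟨V, hVgen, hVn, hV⟩ := exists_c0Semigroup_of_norm_resolvent_le hdense hω0 hQ hQn
  have himp : ∀ l, ω < l → IsPositivityImproving (Q l) := by
    intro l hl g hg hg0
    have hKl := hKω.trans_lt hl
    obtain ⟨R, hR⟩ := hRex l hKl
    obtain ⟨hTB, hu⟩ := (hQ l hl).1 g
    have hfix : R (g + B ⟨Q l g, hTB.2⟩) = Q l g := by
      have h1 := hR.2 ⟨Q l g, hTB.1⟩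
      have h2 : (T + B) ⟨Q l g, hTB⟩ = T ⟨Q l g, hTB.1⟩ + B ⟨Q l g, hTB.2⟩ := rfl
      have h3 : g + B ⟨Q l g, hTB.2⟩ = l • Q l g - T ⟨Q l g, hTB.1⟩ := by
        nth_rewrite 1 [← hu]
        rw [h2]
        abel
      rw [h3]
      exact h1
    have hu0 := hQ0 l hl g hg
    have hv0 : 0 ≤ g + B ⟨Q l g, hTB.2⟩ := add_nonneg hg (hB0 _ hu0)
    refine ae_pos_of_no_gap ha_nonneg hb_nonneg (exists_le_mul_of_gap hb_meas hb_mass h_alt) hg hg0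
      ⟨Q l g, hTB.2⟩ hu0 fun z hz => ?_
    have h1 := h.resolvent_pos_of_lt ha_loc hv0
      (h.ofReal_resolvent_apply ha_loc hUK hU hKl hR hv0).2 hz
    rwa [hfix] at h1
  refine ⟨U, V, h.isGrowthAbsorptionSemigroup ha_loc hU, hdom, hVgen, ?_,
    ⟨ω, fun l hl => ⟨Q l, hQ l hl⟩⟩, ?_, ?_⟩
  · intro t f hf
    refine ge_of_tendsto' (hV t f) fun n => exp_smul_yosida_nonneg _ t.coe_nonneg ?_ hf
    exact hQ0 _ (by have : (0 : ℝ) ≤ n := n.cast_nonneg; linarith)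
  · -- the resolvent decreases in `l`, so it suffices to compare with a large `l`
    intro l hl R hR g hg hg0
    have hlm : l ≤ max l ω + 1 := (le_max_left l ω).trans (le_add_of_nonneg_right zero_le_one)
    have hωm : ω < max l ω + 1 := lt_of_le_of_lt (le_max_right l ω) (lt_add_one _)
    have h1 := hR.sub_apply (hQ _ hωm) g
    have h2 : Q (max l ω + 1) g ≤ R g := by
      rw [← sub_nonneg, h1]
      refine smul_nonneg (sub_nonneg.2 hlm)
        (hR.nonneg_of_Ici_subset hl (M := ω) (fun m hm P hP f hf => ?_) (hQ0 _ hωm g hg))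
      rw [hP.unique (hQ m hm)]
      exact hQ0 m hm f hf
    filter_upwards [himp _ hωm g hg hg0, (Lp.coeFn_le _ _).2 h2] with x e1 e2
    exact e1.trans_le e2
  · intro J hJ hideal hinv
    refine or_iff_not_imp_left.2 fun hJ0 => ?_
    obtain ⟨f, hfJ, hf0⟩ := J.ne_bot_iff.1 hJ0
    have habs : |f| ∈ J := hideal f hfJ _ (abs_abs f).le
    have hl : ω < 2 * ω + 1 := by linarith
    refine eq_top_of_isClosed_of_pos hJ hideal
      (V.resolvent_mem_of_invariant hVn (lt_add_one _) (hVgen ▸ hQ _ hl) hJ hinv habs)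
      (himp _ hl _ (abs_nonneg f) fun h0 => hf0 ?_)
    rw [← norm_eq_zero, ← norm_abs_eq_norm, h0, norm_zero]
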